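/- **Setting.** Let $d\ge 1$. Fix a smooth compactly supported $\varphi:\mathbb R^d\to[0,1]$ with $\varphi=1$ on $\{|\xi|\le r\}$ and $\varphi=0$ on $\{|\xi|\ge 2r\}$ for some $r>0$, and let $S_{\le N}$ be the Fourier multiplier in $x$ with symbol $\varphi(2^{-N}\xi)$, $S_0=S_{\le 0}$, $S_{k}=S_{\le k}-S_{\le k-1}$ for $k\ge1$. For $l\in\mathbb N=\{0,1,2,\dots\}$ let $\mathcal Q_l$ be the partition of $\mathbb R^d$ into the cubes $Q=2^l(n+[0,1)^d)$, $n\in\mathbb Z^d$. Fix a smooth compactly supported $\chi\ge0$ with $\sum_{n\in\mathbb Z^d}\chi(x-n)=1$ for all $x$, and for $Q=2^j(n+[0,1)^d)\in\mathcal Q_j$ put $\chi_Q(x)=\chi(2^{-j}x-n)$. For $0<T\le1$ and space-time functions on $[0,T]\times\mathbb R^d$ define $$\|F\|_X=\sup_{l\ge0}\sup_{Q\in\mathcal Q_l}2^{-l/2}\|F\|_{L^2([0,T]\times Q)},$$ and let $Y$ be the atomic predual of $X$ ($X=Y^*$): $$\|F\|_Y=\inf\Big\{\sum_{l\ge0}\sum_{Q\in\mathcal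 Q_l}2^{l/2}\|a_Q\|_{L^2}:\ F=\sum_{l,Q}a_Q \text{ a.e.},\ \operatorname{supp}a_Q\subset[0,T]\times Q\Big\}.$$ Set $$\|F\|_{X_j}=\max\big(2^{j/2}\|F\|_X,\ \|F\|_{L^\infty_tL^2_x}\big),\qquad \|F\|_{Y_j}=\inf_{F=2^{j/2}F_1+F_2}\big(\|F_1\|_Y+\|F_2\|_{L^1_tL^2_x}\big),$$ and $\|F\|_{l^1_jU}=\sum_{Q\in\mathcal Q_j}\|\chi_QF\|_U$ for $U=X_j,Y_j$. For $s\in\mathbb R$ the spaces $l^1X^s$ and $l^1Y^s$ on $[0,T]$ consist of the (weakly measurable) time-dependent tempered distributions $u:[0,T]\to\mathcal S'(\mathbb R^d;\mathbb C)$ for which the respective norm $$\|u\|_{l^1X^s}=\Big(\sum_{j\ge0}2^{2js}\|S_ju\|_{l^1_jX_j}^2\Big)^{1/2},\qquad \|u\|_{l^1Y^s}=\Big(\sum_{j\ge0}2^{2js}\|S_ju\|_{l^1_jY_j}^2\Big)^{1/2}$$ is finite. The product $uv$ is the one of tempered distributions at almost every time, $uv=\lim_{N\to\infty}(S_{\le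 N}u)(S_{\le N}v)$ in $\mathcal S'(\mathbb R^d)$. **Proposition.** Let $s>\frac d2+2$. There are $\delta_0>0$ and $C>0$, depending only on $d$, $s$, $\varphi$ and $\chi$, such that for all $0\le\delta\le\delta_0$ and all $0<T\le1$ the following hold on the time interval $[0,T]$. 1. If $0\le\sigma\le s$, $u\in l^1X^{\sigma-1}$ and $v\in l^1X^{s-1}$, then the product $uv$ exists, belongs to $l^1Y^{\sigma-\delta}$, and $$\|uv\|_{l^1Y^{\sigma-\delta}}\le C\,T^\delta\,\|u\|_{l^1X^{\sigma-1}}\|v\|_{l^1X^{s-1}}.$$ 2. If $0\le\sigma\le s-1$, $u\in l^1X^{\sigma}$ and $v\in l^1X^{s-2}$, then the product $uv$ exists, belongs to $l^1Y^{\sigma-\delta}$, and $$\|uv\|_{l^1Y^{\sigma-\delta}}\le C\,T^\delta\,\|u\|_{l^1X^{\sigma}}\|v\|_{l^1X^{s-2}}.$$ -/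

import Mathlib

open MeasureTheory Filter Topology SchwartzMap FourierTransform
open scoped ENNReal ContDiff

noncomputable section

namespace LocalEnergy

/-- The physical space `ℝ^d`. -/
abbrev Space (d : ℕ) : Type := EuclideanSpace ℝ (Fin d)

/-! ### Littlewood-Paley decomposition -/

/-- The generating cutoff of an inhomogeneous Littlewood-Paley decomposition: a smooth compactly
supported `φ : ℝ^d → [0, 1]` with `φ = 1` for `|ξ| ≤ r` and `φ = 0` for `|ξ| ≥ 2 r`. The radius
`r > 0` is free, so that every normalisation of the Fourier variable is covered. -/
structure LPCutoff (d : ℕ) where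
  toSchwartz : 𝓢(Space d, ℂ)
  radius : ℝ
  radius_pos : 0 < radius
  range_Icc : ∀ ξ, ∃ c ∈ Set.Icc (0 : ℝ) 1, toSchwartz ξ = (c : ℂ)
  eq_one : ∀ ξ, ‖ξ‖ ≤ radius → toSchwartz ξ = 1
  eq_zero : ∀ ξ, 2 * radius ≤ ‖ξ‖ → toSchwartz ξ = 0

variable {d : ℕ}

/-- The symbol `ξ ↦ φ (2^{-N} ξ)`. -/
def LPCutoff.dilate (φ : LPCutoff d) (N : ℕ) : 𝓢(Space d, ℂ) :=
  compCLMOfContinuousLinearEquiv ℂ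
    (ContinuousLinearEquiv.smulLeft (Units.mk0 ((2 : ℝ) ^ (-(N : ℤ))) (by positivity)))
    φ.toSchwartz

/-- The smooth function `S_{≤ N} f = 𝓕⁻¹ (φ (2^{-N} ·) 𝓕 f)` for a tempered distribution `f`. Its
value at `x` is `f` applied to `y ↦ K (x - y)`, where `K` is the inverse Fourier transform of the
symbol; since `K (x - y)` is the Fourier transform of the symbol at `y - x`, the test function
below is exactly that one. -/
def lpLow (φ : LPCutoff d) (N : ℕ) (f : 𝓢'(Space d, ℂ)) (x : Space d) : ℂ :=
  f ((𝓕 (φ.dilate N)).compSubConstCLM ℂ x)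

/-- The Littlewood-Paley pieces: `S_0 = S_{≤ 0}` and `S_{k+1} = S_{≤ k+1} - S_{≤ k}`. -/
def lpPiece (φ : LPCutoff d) : ℕ → 𝓢'(Space d, ℂ) → Space d → ℂ
  | 0, f, x => lpLow φ 0 f x
  | k + 1, f, x => lpLow φ (k + 1) f x - lpLow φ k f x

/-- The space-time function `(t, x) ↦ (S_j u(t)) (x)`. -/
def spaceTimePiece (φ : LPCutoff d) (j : ℕ) (u : ℝ → 𝓢'(Space d, ℂ)) : ℝ × Space d → ℂ :=
  fun p => lpPiece φ j (u p.1) p.2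

/-! ### Dyadic cubes and the associated partitions of unity -/

/-- The point `n ∈ ℤ^d ⊂ ℝ^d`. -/
def latticePoint (n : Fin d → ℤ) : Space d := WithLp.toLp 2 (fun i => (n i : ℝ))

/-- The cubes of the partition `𝒬_l`: `Q_{l,n} = 2^l (n + [0,1)^d)`, `n ∈ ℤ^d`. -/
def cube (l : ℕ) (n : Fin d → ℤ) : Set (Space d) :=
  {x | ∀ i, (2 : ℝ) ^ l * n i ≤ x i ∧ x i < (2 : ℝ) ^ l * (n i + 1)}

/-- A smooth compactly supported `χ ≥ 0` whose integer translates sum to one. -/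
structure CubePartition (d : ℕ) where
  toFun : Space d → ℝ
  smooth : ContDiff ℝ ∞ toFun
  compact : HasCompactSupport toFun
  nonneg : ∀ x, 0 ≤ toFun x
  sum_eq_one : ∀ x, HasSum (fun n : Fin d → ℤ => toFun (x - latticePoint n)) 1

/-- The function `χ_Q (x) = χ (2^{-j} x - n)` of the cube `Q = Q_{j,n}`. For fixed `j` these form
the partition of unity associated with `𝒬_j`. -/
def CubePartition.cutoff (χ : CubePartition d) (j : ℕ) (n : Fin d → ℤ) (x : Space d) : ℝ :=
  χ.toFun ((2 : ℝ) ^ (-(j : ℤ)) • x - latticePoint n)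

/-- `χ_Q F` for a space-time function `F`. -/
def CubePartition.localize (χ : CubePartition d) (j : ℕ) (n : Fin d → ℤ)
    (F : ℝ × Space d → ℂ) : ℝ × Space d → ℂ :=
  fun p => (χ.cutoff j n p.2 : ℂ) * F p

/-! ### Norms of space-time functions on `[0, T] × ℝ^d`, with values in `[0, ∞]` -/

/-- Lebesgue measure on `[0, T]`. -/
def timeMeasure (T : ℝ) : Measure ℝ := volume.restrict (Set.Icc 0 T)

/-- Lebesgue measure on `[0, T] × ℝ^d`. -/
def slabMeasure (d : ℕ) (T : ℝ) : Measure (ℝ × Space d) :=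
  (timeMeasure T).prod (volume : Measure (Space d))

/-- The norm of `L^∞([0,T]; L^2(ℝ^d))`. -/
def normLinftyL2 (T : ℝ) (F : ℝ × Space d → ℂ) : ℝ≥0∞ :=
  essSup (fun t => eLpNorm (fun x => F (t, x)) 2 volume) (timeMeasure T)

/-- The norm of `L^1([0,T]; L^2(ℝ^d))`. -/
def normL1L2 (T : ℝ) (F : ℝ × Space d → ℂ) : ℝ≥0∞ :=
  ∫⁻ t, eLpNorm (fun x => F (t, x)) 2 volume ∂(timeMeasure T)

/-- The local energy norm `‖F‖_X = sup_l sup_{Q ∈ 𝒬_l} 2^{-l/2} ‖F‖_{L^2([0,T] × Q)}`. -/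
def normX (T : ℝ) (F : ℝ × Space d → ℂ) : ℝ≥0∞ :=
  ⨆ (l : ℕ) (n : Fin d → ℤ), (2 : ℝ≥0∞) ^ (-(l : ℝ) / 2) *
    eLpNorm F 2 ((timeMeasure T).prod (volume.restrict (cube l n)))

/-- The norm of the atomic space `Y`, the predual of `X`: the infimum of
`∑_{l, Q ∈ 𝒬_l} 2^{l/2} ‖a_Q‖_{L^2([0,T] × ℝ^d)}` over all decompositions `F = ∑_Q a_Q`
with `a_Q` supported in `[0,T] × Q`. -/
def normY (T : ℝ) (F : ℝ × Space d → ℂ) : ℝ≥0∞ :=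
  ⨅ (a : ℕ × (Fin d → ℤ) → ℝ × Space d → ℂ)
    (_ : ∀ q, AEStronglyMeasurable (a q) (slabMeasure d T))
    (_ : ∀ q p, p.2 ∉ cube q.1 q.2 → a q p = 0)
    (_ : ∀ᵐ p ∂(slabMeasure d T), HasSum (fun q => a q p) (F p)),
    ∑' q, (2 : ℝ≥0∞) ^ ((q.1 : ℝ) / 2) * eLpNorm (a q) 2 (slabMeasure d T)

/-- The norm of `X_j = 2^{-j/2} X ∩ L^∞ L^2`. -/
def normXj (T : ℝ) (j : ℕ) (F : ℝ × Space d → ℂ) : ℝ≥0∞ :=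
  max ((2 : ℝ≥0∞) ^ ((j : ℝ) / 2) * normX T F) (normLinftyL2 T F)

/-- The norm of `Y_j = 2^{j/2} Y + L^1 L^2`: the infimum of `‖F₁‖_Y + ‖F₂‖_{L^1 L^2}` over all
decompositions `F = 2^{j/2} F₁ + F₂`. -/
def normYj (T : ℝ) (j : ℕ) (F : ℝ × Space d → ℂ) : ℝ≥0∞ :=
  ⨅ (F₁ : ℝ × Space d → ℂ) (F₂ : ℝ × Space d → ℂ)
    (_ : AEStronglyMeasurable F₁ (slabMeasure d T))
    (_ : AEStronglyMeasurable F₂ (slabMeasure d T))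
    (_ : ∀ᵐ p ∂(slabMeasure d T), F p = (((2 : ℝ) ^ ((j : ℝ) / 2) : ℝ) : ℂ) * F₁ p + F₂ p),
    normY T F₁ + normL1L2 T F₂

/-- `‖F‖_{l^1_j U} = ∑_{Q ∈ 𝒬_j} ‖χ_Q F‖_U`. -/
def normL1j (χ : CubePartition d) (j : ℕ) (U : (ℝ × Space d → ℂ) → ℝ≥0∞)
    (F : ℝ × Space d → ℂ) : ℝ≥0∞ :=
  ∑' n : Fin d → ℤ, U (χ.localize j n F)

/-! ### The spaces `l^1 X^s` and `l^1 Y^s`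

The elements are time-dependent tempered distributions: for negative indices they need not be
functions. -/

/-- `‖u‖_{l^1 X^s} = (∑_j 2^{2js} ‖S_j u‖²_{l^1_j X_j})^{1/2}`. -/
def normL1X (φ : LPCutoff d) (χ : CubePartition d) (T s : ℝ) (u : ℝ → 𝓢'(Space d, ℂ)) : ℝ≥0∞ :=
  (∑' j : ℕ, (2 : ℝ≥0∞) ^ (2 * (j : ℝ) * s) *
    normL1j χ j (normXj T j) (spaceTimePiece φ j u) ^ 2) ^ (1 / 2 : ℝ)

/-- `‖f‖_{l^1 Y^s} = (∑_j 2^{2js} ‖S_j f‖²_{l^1_j Y_j})^{1/2}`. -/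
def normL1Y (φ : LPCutoff d) (χ : CubePartition d) (T s : ℝ) (f : ℝ → 𝓢'(Space d, ℂ)) : ℝ≥0∞ :=
  (∑' j : ℕ, (2 : ℝ≥0∞) ^ (2 * (j : ℝ) * s) *
    normL1j χ j (normYj T j) (spaceTimePiece φ j f) ^ 2) ^ (1 / 2 : ℝ)

/-- Measurability in time of a time-dependent tempered distribution on `[0, T]`. -/
def WeaklyMeasurable (T : ℝ) (u : ℝ → 𝓢'(Space d, ℂ)) : Prop :=
  ∀ θ : 𝓢(Space d, ℂ), AEMeasurable (fun t => u t θ) (timeMeasure T)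

/-- `u ∈ l^1 X^s` on the time interval `[0, T]`. -/
def MemL1X (φ : LPCutoff d) (χ : CubePartition d) (T s : ℝ) (u : ℝ → 𝓢'(Space d, ℂ)) : Prop :=
  WeaklyMeasurable T u ∧ normL1X φ χ T s u < ⊤

/-- `f ∈ l^1 Y^s` on the time interval `[0, T]`. -/
def MemL1Y (φ : LPCutoff d) (χ : CubePartition d) (T s : ℝ) (f : ℝ → 𝓢'(Space d, ℂ)) : Prop :=
  WeaklyMeasurable T f ∧ normL1Y φ χ T s f < ⊤

/-! ### Products -/

/-- `h = f g` as tempered distributions: `(S_{≤ N} f) (S_{≤ N} g) → h` in `𝓢'` as `N → ∞`. The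
functions `S_{≤ N} f` are smooth and of polynomial growth, so the integrals converge; for
`f, g ∈ L^2` this is the pointwise product. -/
def IsProduct (φ : LPCutoff d) (f g h : 𝓢'(Space d, ℂ)) : Prop :=
  ∀ θ : 𝓢(Space d, ℂ),
    Tendsto (fun N : ℕ => ∫ x, lpLow φ N f x * lpLow φ N g x * θ x) atTop (𝓝 (h θ))

/-- `w = u v` on `[0, T]`: `w(t) = u(t) v(t)` for almost every `t ∈ [0, T]`. -/
def IsProductOn (φ : LPCutoff d) (T : ℝ) (u v w : ℝ → 𝓢'(Space d, ℂ)) : Prop :=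
  ∀ᵐ t ∂(timeMeasure T), IsProduct φ (u t) (v t) (w t)

end LocalEnergy

end

open LocalEnergy

noncomputable section

namespace LocalEnergy

/-! ### Jets of Schwartz functions and exchange of distributions with integrals -/

section Jets

variable {E : Type} [NormedAddCommGroup E] [InnerProductSpace ℝ E]

/-! Both estimates are cases of one bilinear bound from `l¹X^α × l¹X^β` to `l¹Y^(σ-δ)` with `α + β =
σ + s - 2` and `α, β ≥ σ - 1` (`exists_product_estimate`): take `(α, β) = (σ-1, s-1)` and `(σ,
s-2)`. Expand `uv = ∑ S_i u S_j v`. By the supports of the symbols, `S_k` sees only low-high pairs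
(`i + 3 ≤ j`, `|j - k| ≤ 2`, or the roles exchanged) and high-high pairs (`|i - j| ≤ 2`, `k ≤ i +
4`).

Low-high terms go into the atomic part of `Y_k`, with atoms on cubes of side `2^i`, where `2^i` is
the low frequency. Bernstein's inequality on these cubes bounds the sum of the suprema of the low
factor at the cost `2^(id/2)`. The high factor in `L²([0,T] × Q)` gains `2^((i-j)/2)` from local
energy, or `T^(1/2)` from `L^∞L²`; interpolation gives `2^((i-j)(1-2δ)/2) T^δ`
(`exists_amalgam_mul_le`). With the atomic weight `2^((i-k)/2)` this gains one derivative on the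
high factor, up to the `δ` lost in `σ - δ`, and costs `d/2 + 1` derivatives on the low one. As `s >
d/2 + 2`, the sum over the low frequency is geometric, and the high factor stays in `ℓ²`.

High-high terms go into `L¹L²`: Bernstein from `L¹` to `L²` costs `2^(kd/2)`, Cauchy-Schwarz uses
both factors in `L^∞L²`, and time integration gives `T ≤ T^δ`. The sum converges because `α + β > σ
+ d/2`.

Kernels at frequency `2^k` have width at most one, hence at most the side of any cube; they respect
all the cube sums up to rapidly decaying tails, which are absorbed by a summable weight on `ℤ^d`.

Since `α` or `β` may be negative, the product is constructed: paired with a test function,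
near-diagonal pieces decay because `α + β > 0`, and separated pieces see only its high frequencies
(`piecewiseSummable_of_decay`). Exchanging distributions with integrals, on which the reproducing
formula and spectral orthogonality rest, uses the factorization of a distribution through a Banach
space of finite jets. -/

theorem exists_one_add_norm_pow_mul_le {F : Type} [NormedAddCommGroup F] [NormedSpace ℝ F]
    (K : 𝓢(E, F)) (k n : ℕ) :
    ∃ C : ℝ, 0 ≤ C ∧ ∀ x, (1 + ‖x‖) ^ k * ‖iteratedFDeriv ℝ n K x‖ ≤ C :=
  ⟨_, by positivity, fun x => one_add_le_sup_seminorm_apply (𝕜 := ℝ) (m := (k, n)) le_rfl le_rfl K x⟩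

theorem exists_norm_pow_mul_translate_le (K : 𝓢(E, ℂ)) (k n : ℕ) :
    ∃ C : ℝ, 0 ≤ C ∧ ∀ x y, ‖y‖ ^ k * ‖iteratedFDeriv ℝ n K (y - x)‖ ≤ C * (1 + ‖x‖) ^ k := by
  obtain ⟨C, hC, h⟩ := exists_one_add_norm_pow_mul_le K k n
  refine ⟨C, hC, fun x y => ?_⟩
  have h1 : ‖y‖ ≤ (1 + ‖y - x‖) * (1 + ‖x‖) := by
    have : ‖y‖ ≤ ‖y - x‖ + ‖x‖ := by simpa using norm_add_le (y - x) x
    nlinarith [norm_nonneg (y - x), norm_nonneg x]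
  calc _ ≤ ((1 + ‖y - x‖) * (1 + ‖x‖)) ^ k * ‖iteratedFDeriv ℝ n K (y - x)‖ := by gcongr
    _ = ((1 + ‖y - x‖) ^ k * ‖iteratedFDeriv ℝ n K (y - x)‖) * (1 + ‖x‖) ^ k := by
        rw [mul_pow]; ring
    _ ≤ _ := by gcongr; exact h _

/-- Bounded continuous functions with values in the `n`-linear forms. -/
abbrev JetComponent (E : Type) [NormedAddCommGroup E] [InnerProductSpace ℝ E] (n : ℕ) : Type :=
  BoundedContinuousFunction E (ContinuousMultilinearMap ℝ (fun _ : Fin n => E) ℂ)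

/-- The weighted derivative `y ↦ |y|^k D^n f (y)` as a bounded continuous function. -/
def jetComponent (p : ℕ × ℕ) (f : 𝓢(E, ℂ)) :
    JetComponent E p.2 :=
  BoundedContinuousFunction.ofNormedAddCommGroup
    (fun y => ((‖y‖ ^ p.1 : ℝ) : ℂ) • iteratedFDeriv ℝ p.2 f y)
    (by
      have := (f.smooth ⊤).continuous_iteratedFDeriv (m := p.2) (by exact_mod_cast le_top)
      fun_prop)
    (SchwartzMap.seminorm ℝ p.1 p.2 f)
    (fun y => by
      rw [norm_smul, Complex.norm_real, Real.norm_of_nonneg (by positivity)]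
      exact le_seminorm ℝ _ _ f y)

/-- The target of a finite family of weighted derivatives. -/
def JetSpace (E : Type) [NormedAddCommGroup E] [InnerProductSpace ℝ E]
    (s : Finset (ℕ × ℕ)) : Type :=
  ∀ p : s, JetComponent E p.1.2

instance (s : Finset (ℕ × ℕ)) : NormedAddCommGroup (JetSpace E s) :=
  inferInstanceAs (NormedAddCommGroup (∀ p : s, JetComponent E p.1.2))

instance (s : Finset (ℕ × ℕ)) : NormedSpace ℂ (JetSpace E s) :=
  inferInstanceAs (NormedSpace ℂ (∀ p : s, JetComponent E p.1.2))

instance (s : Finset (ℕ × ℕ)) : CompleteSpace (JetSpace E s) :=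
  inferInstanceAs (CompleteSpace (∀ p : s, JetComponent E p.1.2))

/-- The value of a jet at a point and at a tuple of vectors. -/
def jetEval (s : Finset (ℕ × ℕ)) (p : s) (y : E) (m : Fin p.1.2 → E) : JetSpace E s →L[ℂ] ℂ :=
  LinearMap.mkContinuous
    { toFun := fun f => f p y m
      map_add' := fun _ _ => rfl
      map_smul' := fun _ _ => rfl }
    (∏ i, ‖m i‖) (fun f => by
      change ‖f p y m‖ ≤ _
      have h1 : ‖f p‖ ≤ ‖f‖ := norm_le_pi_norm (f : ∀ p : s, JetComponent E p.1.2) p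
      rw [mul_comm]
      exact (ContinuousMultilinearMap.le_opNorm _ _).trans
        (by gcongr; exact ((f p).norm_coe_le_norm y).trans h1))

/-- Finitely many weighted derivatives of a Schwartz function. -/
def jet (s : Finset (ℕ × ℕ)) : 𝓢(E, ℂ) →ₗ[ℂ] JetSpace E s where
  toFun f p := jetComponent p.1 f
  map_add' f g := by
    refine funext fun p => BoundedContinuousFunction.ext fun y => ?_
    have h := iteratedFDeriv_add_apply (𝕜 := ℝ) (i := p.1.2) (f.contDiffAt (p.1.2 : ℕ∞) (x := y))
      (g.contDiffAt (p.1.2 : ℕ∞))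
    exact (congrArg _ h).trans (smul_add _ _ _)
  map_smul' c f := by
    refine funext fun p => BoundedContinuousFunction.ext fun y => ?_
    have h := iteratedFDeriv_const_smul_apply (𝕜 := ℝ) (i := p.1.2) (a := c)
      (f.contDiffAt (p.1.2 : ℕ∞) (x := y))
    exact (congrArg _ h).trans (smul_comm _ _ _)

theorem jet_apply (s : Finset (ℕ × ℕ)) (f : 𝓢(E, ℂ)) (p : s) (y : E) :
    jet s f p y = ((‖y‖ ^ p.1.1 : ℝ) : ℂ) • iteratedFDeriv ℝ p.1.2 f y := rfl

theorem sup_seminorm_le_norm_jet (s : Finset (ℕ × ℕ)) (f : 𝓢(E, ℂ)) :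
    s.sup (schwartzSeminormFamily ℂ E ℂ) f ≤ ‖jet s f‖ := by
  refine Seminorm.finset_sup_apply_le (norm_nonneg _) fun p hp => ?_
  refine SchwartzMap.seminorm_le_bound ℂ p.1 p.2 f (norm_nonneg _) fun y => ?_
  have h1 := (jet s f ⟨p, hp⟩).norm_coe_le_norm y
  rw [jet_apply, norm_smul, Complex.norm_real, Real.norm_of_nonneg (by positivity)] at h1
  exact h1.trans (norm_le_pi_norm (jet s f : ∀ p : s, JetComponent E p.1.2) ⟨p, hp⟩)

/-- Finitely many Schwartz seminorms bound `u`, so `u` vanishes on the kernel of the jet map and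
descends to a bounded functional on its range; Hahn-Banach extends it. The target is a Banach space,
so Bochner integrals become available. -/
theorem exists_extension_jet (u : 𝓢(E, ℂ) →L[ℂ] ℂ) :
    ∃ (s : Finset (ℕ × ℕ)) (L : JetSpace E s →L[ℂ] ℂ), ∀ f, u f = L (jet s f) := by
  obtain ⟨s, C, -, hC⟩ := Seminorm.bound_of_continuous (schwartz_withSeminorms ℂ E ℂ)
    ((normSeminorm ℂ ℂ).comp u.toLinearMap) (continuous_norm.comp u.continuous)
  have hb : ∀ f, ‖u f‖ ≤ C * ‖jet s f‖ := fun f =>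
    (hC f).trans (mul_le_mul_of_nonneg_left (sup_seminorm_le_norm_jet s f) C.2)
  have hker : LinearMap.ker (jet (E := E) s) ≤ LinearMap.ker u.toLinearMap := by
    intro f hf
    have := hb f
    have h0 : jet s f = 0 := hf
    have h1 : ‖jet s f‖ = 0 := by rw [h0]; exact norm_zero
    rw [h1, mul_zero] at this
    exact norm_le_zero_iff.1 this
  let v : LinearMap.range (jet (E := E) s) →ₗ[ℂ] ℂ :=
    ((LinearMap.ker (jet (E := E) s)).liftQ u.toLinearMap hker).comp
      (jet (E := E) s).quotKerEquivRange.symm.toLinearMap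
  have hv : ∀ f, v ⟨jet s f, LinearMap.mem_range_self _ f⟩ = u f := by
    intro f
    have : (jet (E := E) s).quotKerEquivRange.symm ⟨jet s f, LinearMap.mem_range_self _ f⟩ =
        Submodule.Quotient.mk f := by
      rw [LinearEquiv.symm_apply_eq]; rfl
    simp only [v, LinearMap.comp_apply, LinearEquiv.coe_coe, this]
    rfl
  let v' : StrongDual ℂ (LinearMap.range (jet (E := E) s)) := v.mkContinuous C (by
    rintro ⟨_, f, rfl⟩
    rw [hv]; exact hb f)
  obtain ⟨L, hL, -⟩ := exists_extension_norm_eq _ v'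
  exact ⟨s, L, fun f => by rw [← hv f]; exact (hL ⟨jet s f, LinearMap.mem_range_self _ f⟩).symm⟩

theorem iteratedFDeriv_translate (K : 𝓢(E, ℂ)) (n : ℕ) (x y : E) :
    iteratedFDeriv ℝ n (K.compSubConstCLM ℂ x) y = iteratedFDeriv ℝ n K (y - x) := by
  have : ⇑(K.compSubConstCLM ℂ x) = fun z => K (z - x) := rfl
  rw [this, iteratedFDeriv_comp_sub]

/-- Mean value inequality in the translation parameter: one more derivative of `K` bounds the
difference, and the weight `|y|^k` is absorbed by the decay of `K` locally uniformly in `x`. -/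
theorem continuous_jet_translate (s : Finset (ℕ × ℕ)) (K : 𝓢(E, ℂ)) :
    Continuous fun x => jet s (K.compSubConstCLM ℂ x) := by
  refine continuous_pi fun p => continuous_iff_continuousAt.2 fun x₀ => ?_
  obtain ⟨C, hC, h⟩ := exists_norm_pow_mul_translate_le K p.1.1 (p.1.2 + 1)
  have key : ∀ x ∈ Metric.ball x₀ 1,
      dist (jet s (K.compSubConstCLM ℂ x) p) (jet s (K.compSubConstCLM ℂ x₀) p) ≤
        C * (2 + ‖x₀‖) ^ p.1.1 * ‖x - x₀‖ := by
    intro x hx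
    refine (BoundedContinuousFunction.dist_le (by positivity)).2 fun y => ?_
    rw [jet_apply, jet_apply, iteratedFDeriv_translate, iteratedFDeriv_translate, dist_eq_norm]
    have hd : ∀ z ∈ Metric.ball x₀ 1, DifferentiableAt ℝ
        (fun z => ((‖y‖ ^ p.1.1 : ℝ) : ℂ) • iteratedFDeriv ℝ p.1.2 K (y - z)) z := by
      intro z _
      have := ((K.smooth ⊤).differentiable_iteratedFDeriv (m := p.1.2)
        (by exact_mod_cast WithTop.coe_lt_top _))
      have h2 : DifferentiableAt ℝ (fun z => iteratedFDeriv ℝ p.1.2 K (y - z)) z :=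
        (this (y - z)).comp z (by fun_prop)
      exact h2.const_smul (((‖y‖ ^ p.1.1 : ℝ) : ℂ))
    have := (convex_ball x₀ (1 : ℝ)).norm_image_sub_le_of_norm_fderiv_le (𝕜 := ℝ)
      (f := fun z => ((‖y‖ ^ p.1.1 : ℝ) : ℂ) • iteratedFDeriv ℝ p.1.2 K (y - z))
      (C := C * (2 + ‖x₀‖) ^ p.1.1) hd ?_ (Metric.mem_ball_self one_pos) hx
    · exact this
    · intro z hz
      have h2 : DifferentiableAt ℝ (iteratedFDeriv ℝ p.1.2 K) (y - z) :=
        (K.smooth ⊤).differentiable_iteratedFDeriv (m := p.1.2)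
          (by exact_mod_cast WithTop.coe_lt_top _) _
      have h3 : HasFDerivAt (fun z => ((‖y‖ ^ p.1.1 : ℝ) : ℂ) • iteratedFDeriv ℝ p.1.2 K (y - z))
          (((‖y‖ ^ p.1.1 : ℝ) : ℂ) • (fderiv ℝ (iteratedFDeriv ℝ p.1.2 K) (y - z)).comp
            (-ContinuousLinearMap.id ℝ E)) z := by
        have h4 : HasFDerivAt (fun z : E => y - z) (-ContinuousLinearMap.id ℝ E) z :=
          (hasFDerivAt_id z).const_sub y
        exact (h2.hasFDerivAt.comp z h4).const_smul (((‖y‖ ^ p.1.1 : ℝ) : ℂ))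
      rw [h3.fderiv, norm_smul, Complex.norm_real, Real.norm_of_nonneg (by positivity),
        ContinuousLinearMap.comp_neg, norm_neg, ContinuousLinearMap.comp_id,
        norm_fderiv_iteratedFDeriv]
      refine (h z y).trans ?_
      have : ‖z‖ ≤ 1 + ‖x₀‖ := by
        have h5 := mem_ball_iff_norm.1 hz
        have : ‖z‖ ≤ ‖z - x₀‖ + ‖x₀‖ := by simpa using norm_add_le (z - x₀) x₀
        linarith
      exact mul_le_mul_of_nonneg_left (pow_le_pow_left₀ (by positivity) (by linarith) _) hC
  rw [ContinuousAt, tendsto_iff_dist_tendsto_zero]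
  refine squeeze_zero' (Eventually.of_forall fun _ => dist_nonneg)
    (eventually_of_mem (Metric.ball_mem_nhds x₀ one_pos) key) ?_
  have : Tendsto (fun x => C * (2 + ‖x₀‖) ^ p.1.1 * ‖x - x₀‖) (𝓝 x₀)
      (𝓝 (C * (2 + ‖x₀‖) ^ p.1.1 * ‖x₀ - x₀‖)) := by
    apply Continuous.tendsto; fun_prop
  simpa using this

theorem exists_norm_jet_translate_le (s : Finset (ℕ × ℕ)) (K : 𝓢(E, ℂ)) :
    ∃ (C : ℝ) (k : ℕ), 0 ≤ C ∧ ∀ x, ‖jet s (K.compSubConstCLM ℂ x)‖ ≤ C * (1 + ‖x‖) ^ k := by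
  choose C hC h using fun p : ℕ × ℕ => exists_norm_pow_mul_translate_le K p.1 p.2
  refine ⟨∑ p ∈ s, C p, s.sup Prod.fst, Finset.sum_nonneg fun p _ => hC p, fun x => ?_⟩
  have h0 : 0 ≤ ∑ p ∈ s, C p := Finset.sum_nonneg fun p _ => hC p
  refine (pi_norm_le_iff_of_nonneg (by positivity)).2 fun p => ?_
  refine (BoundedContinuousFunction.norm_le (by positivity)).2 fun y => ?_
  rw [jet_apply, norm_smul, Complex.norm_real, Real.norm_of_nonneg (by positivity),
    iteratedFDeriv_translate]
  refine (h p.1 x y).trans ?_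
  gcongr
  · exact Finset.single_le_sum (f := C) (fun p _ => hC p) p.2
  · linarith [norm_nonneg x]
  · exact Finset.le_sup (f := Prod.fst) p.2

theorem continuous_apply_translate (u : 𝓢(E, ℂ) →L[ℂ] ℂ) (K : 𝓢(E, ℂ)) :
    Continuous fun x => u (K.compSubConstCLM ℂ x) := by
  obtain ⟨s, L, hL⟩ := exists_extension_jet u
  simp only [hL]
  exact L.continuous.comp (continuous_jet_translate s K)

theorem exists_norm_apply_translate_le (u : 𝓢(E, ℂ) →L[ℂ] ℂ) (K : 𝓢(E, ℂ)) :
    ∃ (C : ℝ) (k : ℕ), 0 ≤ C ∧ ∀ x, ‖u (K.compSubConstCLM ℂ x)‖ ≤ C * (1 + ‖x‖) ^ k := by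
  obtain ⟨s, L, hL⟩ := exists_extension_jet u
  obtain ⟨C, k, hC, h⟩ := exists_norm_jet_translate_le s K
  refine ⟨‖L‖ * C, k, by positivity, fun x => ?_⟩
  rw [hL, mul_assoc]
  exact (L.le_opNorm _).trans (by gcongr; exact h x)

variable [FiniteDimensional ℝ E] [MeasurableSpace E] [BorelSpace E]

theorem integrable_smul_translate {F : Type} [NormedAddCommGroup F] [NormedSpace ℂ F]
    [NormedSpace ℝ F] {θ : E → ℂ} (hθ : Integrable θ) {K : E → F} (hK : Continuous K) {C : ℝ}
    (hC : ∀ x, ‖K x‖ ≤ C) (y : E) : Integrable fun x => θ x • K (y - x) := by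
  refine (hθ.norm.mul_const C).mono' ?_ (Eventually.of_forall fun x => ?_)
  · have : AEStronglyMeasurable (fun x => K (y - x)) (volume : Measure E) :=
      (hK.comp (by fun_prop)).aestronglyMeasurable
    exact hθ.1.smul this
  · rw [norm_smul]
    gcongr
    exact hC _

theorem hasFDerivAt_integral_smul_translate {F : Type} [NormedAddCommGroup F] [NormedSpace ℂ F]
    [NormedSpace ℝ F] [SMulCommClass ℝ ℂ F] {θ : E → ℂ} (hθ : Integrable θ) (K : 𝓢(E, F)) (y : E) :
    HasFDerivAt (fun y => ∫ x, θ x • K (y - x)) (∫ x, θ x • fderivCLM ℝ E F K (y - x)) y := by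
  have h0 : ∀ x, ‖K x‖ ≤ SchwartzMap.seminorm ℝ 0 0 K := fun x => norm_le_seminorm ℝ K x
  have h1 : ∀ x, ‖fderiv ℝ K x‖ ≤ SchwartzMap.seminorm ℝ 0 1 K := fun x => by
    have := norm_iteratedFDeriv_le_seminorm ℝ K 1 x
    rwa [← norm_iteratedFDeriv_fderiv, norm_iteratedFDeriv_zero] at this
  have hc : Continuous (fderivCLM ℝ E F K) := (fderivCLM ℝ E F K).continuous
  refine hasFDerivAt_integral_of_dominated_of_fderiv_le (s := Set.univ)
    (F' := fun y x => θ x • fderivCLM ℝ E F K (y - x))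
    (bound := fun x => ‖θ x‖ * SchwartzMap.seminorm ℝ 0 1 K)
    univ_mem (Eventually.of_forall fun y => (integrable_smul_translate hθ K.continuous h0 y).1)
    (integrable_smul_translate hθ K.continuous h0 y)
    (integrable_smul_translate hθ hc h1 y).1 (Eventually.of_forall fun x y _ => ?_)
    (hθ.norm.mul_const _) (Eventually.of_forall fun x y _ => ?_)
  · rw [norm_smul]
    gcongr
    exact h1 _
  · have h4 : HasFDerivAt (fun y : E => y - x) (ContinuousLinearMap.id ℝ E) y :=
      (hasFDerivAt_id y).sub_const x
    have h5 := (K.differentiable (y - x)).hasFDerivAt.comp y h4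
    rw [ContinuousLinearMap.comp_id] at h5
    exact h5.const_smul (θ x)

/-- The induction runs over all target spaces `F`, since one differentiation turns an `F`-valued
Schwartz function into one with values in the linear maps to `F`. -/
theorem iteratedFDeriv_integral_smul_translate {θ : E → ℂ} (hθ : Integrable θ) (n : ℕ) :
    ∀ {F : Type} [NormedAddCommGroup F] [NormedSpace ℂ F] [NormedSpace ℝ F] [SMulCommClass ℝ ℂ F]
      [CompleteSpace F] (K : 𝓢(E, F)) (y : E) (m : Fin n → E),
      iteratedFDeriv ℝ n (fun y => ∫ x, θ x • K (y - x)) y m =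
        ∫ x, θ x • iteratedFDeriv ℝ n K (y - x) m := by
  induction n with
  | zero => intro F _ _ _ _ _ K y m; simp [iteratedFDeriv_zero_apply]
  | succ n ih =>
    intro F _ _ _ _ _ K y m
    have h1 : (fderiv ℝ fun y => ∫ x, θ x • K (y - x)) =
        fun y => ∫ x, θ x • fderivCLM ℝ E F K (y - x) := by
      ext1 y
      exact (hasFDerivAt_integral_smul_translate hθ K y).fderiv
    rw [iteratedFDeriv_succ_apply_right]
    change (iteratedFDeriv ℝ n (fderiv ℝ fun y => ∫ x, θ x • K (y - x)) y) (Fin.init m) _ = _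
    rw [h1, ih (fderivCLM ℝ E F K) y (Fin.init m), ContinuousLinearMap.integral_apply]
    · simp only [iteratedFDeriv_succ_apply_right]
      rfl
    · have hc := ((fderivCLM ℝ E F K).smooth ⊤).continuous_iteratedFDeriv (m := n)
        (by exact_mod_cast le_top)
      refine integrable_smul_translate hθ
        (K := fun z => iteratedFDeriv ℝ n (fderivCLM ℝ E F K) z (Fin.init m))
        (C := SchwartzMap.seminorm ℝ 0 n (fderivCLM ℝ E F K) * ∏ i, ‖Fin.init m i‖)
        (by fun_prop) (fun x => ?_) y
      refine (ContinuousMultilinearMap.le_opNorm _ _).trans ?_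
      gcongr
      exact norm_iteratedFDeriv_le_seminorm ℝ _ n x

/-- A tempered distribution commutes with integrals of translates of a Schwartz function. -/
theorem integral_mul_apply_translate (u : 𝓢(E, ℂ) →L[ℂ] ℂ) (K G : 𝓢(E, ℂ)) {θ : E → ℂ}
    (hθ : ∀ k : ℕ, Integrable fun x => ((1 + ‖x‖) ^ k : ℝ) • θ x)
    (hG : ∀ y, G y = ∫ x, θ x * K (y - x)) :
    ∫ x, θ x * u (K.compSubConstCLM ℂ x) = u G := by
  obtain ⟨s, L, hL⟩ := exists_extension_jet u
  obtain ⟨C, k, hC, h⟩ := exists_norm_jet_translate_le s K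
  have hθ0 : Integrable θ := by simpa using hθ 0
  have hI : Integrable fun x => θ x • jet s (K.compSubConstCLM ℂ x) := by
    refine ((hθ k).norm.const_mul C).mono' ?_ (Eventually.of_forall fun x => ?_)
    · exact hθ0.1.smul (continuous_jet_translate s K).aestronglyMeasurable
    · rw [norm_smul, norm_smul, Real.norm_of_nonneg (by positivity)]
      calc _ ≤ ‖θ x‖ * (C * (1 + ‖x‖) ^ k) := by gcongr; exact h x
        _ = _ := by ring
  have hG' : ⇑G = fun y => ∫ x, θ x • K (y - x) := by
    ext y; simpa using hG y
  -- Point evaluations separate jets and commute with the Bochner integral, so the identity reduces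
  -- to differentiation under the integral sign.
  have key : ∫ x, θ x • jet s (K.compSubConstCLM ℂ x) = jet s G := by
    refine funext fun p => BoundedContinuousFunction.ext fun y =>
      ContinuousMultilinearMap.ext fun m => ?_
    let ev := jetEval s p y m
    have h1 : ev (∫ x, θ x • jet s (K.compSubConstCLM ℂ x)) =
        ∫ x, ev (θ x • jet s (K.compSubConstCLM ℂ x)) := (ev.integral_comp_comm hI).symm
    change ev (∫ x, θ x • jet s (K.compSubConstCLM ℂ x)) = ev (jet s G)
    rw [h1]
    have h2 : ∀ f : 𝓢(E, ℂ), ev (jet s f) =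
        ((‖y‖ ^ p.1.1 : ℝ) : ℂ) * iteratedFDeriv ℝ p.1.2 f y m := fun f => rfl
    have h3 : ∀ x, ev (θ x • jet s (K.compSubConstCLM ℂ x)) =
        ((‖y‖ ^ p.1.1 : ℝ) : ℂ) * (θ x • iteratedFDeriv ℝ p.1.2 K (y - x) m) := by
      intro x
      have : ev (θ x • jet s (K.compSubConstCLM ℂ x)) =
        θ x * ev (jet s (K.compSubConstCLM ℂ x)) := rfl
      rw [this, h2, iteratedFDeriv_translate, smul_eq_mul]
      ring
    simp only [h3, h2]
    rw [integral_const_mul, hG', iteratedFDeriv_integral_smul_translate hθ0]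
  have h5 : ∀ x, θ x * u (K.compSubConstCLM ℂ x) = L (θ x • jet s (K.compSubConstCLM ℂ x)) := by
    intro x
    rw [map_smul, ← hL, smul_eq_mul]
  simp only [h5]
  rw [L.integral_comp_comm hI, key, hL]

end Jets

variable {d : ℕ}

/-! ### Fourier multipliers with Schwartz symbol -/

/-- The smooth function `m(D) u = 𝓕⁻¹ (m 𝓕 u)`. -/
def multiplier (m : 𝓢(Space d, ℂ)) (u : 𝓢'(Space d, ℂ)) (x : Space d) : ℂ :=
  u ((𝓕 m).compSubConstCLM ℂ x)

/-- The symbol of the Littlewood-Paley piece `S_k`. -/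
def pieceSymbol (φ : LPCutoff d) : ℕ → 𝓢(Space d, ℂ)
  | 0 => φ.dilate 0
  | k + 1 => φ.dilate (k + 1) - φ.dilate k

theorem lpPiece_eq_multiplier (φ : LPCutoff d) (k : ℕ) (u : 𝓢'(Space d, ℂ)) :
    lpPiece φ k u = multiplier (pieceSymbol φ k) u := by
  ext x
  cases k with
  | zero => rfl
  | succ k =>
    simp only [lpPiece, lpLow, multiplier, pieceSymbol]
    have h1 : 𝓕 (φ.dilate (k + 1) - φ.dilate k) = 𝓕 (φ.dilate (k + 1)) - 𝓕 (φ.dilate k) :=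
      map_sub (fourierCLM ℂ 𝓢(Space d, ℂ)) _ _
    rw [h1, map_sub]
    exact (ContinuousLinearMap.map_sub (u : 𝓢(Space d, ℂ) →L[ℂ] ℂ) _ _).symm

theorem lpLow_eq_sum (φ : LPCutoff d) (N : ℕ) (u : 𝓢'(Space d, ℂ)) (x : Space d) :
    lpLow φ N u x = ∑ k ∈ Finset.range (N + 1), lpPiece φ k u x := by
  induction N with
  | zero => simp [lpPiece]
  | succ N ih => rw [Finset.sum_range_succ, ← ih]; simp [lpPiece]

theorem continuous_multiplier (m : 𝓢(Space d, ℂ)) (u : 𝓢'(Space d, ℂ)) :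
    Continuous (multiplier m u) :=
  continuous_apply_translate (u : 𝓢(Space d, ℂ) →L[ℂ] ℂ) (𝓕 m)

theorem exists_norm_multiplier_le (m : 𝓢(Space d, ℂ)) (u : 𝓢'(Space d, ℂ)) :
    ∃ (C : ℝ) (k : ℕ), 0 ≤ C ∧ ∀ x, ‖multiplier m u x‖ ≤ C * (1 + ‖x‖) ^ k :=
  exists_norm_apply_translate_le (u : 𝓢(Space d, ℂ) →L[ℂ] ℂ) (𝓕 m)

/-- The pointwise product of Schwartz functions. -/
def schwartzMul (a b : 𝓢(Space d, ℂ)) : 𝓢(Space d, ℂ) :=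
  pairing (ContinuousLinearMap.mul ℂ ℂ) a b

@[simp]
theorem schwartzMul_apply (a b : 𝓢(Space d, ℂ)) (x : Space d) : schwartzMul a b x = a x * b x :=
  rfl

theorem integral_fourier_mul_fourier_sub (a b : 𝓢(Space d, ℂ)) (x : Space d) :
    ∫ y, 𝓕 a y * 𝓕 b (x - y) = 𝓕 (schwartzMul a b) x := by
  have h1 : 𝓕⁻ (SchwartzMap.convolution (ContinuousLinearMap.mul ℂ ℂ) (𝓕 a) (𝓕 b)) =
      schwartzMul a b := by
    ext ξ
    have h2 : ∀ f : 𝓢(Space d, ℂ), 𝓕⁻ f ξ = 𝓕 f (-ξ) := fun f => by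
      rw [fourierInv_coe, fourier_coe, Real.fourierInv_eq_fourier_neg]
    rw [h2, fourier_convolution, pairing_apply_apply, ← h2, ← h2]
    simp
  have h3 : SchwartzMap.convolution (ContinuousLinearMap.mul ℂ ℂ) (𝓕 a) (𝓕 b) =
      𝓕 (schwartzMul a b) := by rw [← h1]; simp
  rw [← h3, SchwartzMap.convolution_apply]
  rfl

theorem integrable_one_add_norm_pow_smul (f : 𝓢(Space d, ℂ)) (k : ℕ) :
    Integrable fun x => ((1 + ‖x‖) ^ k : ℝ) • f x := by
  have h : Integrable fun x => (2 : ℝ) ^ k * (‖f x‖ + ‖x‖ ^ k * ‖f x‖) :=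
    (f.integrable.norm.add (f.integrable_pow_mul volume k)).const_mul _
  refine h.mono' (by
    have : Continuous fun x => ((1 + ‖x‖) ^ k : ℝ) • f x := by
      have := f.continuous
      fun_prop
    exact this.aestronglyMeasurable) (Eventually.of_forall fun x => ?_)
  rw [norm_smul, Real.norm_of_nonneg (by positivity)]
  have : (1 + ‖x‖) ^ k ≤ 2 ^ k * (1 + ‖x‖ ^ k) := by
    have h1 := add_pow_le (zero_le_one (α := ℝ)) (norm_nonneg x) k
    refine h1.trans ?_
    rw [one_pow]
    gcongr
    · norm_num
    · omega
  calc _ ≤ 2 ^ k * (1 + ‖x‖ ^ k) * ‖f x‖ := by gcongr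
    _ = _ := by ring

/-- After exchanging `u` with the integral, the claim is `𝓕 ρ * 𝓕 m = 𝓕 (ρ m) = 𝓕 m`. It is the
reproducing formula behind all Bernstein inequalities below. -/
theorem integral_fourier_translate_mul_multiplier {ρ m : 𝓢(Space d, ℂ)}
    (h : ∀ ξ, ρ ξ * m ξ = m ξ) (u : 𝓢'(Space d, ℂ)) (x : Space d) :
    ∫ y, 𝓕 ρ (y - x) * multiplier m u y = multiplier m u x := by
  refine integral_mul_apply_translate (u : 𝓢(Space d, ℂ) →L[ℂ] ℂ) (𝓕 m)
    ((𝓕 m).compSubConstCLM ℂ x) (θ := fun y => 𝓕 ρ (y - x)) (fun k => ?_) fun z => ?_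
  · exact integrable_one_add_norm_pow_smul ((𝓕 ρ).compSubConstCLM ℂ x) k
  · have hm : schwartzMul ρ m = m := by ext ξ; exact h ξ
    have h1 := integral_fourier_mul_fourier_sub ρ m (z - x)
    rw [hm] at h1
    rw [compSubConstCLM_apply, ← h1, ← integral_sub_right_eq_self _ x]
    simp

/-- It exhibits the spectrum of `θ` times a translated kernel: the value at `ξ` involves `𝓕⁻ θ (ξ +
ζ)` only for `ζ` in the support of `m`. -/
theorem fourierInv_mul_translate (θ m : 𝓢(Space d, ℂ)) (y ξ : Space d) :
    𝓕⁻ (schwartzMul θ ((𝓕⁻ m).compSubConstCLM ℂ y)) ξ =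
      ∫ ζ, Complex.exp (↑(-2 * Real.pi * inner ℝ y ζ) * Complex.I) * m ζ * 𝓕⁻ θ (ξ + ζ) := by
  have hF : ∀ (f : 𝓢(Space d, ℂ)) (w : Space d), 𝓕⁻ f w =
      ∫ v, Complex.exp (↑(2 * Real.pi * inner ℝ v w) * Complex.I) * f v := fun f w => by
    rw [fourierInv_coe, Real.fourierInv_eq']
    simp only [smul_eq_mul]
  rw [hF]
  simp only [schwartzMul_apply, compSubConstCLM_apply, hF]
  simp only [← integral_const_mul]
  rw [integral_integral_swap]
  · refine integral_congr_ae (Eventually.of_forall fun ζ => integral_congr_ae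
      (Eventually.of_forall fun x => ?_))
    simp only []
    rw [inner_sub_right, inner_add_right, real_inner_comm ζ x, real_inner_comm ζ y]
    have : ∀ a b c : ℝ, Complex.exp (↑(2 * Real.pi * (b + c)) * Complex.I) *
        Complex.exp (↑(-2 * Real.pi * a) * Complex.I) =
        Complex.exp (↑(2 * Real.pi * b) * Complex.I) *
        Complex.exp (↑(2 * Real.pi * (c - a)) * Complex.I) := by
      intro a b c
      rw [← Complex.exp_add, ← Complex.exp_add]
      congr 1
      push_cast
      ring
    linear_combination (-(θ x) * m ζ) * this (inner ℝ ζ y) (inner ℝ x ξ) (inner ℝ ζ x)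
  · refine ((θ.integrable (μ := volume)).mul_prod (m.integrable (μ := volume))).mono ?_
      (Eventually.of_forall fun p => ?_)
    · have := θ.continuous
      have := m.continuous
      refine Continuous.aestronglyMeasurable ?_
      simp only [Function.uncurry_def]
      fun_prop
    · simp only [Function.uncurry, norm_mul, Complex.norm_exp_ofReal_mul_I, one_mul]
      rfl

/-- Spectral orthogonality: the pairing vanishes unless the spectra match. -/
theorem integral_multiplier_mul_multiplier_mul_eq_zero {m₁ m₂ θ : 𝓢(Space d, ℂ)}
    (h : ∀ ξ ζ, m₁ ξ ≠ 0 → m₂ ζ ≠ 0 → 𝓕⁻ θ (ξ + ζ) = 0) (u v : 𝓢'(Space d, ℂ)) :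
    ∫ x, multiplier m₁ u x * multiplier m₂ v x * θ x = 0 := by
  -- First exchange, for `v`: with the rapidly decreasing weight `m₁(D)u · θ` it suffices that its
  -- convolution with the kernel of `m₂` vanishes at every `y`. That convolution is a pairing with
  -- `u`, treated by a second exchange.
  have h0 := integral_mul_apply_translate (v : 𝓢(Space d, ℂ) →L[ℂ] ℂ) (𝓕 m₂) 0
    (θ := fun x => multiplier m₁ u x * θ x) (fun k => ?_) (fun y => ?_)
  · rw [ContinuousLinearMap.map_zero (v : 𝓢(Space d, ℂ) →L[ℂ] ℂ)] at h0
    rw [← h0]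
    refine integral_congr_ae (Eventually.of_forall fun x => ?_)
    simp only [multiplier]
    exact mul_right_comm _ _ _
  · obtain ⟨C, n, hC, hb⟩ := exists_norm_multiplier_le m₁ u
    refine ((integrable_one_add_norm_pow_smul θ (k + n)).norm.const_mul C).mono' ?_
      (Eventually.of_forall fun x => ?_)
    · have := θ.continuous
      have := continuous_multiplier m₁ u
      exact Continuous.aestronglyMeasurable (by fun_prop)
    · rw [norm_smul, norm_smul, norm_mul, Real.norm_of_nonneg (by positivity),
        Real.norm_of_nonneg (by positivity), pow_add]
      calc _ ≤ (1 + ‖x‖) ^ k * (C * (1 + ‖x‖) ^ n * ‖θ x‖) := by gcongr; exact hb x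
        _ = _ := by ring
  · set B : 𝓢(Space d, ℂ) := schwartzMul θ ((𝓕⁻ m₂).compSubConstCLM ℂ y) with hB
    have hneg : ∀ x, 𝓕 m₂ (y - x) = (𝓕⁻ m₂) (x - y) := fun x => by
      rw [fourierInv_coe, fourier_coe, Real.fourierInv_eq_fourier_neg, neg_sub]
    -- On the support of `m₁` the integrand of `fourierInv_mul_translate` vanishes: either `m₂ ζ =
    -- 0` or `𝓕⁻ θ (ξ + ζ) = 0`.
    have hz : schwartzMul (𝓕⁻ B) m₁ = 0 := by
      ext ξ
      rw [schwartzMul_apply, hB, fourierInv_mul_translate]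
      by_cases hξ : m₁ ξ = 0
      · simp [hξ]
      · rw [zero_apply, mul_eq_zero]
        left
        refine integral_eq_zero_of_ae (Eventually.of_forall fun ζ => ?_)
        by_cases hζ : m₂ ζ = 0
        · simp [hζ]
        · simp [h ξ ζ hξ hζ]
    have h1 := integral_mul_apply_translate (u : 𝓢(Space d, ℂ) →L[ℂ] ℂ) (𝓕 m₁) 0
      (θ := B) (integrable_one_add_norm_pow_smul B) (fun z => by
        have := integral_fourier_mul_fourier_sub (𝓕⁻ B) m₁ z
        rw [hz] at this
        simpa using this.symm)
    rw [ContinuousLinearMap.map_zero (u : 𝓢(Space d, ℂ) →L[ℂ] ℂ)] at h1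
    rw [zero_apply, ← h1]
    refine integral_congr_ae (Eventually.of_forall fun x => ?_)
    simp only [hB, schwartzMul_apply, compSubConstCLM_apply, hneg, multiplier]
    have e : ∀ a b c : ℂ, a * b * c = c * a * b := by intros; ring
    exact e _ _ _

/-! ### Littlewood-Paley symbols -/

theorem LPCutoff.dilate_apply (φ : LPCutoff d) (N : ℕ) (ξ : Space d) :
    φ.dilate N ξ = φ.toSchwartz (((2 : ℝ) ^ N)⁻¹ • ξ) := by
  change φ.toSchwartz (((2 : ℝ) ^ (-(N : ℤ))) • ξ) = _
  rw [zpow_neg, zpow_natCast]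

theorem LPCutoff.dilate_eq_one (φ : LPCutoff d) {N : ℕ} {ξ : Space d}
    (h : ‖ξ‖ ≤ φ.radius * 2 ^ N) : φ.dilate N ξ = 1 := by
  rw [dilate_apply]
  refine φ.eq_one _ ?_
  rw [norm_smul, norm_inv, norm_pow, Real.norm_ofNat, inv_mul_le_iff₀ (by positivity)]
  linarith

theorem LPCutoff.dilate_eq_zero (φ : LPCutoff d) {N : ℕ} {ξ : Space d}
    (h : φ.radius * 2 ^ (N + 1) ≤ ‖ξ‖) : φ.dilate N ξ = 0 := by
  rw [dilate_apply]
  refine φ.eq_zero _ ?_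
  rw [norm_smul, norm_inv, norm_pow, Real.norm_ofNat, le_inv_mul_iff₀ (by positivity)]
  rw [pow_succ] at h
  linarith

theorem LPCutoff.norm_one_sub_dilate_le (φ : LPCutoff d) (N : ℕ) (ξ : Space d) :
    ‖1 - φ.dilate N ξ‖ ≤ 1 := by
  rw [dilate_apply]
  obtain ⟨c, hc, h⟩ := φ.range_Icc (((2 : ℝ) ^ N)⁻¹ • ξ)
  rw [h, ← Complex.ofReal_one, ← Complex.ofReal_sub, Complex.norm_real, Real.norm_eq_abs, abs_le]
  constructor <;> linarith [hc.1, hc.2]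

theorem norm_lt_of_pieceSymbol_ne_zero (φ : LPCutoff d) {k : ℕ} {ξ : Space d}
    (h : pieceSymbol φ k ξ ≠ 0) : ‖ξ‖ < φ.radius * 2 ^ (k + 1) := by
  by_contra! hc
  apply h
  have hr := φ.radius_pos
  cases k with
  | zero => exact φ.dilate_eq_zero hc
  | succ k =>
    have h2 : φ.radius * 2 ^ (k + 1) ≤ ‖ξ‖ := by
      refine le_trans ?_ hc
      gcongr <;> norm_num
    change φ.dilate (k + 1) ξ - φ.dilate k ξ = 0
    rw [φ.dilate_eq_zero hc, φ.dilate_eq_zero h2, sub_zero]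

theorem lt_norm_of_pieceSymbol_succ_ne_zero (φ : LPCutoff d) {k : ℕ} {ξ : Space d}
    (h : pieceSymbol φ (k + 1) ξ ≠ 0) : φ.radius * 2 ^ k < ‖ξ‖ := by
  by_contra! hc
  apply h
  have hr := φ.radius_pos
  have h2 : ‖ξ‖ ≤ φ.radius * 2 ^ (k + 1) := by
    refine hc.trans ?_
    gcongr <;> norm_num
  change φ.dilate (k + 1) ξ - φ.dilate k ξ = 0
  rw [φ.dilate_eq_one hc, φ.dilate_eq_one h2, sub_self]

theorem dilate_mul_pieceSymbol (φ : LPCutoff d) (k : ℕ) (ξ : Space d) :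
    φ.dilate (k + 1) ξ * pieceSymbol φ k ξ = pieceSymbol φ k ξ := by
  by_cases h : pieceSymbol φ k ξ = 0
  · rw [h, mul_zero]
  · rw [φ.dilate_eq_one (norm_lt_of_pieceSymbol_ne_zero φ h).le, one_mul]

/-- The frequencies `i, j, k` for which `S_k (S_i u S_j v)` need not vanish. -/
def Interacting (i j k : ℕ) : Prop :=
  (i + 3 ≤ j ∧ j ≤ k + 2 ∧ k ≤ j + 2) ∨ (j + 3 ≤ i ∧ i ≤ k + 2 ∧ k ≤ i + 2) ∨
    (i ≤ j + 2 ∧ j ≤ i + 2 ∧ k ≤ i + 4)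

theorem pow_lt_of_radius_mul_lt (φ : LPCutoff d) {a b : ℕ} {x : ℝ}
    (h1 : φ.radius * 2 ^ a < x) (h2 : x < φ.radius * 2 ^ b) : a < b := by
  have h := (mul_lt_mul_iff_right₀ φ.radius_pos).1 (h1.trans h2)
  exact (pow_lt_pow_iff_right₀ one_lt_two).1 h

/-- The low frequency lies below `r 2^(j-2)` and the high one above `r 2^(j-1)`, so the sum stays
away from zero. With a gap of two instead of three these two bounds would coincide. -/
theorem norm_add_bounds_of_separated (φ : LPCutoff d) {i j : ℕ} (hij : i + 3 ≤ j)
    {ξ ζ : Space d} (hi : pieceSymbol φ i ξ ≠ 0) (hj : pieceSymbol φ j ζ ≠ 0) :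
    φ.radius * 2 ^ (j - 2) < ‖ξ + ζ‖ ∧ ‖ξ + ζ‖ < φ.radius * 2 ^ (j + 2) := by
  obtain ⟨n, rfl⟩ : ∃ n, j = n + 3 := ⟨j - 3, by omega⟩
  have h1 := norm_lt_of_pieceSymbol_ne_zero φ hi
  have h2 := norm_lt_of_pieceSymbol_ne_zero φ hj
  have h3 := lt_norm_of_pieceSymbol_succ_ne_zero φ hj
  have hr := φ.radius_pos
  have h4 : φ.radius * 2 ^ (i + 1) ≤ φ.radius * 2 ^ (n + 1) := by
    gcongr
    · norm_num
    · omega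
  have h5 : ‖ξ + ζ‖ ≤ ‖ξ‖ + ‖ζ‖ := norm_add_le _ _
  have h6 : ‖ζ‖ ≤ ‖ξ + ζ‖ + ‖ξ‖ := by
    have := norm_sub_le (ξ + ζ) ξ
    rwa [add_sub_cancel_left] at this
  have e : n + 3 - 2 = n + 1 := by omega
  rw [e]
  have hp : 0 < φ.radius * 2 ^ n := by positivity
  simp only [pow_succ] at *
  constructor <;> linarith

theorem interacting_of_pieceSymbol_ne_zero (φ : LPCutoff d) {i j k : ℕ} {ξ ζ : Space d}
    (hi : pieceSymbol φ i ξ ≠ 0) (hj : pieceSymbol φ j ζ ≠ 0)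
    (hk : pieceSymbol φ k (ξ + ζ) ≠ 0) : Interacting i j k := by
  have hku := norm_lt_of_pieceSymbol_ne_zero φ hk
  have key : ∀ b : ℕ, 0 < b → ‖ξ + ζ‖ < φ.radius * 2 ^ b → k ≤ b := by
    intro b hb h
    cases k with
    | zero => omega
    | succ k =>
      have := pow_lt_of_radius_mul_lt φ (lt_norm_of_pieceSymbol_succ_ne_zero φ hk) h
      omega
  rcases le_or_gt (i + 3) j with hij | hij
  · obtain ⟨h1, h2⟩ := norm_add_bounds_of_separated φ hij hi hj
    have h3 := pow_lt_of_radius_mul_lt φ h1 hku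
    exact Or.inl ⟨hij, by omega, key _ (by omega) h2⟩
  rcases le_or_gt (j + 3) i with hji | hji
  · obtain ⟨h1, h2⟩ := norm_add_bounds_of_separated φ hji hj hi
    rw [add_comm] at h1 h2
    have h3 := pow_lt_of_radius_mul_lt φ h1 hku
    exact Or.inr (Or.inl ⟨hji, by omega, key _ (by omega) h2⟩)
  · refine Or.inr (Or.inr ⟨by omega, by omega, key _ (by omega) ?_⟩)
    have hr := φ.radius_pos
    have h1 := norm_lt_of_pieceSymbol_ne_zero φ hi
    have h2 := norm_lt_of_pieceSymbol_ne_zero φ hj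
    have h4 : φ.radius * 2 ^ (j + 1) ≤ φ.radius * 2 ^ (i + 3) :=
      mul_le_mul_of_nonneg_left (pow_le_pow_right₀ one_le_two (by omega)) hr.le
    have h5 : ‖ξ + ζ‖ ≤ ‖ξ‖ + ‖ζ‖ := norm_add_le _ _
    have hp : 0 < φ.radius * 2 ^ i := by positivity
    simp only [pow_succ] at *
    linarith

theorem fourierInv_translate_fourier (m : 𝓢(Space d, ℂ)) (x ξ : Space d) :
    (𝓕⁻ ((𝓕 m : 𝓢(Space d, ℂ)).compSubConstCLM ℂ x) : 𝓢(Space d, ℂ)) ξ =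
      Complex.exp (↑(2 * Real.pi * inner ℝ x ξ) * Complex.I) * m ξ := by
  have hF : ∀ (f : 𝓢(Space d, ℂ)) (w : Space d), 𝓕⁻ f w =
      ∫ v, Complex.exp (↑(2 * Real.pi * inner ℝ v w) * Complex.I) * f v := fun f w => by
    rw [fourierInv_coe, Real.fourierInv_eq']
    simp only [smul_eq_mul]
  have hm : m ξ = 𝓕⁻ (𝓕 m) ξ := by simp
  rw [hm, hF, hF, ← integral_add_right_eq_self _ x, ← integral_const_mul]
  refine integral_congr_ae (Eventually.of_forall fun v => ?_)
  simp only [compSubConstCLM_apply, add_sub_cancel_right]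
  rw [← mul_assoc, ← Complex.exp_add, inner_add_left]
  congr 2
  push_cast
  ring

/-- The test function is the kernel of `S_k` centred at `x`, so the integral is `S_k (S_i u S_j
v)(x)`. Translating the kernel only modulates its spectrum. -/
theorem integral_lpPiece_mul_lpPiece_mul_eq_zero (φ : LPCutoff d) {i j k : ℕ}
    (h : ¬ Interacting i j k) (u v : 𝓢'(Space d, ℂ)) (x : Space d) :
    ∫ y, lpPiece φ i u y * lpPiece φ j v y *
      (𝓕 (pieceSymbol φ k) : 𝓢(Space d, ℂ)).compSubConstCLM ℂ x y = 0 := by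
  rw [lpPiece_eq_multiplier, lpPiece_eq_multiplier]
  refine integral_multiplier_mul_multiplier_mul_eq_zero (fun ξ ζ hi hj => ?_) u v
  rw [fourierInv_translate_fourier]
  by_contra hc
  exact h (interacting_of_pieceSymbol_ne_zero φ hi hj (right_ne_zero_of_mul hc))

theorem lpPiece_reproducing (φ : LPCutoff d) (k : ℕ) (u : 𝓢'(Space d, ℂ)) (x : Space d) :
    ∫ y, 𝓕 (φ.dilate (k + 1)) (y - x) * lpPiece φ k u y = lpPiece φ k u x := by
  rw [lpPiece_eq_multiplier]
  exact integral_fourier_translate_mul_multiplier (dilate_mul_pieceSymbol φ k) u x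

/-! ### Pairings of separated pieces with a test function -/

/-- The moments `∫ |ξ|^M |𝓕⁻ θ (ξ)| dξ`. -/
def spectralMoment (M : ℕ) (θ : 𝓢(Space d, ℂ)) : ℝ := ∫ ξ, ‖ξ‖ ^ M * ‖𝓕⁻ θ ξ‖

theorem spectralMoment_nonneg (M : ℕ) (θ : 𝓢(Space d, ℂ)) : 0 ≤ spectralMoment M θ :=
  integral_nonneg fun _ => by positivity

/-- Two Schwartz seminorms of `𝓕⁻ θ` dominate the moment, and `𝓕⁻` is continuous on Schwartz
functions. This will make the product a continuous functional of `θ`. -/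
theorem exists_spectralMoment_le (M : ℕ) : ∃ (s : Finset (ℕ × ℕ)) (C : ℝ), 0 ≤ C ∧
    ∀ θ : 𝓢(Space d, ℂ), spectralMoment M θ ≤ C * s.sup (schwartzSeminormFamily ℂ (Space d) ℂ) θ := by
  set l := (volume : Measure (Space d)).integrablePower with hl
  set c := 2 ^ l * ∫ x : Space d, (1 + ‖x‖) ^ (-(l : ℝ)) with hc
  have hc0 : 0 ≤ c := by positivity
  have h1 : ∀ θ : 𝓢(Space d, ℂ), spectralMoment M θ ≤
      c * (SchwartzMap.seminorm ℂ 0 0 (𝓕⁻ θ) + SchwartzMap.seminorm ℂ (M + l) 0 (𝓕⁻ θ)) := by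
    intro θ
    have := integral_pow_mul_iteratedFDeriv_le ℂ (volume : Measure (Space d)) (𝓕⁻ θ) M 0
    simp only [norm_iteratedFDeriv_zero] at this
    exact this
  let q : Seminorm ℂ 𝓢(Space d, ℂ) :=
    (SchwartzMap.seminorm ℂ 0 0 + SchwartzMap.seminorm ℂ (M + l) 0).comp
      (fourierInvCLM ℂ 𝓢(Space d, ℂ)).toLinearMap
  have hq : Continuous q := by
    have hs := (schwartz_withSeminorms ℂ (Space d) ℂ)
    have a := (hs.continuous_seminorm (0, 0)).add (hs.continuous_seminorm (M + l, 0))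
    exact a.comp (fourierInvCLM ℂ 𝓢(Space d, ℂ)).continuous
  obtain ⟨s, C, -, h⟩ := Seminorm.bound_of_continuous (schwartz_withSeminorms ℂ (Space d) ℂ) q hq
  refine ⟨s, c * C, by positivity, fun θ => (h1 θ).trans ?_⟩
  rw [mul_assoc c]
  exact mul_le_mul_of_nonneg_left (h θ) hc0

theorem norm_le_integral_fourierInv (θ : 𝓢(Space d, ℂ)) (x : Space d) :
    ‖θ x‖ ≤ ∫ ξ, ‖𝓕⁻ θ ξ‖ := by
  have h : θ x = 𝓕 (𝓕⁻ θ) x := by simp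
  rw [h, fourier_coe, Real.fourier_eq']
  refine (norm_integral_le_integral_norm _).trans (le_of_eq ?_)
  congr 1
  ext v
  rw [norm_smul, Complex.norm_exp_ofReal_mul_I, one_mul]

theorem norm_le_spectralMoment_zero (θ : 𝓢(Space d, ℂ)) (x : Space d) :
    ‖θ x‖ ≤ spectralMoment 0 θ := by
  simpa [spectralMoment] using norm_le_integral_fourierInv θ x

/-- The part of a test function with frequencies above `2^n`. -/
theorem exists_highFrequency_part (φ : LPCutoff d) (n M : ℕ) (θ : 𝓢(Space d, ℂ)) :
    ∃ θ' : 𝓢(Space d, ℂ),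
      (∀ ξ, φ.radius * 2 ^ (n + 1) ≤ ‖ξ‖ → 𝓕⁻ (θ - θ') ξ = 0) ∧
      ∀ x, ‖θ' x‖ ≤ (φ.radius * 2 ^ n)⁻¹ ^ M * spectralMoment M θ := by
  have hr := φ.radius_pos
  refine ⟨θ - 𝓕 (schwartzMul (φ.dilate n) (𝓕⁻ θ)), fun ξ hξ => ?_, fun x => ?_⟩
  · rw [sub_sub_cancel]
    simp [φ.dilate_eq_zero hξ]
  · refine (norm_le_integral_fourierInv _ x).trans ?_
    rw [spectralMoment, ← integral_const_mul]
    refine integral_mono (SchwartzMap.integrable _).norm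
      (((𝓕⁻ θ).integrable_pow_mul volume M).const_mul _) fun ξ => ?_
    have e : 𝓕⁻ (θ - 𝓕 (schwartzMul (φ.dilate n) (𝓕⁻ θ))) =
        𝓕⁻ θ - 𝓕⁻ (𝓕 (schwartzMul (φ.dilate n) (𝓕⁻ θ))) :=
      map_sub (fourierInvCLM ℂ 𝓢(Space d, ℂ)) _ _
    have e2 : 𝓕⁻ (θ - 𝓕 (schwartzMul (φ.dilate n) (𝓕⁻ θ))) ξ =
        (1 - φ.dilate n ξ) * 𝓕⁻ θ ξ := by
      rw [e]
      simp only [fourierInv_fourier_eq, sub_apply, schwartzMul_apply]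
      ring
    simp only [e2, norm_mul]
    -- Where `1 - φ (2^{-n} ξ)` does not vanish, `|ξ|` exceeds `r 2^n`, so the factor `(|ξ| / (r
    -- 2^n))^M` is at least one and can be inserted.
    rcases le_or_gt ‖ξ‖ (φ.radius * 2 ^ n) with hξ | hξ
    · rw [φ.dilate_eq_one hξ, sub_self, norm_zero, zero_mul]
      positivity
    · rw [← mul_assoc, ← mul_pow]
      refine mul_le_mul_of_nonneg_right ((φ.norm_one_sub_dilate_le n ξ).trans ?_) (norm_nonneg _)
      refine one_le_pow₀ ?_
      rw [le_inv_mul_iff₀ (by positivity)]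
      linarith

/-- For separated frequencies only the high frequencies of a test function matter. -/
theorem exists_integral_lpPiece_mul_eq (φ : LPCutoff d) {i j : ℕ} (hij : i + 3 ≤ j) (M : ℕ)
    (θ : 𝓢(Space d, ℂ)) :
    ∃ θ' : 𝓢(Space d, ℂ),
      (∀ x, ‖θ' x‖ ≤ (φ.radius * 2 ^ (j - 3))⁻¹ ^ M * spectralMoment M θ) ∧
      (∀ u v : 𝓢'(Space d, ℂ), ∫ x, lpPiece φ i u x * lpPiece φ j v x * (θ - θ') x = 0) ∧
      (∀ u v : 𝓢'(Space d, ℂ), ∫ x, lpPiece φ j u x * lpPiece φ i v x * (θ - θ') x = 0) := by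
  obtain ⟨θ', h1, h2⟩ := exists_highFrequency_part φ (j - 3) M θ
  have e : j - 3 + 1 = j - 2 := by omega
  rw [e] at h1
  refine ⟨θ', h2, fun u v => ?_, fun u v => ?_⟩
  · rw [lpPiece_eq_multiplier, lpPiece_eq_multiplier]
    exact integral_multiplier_mul_multiplier_mul_eq_zero (fun ξ ζ hi hj =>
      h1 _ (norm_add_bounds_of_separated φ hij hi hj).1.le) u v
  · rw [lpPiece_eq_multiplier, lpPiece_eq_multiplier]
    exact integral_multiplier_mul_multiplier_mul_eq_zero (fun ξ ζ hi hj => by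
      rw [add_comm]
      exact h1 _ (norm_add_bounds_of_separated φ hij hj hi).1.le) u v

/-! ### Kernels and lattice weights -/

/-- The majorant `2^{Nd} (1 + 2^N |z|)^{-p}` of a convolution kernel at frequency `2^N`. -/
def decayKernel (d p N : ℕ) (z : Space d) : ℝ≥0∞ :=
  ENNReal.ofReal (2 ^ (N * d) / (1 + 2 ^ N * ‖z‖) ^ p)

theorem measurable_decayKernel (d p N : ℕ) : Measurable (decayKernel d p N) := by
  unfold decayKernel
  fun_prop

theorem decayKernel_neg (p N : ℕ) (z : Space d) : decayKernel d p N (-z) = decayKernel d p N z := by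
  simp [decayKernel]

theorem decayKernel_add (p q N : ℕ) (z : Space d) :
    decayKernel d (p + q) N z =
      decayKernel d p N z * ENNReal.ofReal (1 / (1 + 2 ^ N * ‖z‖) ^ q) := by
  rw [decayKernel, decayKernel, ← ENNReal.ofReal_mul (by positivity), pow_add]
  congr 1
  field_simp

theorem decayKernel_succ_le (p N : ℕ) (z : Space d) :
    decayKernel d p (N + 1) z ≤ 2 ^ d * decayKernel d p N z := by
  have e : (2 : ℝ≥0∞) ^ d = ENNReal.ofReal (2 ^ d) := by
    rw [ENNReal.ofReal_pow (by norm_num)]; simp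
  rw [decayKernel, decayKernel, e, ← ENNReal.ofReal_mul (by positivity)]
  refine ENNReal.ofReal_le_ofReal ?_
  rw [← mul_div_assoc, ← pow_add, add_mul, one_mul, add_comm d]
  gcongr <;> norm_num

theorem decayKernel_le_succ (p N : ℕ) (z : Space d) :
    decayKernel d p N z ≤ 2 ^ p * decayKernel d p (N + 1) z := by
  have e : (2 : ℝ≥0∞) ^ p = ENNReal.ofReal (2 ^ p) := by
    rw [ENNReal.ofReal_pow (by norm_num)]; simp
  rw [decayKernel, decayKernel, e, ← ENNReal.ofReal_mul (by positivity)]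
  refine ENNReal.ofReal_le_ofReal ?_
  rw [div_le_iff₀ (by positivity)]
  have h1 : (1 + 2 ^ (N + 1) * ‖z‖) ^ p ≤ 2 ^ p * (1 + 2 ^ N * ‖z‖) ^ p := by
    rw [← mul_pow]
    refine pow_le_pow_left₀ (by positivity) ?_ _
    rw [pow_succ]
    linarith
  have h2 : (2 : ℝ) ^ (N * d) ≤ 2 ^ ((N + 1) * d) := by
    gcongr
    · norm_num
    · omega
  calc (2 : ℝ) ^ (N * d) ≤ 2 ^ ((N + 1) * d) := h2
    _ = 2 ^ ((N + 1) * d) / (1 + 2 ^ (N + 1) * ‖z‖) ^ p * (1 + 2 ^ (N + 1) * ‖z‖) ^ p := by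
        field_simp
    _ ≤ 2 ^ ((N + 1) * d) / (1 + 2 ^ (N + 1) * ‖z‖) ^ p * (2 ^ p * (1 + 2 ^ N * ‖z‖) ^ p) := by
        gcongr
    _ = _ := by ring

/-! ### Decay and mass of the Littlewood-Paley kernels. -/

theorem fourier_dilate (φ : LPCutoff d) (N : ℕ) (y : Space d) :
    𝓕 (φ.dilate N) y = 2 ^ (N * d) * 𝓕 φ.toSchwartz ((2 : ℝ) ^ N • y) := by
  have hF : ∀ (f : 𝓢(Space d, ℂ)) (w : Space d), 𝓕 f w =
      ∫ v, Complex.exp (↑(-2 * Real.pi * inner ℝ v w) * Complex.I) * f v := fun f w => by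
    rw [fourier_coe, Real.fourier_eq']
    simp only [smul_eq_mul]
  have h2 : (0 : ℝ) < 2 ^ N := by positivity
  have h := Measure.integral_comp_smul (volume : Measure (Space d))
    (fun v => Complex.exp (↑(-2 * Real.pi * inner ℝ v ((2 : ℝ) ^ N • y)) * Complex.I) *
      φ.toSchwartz v) ((2 : ℝ) ^ N)⁻¹
  rw [hF, hF]
  have e : ∀ v : Space d, Complex.exp (↑(-2 * Real.pi * inner ℝ (((2 : ℝ) ^ N)⁻¹ • v)
      ((2 : ℝ) ^ N • y)) * Complex.I) * φ.toSchwartz (((2 : ℝ) ^ N)⁻¹ • v) =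
      Complex.exp (↑(-2 * Real.pi * inner ℝ v y) * Complex.I) * φ.dilate N v := by
    intro v
    rw [LPCutoff.dilate_apply, inner_smul_left, inner_smul_right]
    congr 4
    simp only [map_inv₀, conj_trivial]
    field_simp
  simp only [e] at h
  rw [h, finrank_euclideanSpace_fin, ← inv_pow, inv_inv, abs_of_pos (by positivity),
    ← pow_mul, Complex.real_smul]
  push_cast
  rfl

theorem exists_enorm_fourier_dilate_le (φ : LPCutoff d) (p : ℕ) :
    ∃ C : ℝ≥0∞, C ≠ ⊤ ∧ ∀ N z, ‖𝓕 (φ.dilate N) z‖ₑ ≤ C * decayKernel d p N z := by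
  obtain ⟨C, hC, h⟩ := exists_one_add_norm_pow_mul_le (𝓕 φ.toSchwartz : 𝓢(Space d, ℂ)) p 0
  refine ⟨ENNReal.ofReal C, ENNReal.ofReal_ne_top, fun N z => ?_⟩
  rw [decayKernel, ← ENNReal.ofReal_mul hC, ← ofReal_norm, fourier_dilate]
  refine ENNReal.ofReal_le_ofReal ?_
  have h1 := h ((2 : ℝ) ^ N • z)
  rw [norm_iteratedFDeriv_zero, norm_smul, norm_pow, Real.norm_ofNat] at h1
  rw [norm_mul, norm_pow, Complex.norm_ofNat, ← mul_div_assoc, le_div_iff₀ (by positivity)]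
  calc _ = 2 ^ (N * d) * ((1 + 2 ^ N * ‖z‖) ^ p * ‖(𝓕 φ.toSchwartz) ((2 : ℝ) ^ N • z)‖) := by ring
    _ ≤ 2 ^ (N * d) * C := by gcongr
    _ = _ := by ring

theorem exists_enorm_fourier_pieceSymbol_le (φ : LPCutoff d) (p : ℕ) :
    ∃ C : ℝ≥0∞, C ≠ ⊤ ∧ ∀ k z, ‖𝓕 (pieceSymbol φ k) z‖ₑ ≤ C * decayKernel d p k z := by
  obtain ⟨C, hC, h⟩ := exists_enorm_fourier_dilate_le φ p
  refine ⟨C * (1 + 2 ^ p), by finiteness, fun k z => ?_⟩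
  cases k with
  | zero =>
    refine (h 0 z).trans ?_
    gcongr
    exact le_mul_of_one_le_right' le_self_add
  | succ k =>
    have e : 𝓕 (pieceSymbol φ (k + 1)) = 𝓕 (φ.dilate (k + 1)) - 𝓕 (φ.dilate k) :=
      map_sub (fourierCLM ℂ 𝓢(Space d, ℂ)) _ _
    rw [e]
    calc ‖𝓕 (φ.dilate (k + 1)) z - 𝓕 (φ.dilate k) z‖ₑ
        ≤ ‖𝓕 (φ.dilate (k + 1)) z‖ₑ + ‖𝓕 (φ.dilate k) z‖ₑ := enorm_sub_le
      _ ≤ C * decayKernel d p (k + 1) z + C * (2 ^ p * decayKernel d p (k + 1) z) := by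
          gcongr
          · exact h _ _
          · exact (h _ _).trans (by gcongr; exact decayKernel_le_succ _ _ _)
      _ = _ := by ring

theorem lintegral_decayKernel (N : ℕ) :
    ∫⁻ z, decayKernel d (d + 1) N z = ∫⁻ z, decayKernel d (d + 1) 0 z := by
  have h2 : (2 : ℝ) ^ N ≠ 0 := by positivity
  have hm := (measurable_decayKernel d (d + 1) 0)
  have h := lintegral_map (μ := (volume : Measure (Space d))) hm
    (measurable_const_smul ((2 : ℝ) ^ N))
  rw [Measure.map_addHaar_smul _ h2, lintegral_smul_measure] at h
  have e : ∀ z : Space d, decayKernel d (d + 1) N z =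
      ENNReal.ofReal (2 ^ (N * d)) * decayKernel d (d + 1) 0 ((2 : ℝ) ^ N • z) := by
    intro z
    rw [decayKernel, decayKernel, ← ENNReal.ofReal_mul (by positivity), norm_smul, norm_pow,
      Real.norm_ofNat]
    congr 1
    simp
    ring
  simp only [e]
  rw [lintegral_const_mul' _ _ ENNReal.ofReal_ne_top, ← h, smul_eq_mul, ← mul_assoc,
    ← ENNReal.ofReal_mul (by positivity), finrank_euclideanSpace_fin, ← pow_mul,
    abs_of_pos (by positivity), mul_inv_cancel₀ (by positivity), ENNReal.ofReal_one, one_mul]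

theorem lintegral_decayKernel_lt_top (N : ℕ) : ∫⁻ z, decayKernel d (d + 1) N z < ⊤ := by
  rw [lintegral_decayKernel]
  have := finite_integral_one_add_norm (μ := (volume : Measure (Space d))) (r := (d : ℝ) + 1)
    (by rw [finrank_euclideanSpace_fin]; linarith)
  refine lt_of_le_of_lt (lintegral_mono fun z => ENNReal.ofReal_le_ofReal ?_) this
  rw [Real.rpow_neg (by positivity), ← Nat.cast_add_one, Real.rpow_natCast]
  simp

/-- The common `L¹` norm of the kernels `decayKernel d (d + 1) N`. -/
def kernelMass (d : ℕ) : ℝ≥0∞ := ∫⁻ z, decayKernel d (d + 1) 0 z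

theorem kernelMass_ne_top (d : ℕ) : kernelMass d ≠ ⊤ := (lintegral_decayKernel_lt_top 0).ne

theorem lintegral_decayKernel_sub_left (N : ℕ) (x : Space d) :
    ∫⁻ y, decayKernel d (d + 1) N (y - x) = kernelMass d := by
  rw [lintegral_sub_right_eq_self (fun z => decayKernel d (d + 1) N z), lintegral_decayKernel]
  rfl

theorem lintegral_decayKernel_sub_right (N : ℕ) (y : Space d) :
    ∫⁻ x, decayKernel d (d + 1) N (y - x) = kernelMass d := by
  rw [← lintegral_decayKernel_sub_left N y]
  congr 1
  ext x
  rw [← decayKernel_neg, neg_sub]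

theorem decayKernel_le (p N : ℕ) (z : Space d) : decayKernel d p N z ≤ 2 ^ (N * d) := by
  have e : (2 : ℝ≥0∞) ^ (N * d) = ENNReal.ofReal (2 ^ (N * d)) := by
    rw [ENNReal.ofReal_pow (by norm_num)]; simp
  rw [e]
  refine ENNReal.ofReal_le_ofReal (div_le_self (by positivity) (one_le_pow₀ ?_))
  have : 0 ≤ 2 ^ N * ‖z‖ := by positivity
  linarith

theorem lintegral_decayKernel_sq_left_le (N : ℕ) (x : Space d) :
    ∫⁻ y, decayKernel d (d + 1) N (y - x) ^ 2 ≤ 2 ^ (N * d) * kernelMass d := by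
  rw [← lintegral_decayKernel_sub_left N x, ← lintegral_const_mul]
  · refine lintegral_mono fun y => ?_
    rw [pow_two]
    exact mul_le_mul_left (decayKernel_le _ _ _) _
  · exact (measurable_decayKernel _ _ _).comp (measurable_id.sub_const x)

theorem lintegral_decayKernel_sq_right_le (N : ℕ) (y : Space d) :
    ∫⁻ x, decayKernel d (d + 1) N (y - x) ^ 2 ≤ 2 ^ (N * d) * kernelMass d := by
  refine le_trans (le_of_eq ?_) (lintegral_decayKernel_sq_left_le N y)
  congr 1
  ext x
  rw [← decayKernel_neg, neg_sub]

/-- A summable weight on `ℤ^d`. -/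
def latticeWeight (n : Fin d → ℤ) : ℝ≥0∞ := ENNReal.ofReal (1 / (1 + ‖n‖) ^ (d + 1))

/-- The sum of the weight over the lattice. -/
def weightMass (d : ℕ) : ℝ≥0∞ := ∑' n : Fin d → ℤ, latticeWeight n

theorem latticeWeight_neg (n : Fin d → ℤ) : latticeWeight (-n) = latticeWeight n := by
  simp [latticeWeight]

/-- Comparison with the power `d + 1` of the inverse norm on the lattice spanned by the standard
basis, away from the origin. -/
theorem weightMass_ne_top (d : ℕ) : weightMass d ≠ ⊤ := by
  let L := Submodule.span ℤ (Set.range (Pi.basisFun ℝ (Fin d)))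
  have hrank : Module.finrank ℤ L = d := by
    rw [ZLattice.rank ℝ L]; simp
  have hs : Summable fun z : L => ‖z‖ ^ (-((d : ℝ) + 1)) :=
    ZLattice.summable_norm_rpow L _ (by rw [hrank]; linarith)
  let ι : (Fin d → ℤ) → L := fun n => ⟨fun i => (n i : ℝ), by
    rw [(Pi.basisFun ℝ (Fin d)).mem_span_iff_repr_mem ℤ]
    intro i
    simp⟩
  have hι : Function.Injective ι := by
    intro a b hab
    ext i
    have : (a i : ℝ) = b i := congrFun (congrArg Subtype.val hab) i
    exact_mod_cast this
  have hn : ∀ n : Fin d → ℤ, ‖ι n‖ = ‖n‖ := by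
    intro n
    change ‖fun i => (n i : ℝ)‖ = ‖n‖
    simp only [Pi.norm_def]
    rfl
  have hs2 : Summable fun n : Fin d → ℤ => 1 / (1 + ‖n‖) ^ (d + 1) := by
    refine Summable.of_norm_bounded_eventually (hs.comp_injective hι) ?_
    have : ∀ᶠ n : Fin d → ℤ in cofinite, n ≠ 0 := (Set.finite_singleton 0).compl_mem_cofinite
    filter_upwards [this] with n hn0
    have hp : 0 < ‖n‖ := norm_pos_iff.2 hn0
    simp only [Function.comp]
    rw [hn, Real.rpow_neg hp.le, ← Nat.cast_add_one, Real.rpow_natCast,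
      Real.norm_of_nonneg (by positivity), ← one_div]
    gcongr
    linarith
  unfold weightMass latticeWeight
  exact hs2.tsum_ofReal_ne_top

theorem tsum_latticeWeight_sub_left (m : Fin d → ℤ) :
    ∑' n : Fin d → ℤ, latticeWeight (n - m) = weightMass d :=
  (Equiv.subRight m).tsum_eq (fun n => latticeWeight n)

/-- The `ℓ¹` convolution identity on `ℤ^d`; it removes the tails of the kernels and cutoffs from
every sum over cubes. -/
theorem tsum_tsum_latticeWeight_mul (a : (Fin d → ℤ) → ℝ≥0∞) :
    ∑' n : Fin d → ℤ, ∑' m : Fin d → ℤ, latticeWeight (n - m) * a m = weightMass d * ∑' m, a m := by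
  rw [ENNReal.tsum_comm, ← ENNReal.tsum_mul_left]
  refine tsum_congr fun m => ?_
  rw [ENNReal.tsum_mul_right, tsum_latticeWeight_sub_left]

/-! ### Cubes -/

theorem mem_cube_iff {l : ℕ} {n : Fin d → ℤ} {x : Space d} :
    x ∈ cube l n ↔ ∀ i, ⌊x i / 2 ^ l⌋ = n i := by
  refine forall_congr' fun i => ?_
  rw [Int.floor_eq_iff, le_div_iff₀ (by positivity), div_lt_iff₀ (by positivity), mul_comm,
    mul_comm ((n i : ℝ) + 1)]

/-- The index of the cube of scale `2^l` containing a given point. -/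
def cubeIndex (l : ℕ) (x : Space d) : Fin d → ℤ := fun i => ⌊x i / 2 ^ l⌋

theorem mem_cube_iff_eq {l : ℕ} {n : Fin d → ℤ} {x : Space d} :
    x ∈ cube l n ↔ n = cubeIndex l x := by
  rw [mem_cube_iff, funext_iff]
  exact forall_congr' fun i => eq_comm

theorem measurableSet_cube (l : ℕ) (n : Fin d → ℤ) : MeasurableSet (cube l n) := by
  have : cube l n = ⋂ i, {x : Space d | (2 : ℝ) ^ l * n i ≤ x i ∧ x i < (2 : ℝ) ^ l * (n i + 1)} := by
    ext x; simp [cube]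
  rw [this]
  refine MeasurableSet.iInter fun i => ?_
  have : Measurable fun x : Space d => x i := by fun_prop
  exact (measurableSet_le measurable_const this).inter (measurableSet_lt this measurable_const)

theorem pairwise_disjoint_cube (l : ℕ) :
    Pairwise (Function.onFun Disjoint (cube (d := d) l)) := by
  intro n m hnm
  refine Set.disjoint_left.2 fun x h1 h2 => hnm ?_
  rw [mem_cube_iff_eq.1 h1, mem_cube_iff_eq.1 h2]

theorem iUnion_cube (l : ℕ) : ⋃ n, cube (d := d) l n = Set.univ :=
  Set.eq_univ_of_forall fun _ => Set.mem_iUnion.2 ⟨_, mem_cube_iff_eq.2 rfl⟩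

theorem norm_sub_le_of_mem_cube {l : ℕ} {n m : Fin d → ℤ} {x y : Space d} (hx : x ∈ cube l n)
    (hy : y ∈ cube l m) : ‖n - m‖ ≤ 1 + ‖y - x‖ := by
  refine (pi_norm_le_iff_of_nonneg (by positivity)).2 fun i => ?_
  have h1 := hx i
  have h2 := hy i
  have h3 : |y i - x i| ≤ ‖y - x‖ := by simpa using PiLp.norm_apply_le (y - x) i
  have h4 : (1 : ℝ) ≤ 2 ^ l := one_le_pow₀ one_le_two
  rw [Pi.sub_apply, Int.norm_eq_abs]
  push_cast
  rw [abs_le] at h3 ⊢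
  constructor
  · by_contra! hc
    nlinarith
  · by_contra! hc
    nlinarith

/-- Of the decay, `d + 1` powers are traded for the lattice weight, uniformly in `l` and `N`: cubes
have side at least one and `2^N ≥ 1`, whence `1 + |n - m| ≤ 2 + |y - x| ≤ 2 (1 + 2^N |y - x|)`. -/
theorem decayKernel_le_latticeWeight {l N p : ℕ} {n m : Fin d → ℤ} {x y : Space d}
    (hx : x ∈ cube l n) (hy : y ∈ cube l m) :
    decayKernel d (p + (d + 1)) N (y - x) ≤
      2 ^ (d + 1) * latticeWeight (n - m) * decayKernel d p N (y - x) := by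
  rw [decayKernel_add, mul_comm]
  gcongr
  have e : (2 : ℝ≥0∞) ^ (d + 1) = ENNReal.ofReal (2 ^ (d + 1)) := by
    rw [ENNReal.ofReal_pow (by norm_num)]; simp
  rw [latticeWeight, e, ← ENNReal.ofReal_mul (by positivity)]
  refine ENNReal.ofReal_le_ofReal ?_
  rw [mul_one_div, div_le_div_iff₀ (by positivity) (by positivity), one_mul, ← mul_pow]
  refine pow_le_pow_left₀ (by positivity) ?_ _
  have h := norm_sub_le_of_mem_cube hx hy
  have : ‖y - x‖ ≤ 2 ^ N * ‖y - x‖ :=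
    le_mul_of_one_le_left (norm_nonneg _) (one_le_pow₀ one_le_two)
  linarith [norm_nonneg (y - x)]

/-- The index of the cube of scale `2^k` containing `cube l m`, for `l ≤ k`. -/
def parentIndex (l k : ℕ) (m : Fin d → ℤ) : Fin d → ℤ := fun i => m i / 2 ^ (k - l)

theorem cube_subset_parent {l k : ℕ} (h : l ≤ k) (m : Fin d → ℤ) :
    cube l m ⊆ cube k (parentIndex l k m) := by
  intro x hx i
  have h1 := hx i
  obtain ⟨e, rfl⟩ := Nat.exists_eq_add_of_le h
  have he : l + e - l = e := by omega
  simp only [parentIndex, he]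
  have hp : (0 : ℤ) < 2 ^ e := by positivity
  have h2 : (2 : ℤ) ^ e * (m i / 2 ^ e) ≤ m i := Int.mul_ediv_self_le hp.ne'
  have h3 : m i + 1 ≤ (2 : ℤ) ^ e * (m i / 2 ^ e + 1) := by
    have := Int.lt_mul_ediv_self_add (x := m i) hp
    rw [mul_add, mul_one]
    omega
  have h2' : (2 : ℝ) ^ e * ((m i / 2 ^ e : ℤ) : ℝ) ≤ m i := by exact_mod_cast h2
  have h3' : (m i : ℝ) + 1 ≤ (2 : ℝ) ^ e * (((m i / 2 ^ e : ℤ) : ℝ) + 1) := by exact_mod_cast h3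
  have hl : (0 : ℝ) < 2 ^ l := by positivity
  rw [pow_add, mul_assoc, mul_assoc]
  exact ⟨(mul_le_mul_of_nonneg_left h2' hl.le).trans h1.1,
    h1.2.trans_le (mul_le_mul_of_nonneg_left h3' hl.le)⟩

/-! ### The partition of unity -/

theorem CubePartition.cutoff_nonneg (χ : CubePartition d) (j : ℕ) (n : Fin d → ℤ) (x : Space d) :
    0 ≤ χ.cutoff j n x := χ.nonneg _

theorem CubePartition.hasSum_cutoff (χ : CubePartition d) (j : ℕ) (x : Space d) :
    HasSum (fun n => χ.cutoff j n x) 1 := χ.sum_eq_one _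

theorem CubePartition.continuous_cutoff (χ : CubePartition d) (j : ℕ) (n : Fin d → ℤ) :
    Continuous (χ.cutoff j n) := by
  have := χ.smooth.continuous
  unfold CubePartition.cutoff
  fun_prop

theorem CubePartition.cutoff_le_one (χ : CubePartition d) (j : ℕ) (n : Fin d → ℤ) (x : Space d) :
    χ.cutoff j n x ≤ 1 :=
  le_hasSum (χ.hasSum_cutoff j x) n fun m _ => χ.cutoff_nonneg j m x

theorem CubePartition.tsum_enorm_cutoff (χ : CubePartition d) (j : ℕ) (x : Space d) :
    ∑' n, ENNReal.ofReal (χ.cutoff j n x) = 1 := by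
  rw [← ENNReal.ofReal_tsum_of_nonneg (fun n => χ.cutoff_nonneg j n x) (χ.hasSum_cutoff j x).summable,
    (χ.hasSum_cutoff j x).tsum_eq, ENNReal.ofReal_one]

/-- At scale `2^k`, the support of a cutoff meets only cubes at bounded index distance. Stated
through the lattice weight, this finite overlap is handled by the same sums as the kernel tails. -/
theorem CubePartition.exists_cutoff_weight (χ : CubePartition d) :
    ∃ C : ℝ≥0∞, C ≠ ⊤ ∧ ∀ (k : ℕ) (n m : Fin d → ℤ) (x : Space d), x ∈ cube k m →
      χ.cutoff k n x ≠ 0 → 1 ≤ C * latticeWeight (n - m) := by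
  obtain ⟨R, hR⟩ := χ.compact.isCompact.isBounded.exists_norm_le
  have hR0 : ∀ z, χ.toFun z ≠ 0 → ‖z‖ ≤ |R| := fun z hz =>
    (hR z (subset_tsupport _ hz)).trans (le_abs_self R)
  refine ⟨ENNReal.ofReal ((2 + |R|) ^ (d + 1)), ENNReal.ofReal_ne_top, fun k n m x hx hn => ?_⟩
  have h1 := hR0 _ hn
  rw [latticeWeight, ← ENNReal.ofReal_mul (by positivity), ENNReal.one_le_ofReal, mul_one_div,
    le_div_iff₀ (by positivity), one_mul]
  refine pow_le_pow_left₀ (by positivity) ?_ _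
  have : ‖n - m‖ ≤ 1 + |R| := by
    refine (pi_norm_le_iff_of_nonneg (by positivity)).2 fun i => ?_
    have h2 := hx i
    have h3 := (PiLp.norm_apply_le ((2 : ℝ) ^ (-(k : ℤ)) • x - latticePoint n) i).trans h1
    have h4 : ((2 : ℝ) ^ (-(k : ℤ)) • x - latticePoint n) i = x i / 2 ^ k - n i := by
      simp [latticePoint, zpow_neg, div_eq_inv_mul]
    have h5 : (m i : ℝ) ≤ x i / 2 ^ k := by rw [le_div_iff₀ (by positivity)]; linarith
    have h6 : x i / 2 ^ k < m i + 1 := by rw [div_lt_iff₀ (by positivity)]; linarith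
    rw [h4, Real.norm_eq_abs, abs_le] at h3
    rw [Pi.sub_apply, Int.norm_eq_abs]
    push_cast
    rw [abs_le]
    constructor <;> linarith
  linarith

/-! ### `L²` norms of functions with values in `[0, ∞]` -/

section LTwo

variable {α : Type*} [MeasurableSpace α] {μ ν : Measure α}

/-- The `L²` norm of a function with values in `[0, ∞]`. -/
def lTwo (μ : Measure α) (f : α → ℝ≥0∞) : ℝ≥0∞ := (∫⁻ a, f a ^ 2 ∂μ) ^ (1 / 2 : ℝ)

theorem ENNReal_sq_rpow_half (a : ℝ≥0∞) : (a ^ 2) ^ (1 / 2 : ℝ) = a := by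
  rw [← ENNReal.rpow_natCast, ← ENNReal.rpow_mul]; simp

theorem ENNReal_rpow_half_sq (a : ℝ≥0∞) : (a ^ (1 / 2 : ℝ)) ^ 2 = a := by
  rw [← ENNReal.rpow_natCast, ← ENNReal.rpow_mul]; simp

theorem lTwo_sq (μ : Measure α) (f : α → ℝ≥0∞) : lTwo μ f ^ 2 = ∫⁻ a, f a ^ 2 ∂μ :=
  ENNReal_rpow_half_sq _

theorem lTwo_le_of_sq_le {f : α → ℝ≥0∞} {b : ℝ≥0∞} (h : ∫⁻ a, f a ^ 2 ∂μ ≤ b ^ 2) :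
    lTwo μ f ≤ b := by
  rw [← ENNReal_sq_rpow_half b]
  exact ENNReal.rpow_le_rpow h (by norm_num)

theorem eLpNorm_two_eq_lTwo (F : α → ℂ) : eLpNorm F 2 μ = lTwo μ fun a => ‖F a‖ₑ := by
  rw [eLpNorm_eq_lintegral_rpow_enorm_toReal two_ne_zero ENNReal.ofNat_ne_top, lTwo]
  simp

theorem lTwo_mono_ae {f g : α → ℝ≥0∞} (h : ∀ᵐ a ∂μ, f a ≤ g a) : lTwo μ f ≤ lTwo μ g :=
  ENNReal.rpow_le_rpow (lintegral_mono_ae (h.mono fun a ha => pow_le_pow_left₀ bot_le ha 2))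
    (by norm_num)

theorem lTwo_mono {f g : α → ℝ≥0∞} (h : ∀ a, f a ≤ g a) : lTwo μ f ≤ lTwo μ g :=
  lTwo_mono_ae (Eventually.of_forall h)

theorem lTwo_mono_measure {f : α → ℝ≥0∞} (h : μ ≤ ν) : lTwo μ f ≤ lTwo ν f :=
  ENNReal.rpow_le_rpow (lintegral_mono' h le_rfl) (by norm_num)

theorem lTwo_const_mul (c : ℝ≥0∞) {f : α → ℝ≥0∞} (hf : AEMeasurable f μ) :
    lTwo μ (fun a => c * f a) = c * lTwo μ f := by
  simp only [lTwo, mul_pow]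
  rw [lintegral_const_mul'' _ (hf.pow_const 2), ENNReal.mul_rpow_of_nonneg _ _ (by norm_num),
    ENNReal_sq_rpow_half]

theorem lintegral_mul_le_lTwo {f g : α → ℝ≥0∞} (hf : AEMeasurable f μ) (hg : AEMeasurable g μ) :
    ∫⁻ a, f a * g a ∂μ ≤ lTwo μ f * lTwo μ g := by
  have h := ENNReal.lintegral_mul_le_Lp_mul_Lq μ (p := 2) (q := 2)
    (by rw [Real.holderConjugate_iff]; norm_num) hf hg
  simpa only [lTwo, Pi.mul_apply, ENNReal.rpow_two] using h

theorem sq_lintegral_mul_le {f g : α → ℝ≥0∞} (hf : AEMeasurable f μ) (hg : AEMeasurable g μ) :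
    (∫⁻ a, f a * g a ∂μ) ^ 2 ≤ (∫⁻ a, f a ^ 2 ∂μ) * ∫⁻ a, g a ^ 2 ∂μ := by
  rw [← lTwo_sq, ← lTwo_sq, ← mul_pow]
  exact pow_le_pow_left₀ bot_le (lintegral_mul_le_lTwo hf hg) 2

/-- Minkowski's inequality: expand the square into a double sum and apply Cauchy-Schwarz to each
term. -/
theorem lTwo_tsum_le {ι : Type*} [Countable ι] {f : ι → α → ℝ≥0∞}
    (hf : ∀ i, AEMeasurable (f i) μ) :
    lTwo μ (fun a => ∑' i, f i a) ≤ ∑' i, lTwo μ (f i) := by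
  refine lTwo_le_of_sq_le ?_
  simp only [pow_two, ← ENNReal.tsum_mul_left]
  simp only [← ENNReal.tsum_mul_right]
  have hm : ∀ i j, AEMeasurable (fun a => f j a * f i a) μ := fun i j => (hf j).mul (hf i)
  rw [lintegral_tsum fun i => AEMeasurable.tsum fun j => hm i j]
  refine ENNReal.tsum_le_tsum fun i => ?_
  rw [lintegral_tsum fun j => hm i j]
  exact ENNReal.tsum_le_tsum fun j => lintegral_mul_le_lTwo (hf j) (hf i)

theorem lTwo_sum_le {ι : Type*} (s : Finset ι) {f : ι → α → ℝ≥0∞}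
    (hf : ∀ i, AEMeasurable (f i) μ) :
    lTwo μ (fun a => ∑ i ∈ s, f i a) ≤ ∑ i ∈ s, lTwo μ (f i) := by
  have h := lTwo_tsum_le (μ := μ) (f := fun (i : s) => f i) fun i => hf i
  simp only [tsum_fintype] at h
  rwa [Finset.sum_coe_sort s fun i => lTwo μ (f i),
    show (fun a => ∑ i : s, f i a) = fun a => ∑ i ∈ s, f i a from
      funext fun a => Finset.sum_coe_sort s fun i => f i a] at h

/-- The square of an integral against a kernel. -/
theorem sq_lintegral_kernel_mul_le {k f : α → ℝ≥0∞} (hk : AEMeasurable k μ)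
    (hf : AEMeasurable f μ) :
    (∫⁻ a, k a * f a ∂μ) ^ 2 ≤ (∫⁻ a, k a ∂μ) * ∫⁻ a, k a * f a ^ 2 ∂μ := by
  have h := sq_lintegral_mul_le (hk.pow_const (1 / 2 : ℝ)) ((hk.pow_const (1 / 2 : ℝ)).mul hf)
  have e : ∀ a : α, k a ^ (1 / 2 : ℝ) * (k a ^ (1 / 2 : ℝ) * f a) = k a * f a := fun a => by
    rw [← mul_assoc, ← pow_two, ENNReal_rpow_half_sq]
  simpa only [Pi.mul_apply, e, mul_pow, ENNReal_rpow_half_sq] using h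

end LTwo

/-! ### Convolution with decaying kernels on amalgam spaces -/

instance (T : ℝ) : IsFiniteMeasure (timeMeasure T) := by
  unfold timeMeasure; infer_instance

theorem timeMeasure_univ {T : ℝ} : timeMeasure T Set.univ = ENNReal.ofReal T := by
  simp [timeMeasure]

/-- Lebesgue measure on `[0,T] × Q` for a cube `Q` of scale `2^l`. -/
def cubeMeasure (T : ℝ) (l : ℕ) (n : Fin d → ℤ) : Measure (ℝ × Space d) :=
  (timeMeasure T).prod (volume.restrict (cube l n))

theorem cubeMeasure_eq_restrict (T : ℝ) (l : ℕ) (n : Fin d → ℤ) :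
    cubeMeasure T l n = (slabMeasure d T).restrict (Set.univ ×ˢ cube l n) := by
  rw [slabMeasure, ← Measure.prod_restrict, Measure.restrict_univ, cubeMeasure]

theorem cubeMeasure_le (T : ℝ) (l : ℕ) (n : Fin d → ℤ) : cubeMeasure T l n ≤ slabMeasure d T := by
  rw [cubeMeasure_eq_restrict]
  exact Measure.restrict_le_self

theorem ae_mem_cube (T : ℝ) (l : ℕ) (n : Fin d → ℤ) : ∀ᵐ p ∂cubeMeasure T l n, p.2 ∈ cube l n := by
  rw [cubeMeasure_eq_restrict]
  filter_upwards [ae_restrict_mem (MeasurableSet.univ.prod (measurableSet_cube l n))] with p hp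
  exact hp.2

theorem lintegral_eq_tsum_cube (l : ℕ) (g : Space d → ℝ≥0∞) :
    ∫⁻ y, g y = ∑' m, ∫⁻ y in cube l m, g y := by
  rw [← lintegral_iUnion (fun m => measurableSet_cube l m) (pairwise_disjoint_cube l), iUnion_cube,
    Measure.restrict_univ]

/-- The amalgam norm `∑_{Q ∈ 𝒬_l} ‖f‖_{L²([0,T] × Q)}`. -/
def amalgam (T : ℝ) (l : ℕ) (f : ℝ × Space d → ℝ≥0∞) : ℝ≥0∞ :=
  ∑' n : Fin d → ℤ, lTwo (cubeMeasure T l n) f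

/-- Convolution in space with a decaying kernel. -/
def kernelConv (p N : ℕ) (f : ℝ × Space d → ℝ≥0∞) (q : ℝ × Space d) : ℝ≥0∞ :=
  ∫⁻ y, decayKernel d p N (y - q.2) * f (q.1, y)

/-- Convolution in space with a decaying kernel of the restriction to a cube. -/
def cubeConv (p N l : ℕ) (m : Fin d → ℤ) (f : ℝ × Space d → ℝ≥0∞) (q : ℝ × Space d) : ℝ≥0∞ :=
  ∫⁻ y in cube l m, decayKernel d p N (y - q.2) * f (q.1, y)

theorem measurable_decayKernel_sub (p N : ℕ) (y : Space d) :
    Measurable fun x => decayKernel d p N (y - x) :=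
  (measurable_decayKernel d p N).comp (measurable_id.const_sub y)

theorem measurable_kernel_mul (p N : ℕ) {f : ℝ × Space d → ℝ≥0∞} (hf : Measurable f) :
    Measurable fun r : (ℝ × Space d) × Space d =>
      decayKernel d p N (r.2 - r.1.2) * f (r.1.1, r.2) :=
  ((measurable_decayKernel d p N).comp (by fun_prop)).mul (hf.comp (by fun_prop))

theorem measurable_kernelConv (p N : ℕ) {f : ℝ × Space d → ℝ≥0∞} (hf : Measurable f) :
    Measurable (kernelConv p N f) := by
  have := (measurable_kernel_mul p N hf).lintegral_prod_right' (ν := volume)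
  exact this

theorem measurable_cubeConv (p N l : ℕ) (m : Fin d → ℤ) {f : ℝ × Space d → ℝ≥0∞}
    (hf : Measurable f) : Measurable (cubeConv p N l m f) := by
  have := (measurable_kernel_mul p N hf).lintegral_prod_right' (ν := volume.restrict (cube l m))
  exact this

theorem kernelConv_mono {p N : ℕ} {f g : ℝ × Space d → ℝ≥0∞} (h : ∀ q, f q ≤ g q)
    (q : ℝ × Space d) : kernelConv p N f q ≤ kernelConv p N g q :=
  lintegral_mono fun _ => by gcongr; exact h _

/-- Half of the decay of order `2 (d + 1)` pays for the sum over cubes; the other half, of order `d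
+ 1`, keeps the kernel integrable. -/
theorem kernelConv_le_tsum (p N l : ℕ) (f : ℝ × Space d → ℝ≥0∞) {n : Fin d → ℤ}
    {q : ℝ × Space d} (hq : q.2 ∈ cube l n) :
    kernelConv (p + (d + 1)) N f q ≤
      ∑' m, 2 ^ (d + 1) * latticeWeight (n - m) * cubeConv p N l m f q := by
  rw [kernelConv, lintegral_eq_tsum_cube l]
  refine ENNReal.tsum_le_tsum fun m => ?_
  rw [cubeConv, ← lintegral_const_mul' _ _ (by unfold latticeWeight; finiteness)]
  refine setLIntegral_mono' (measurableSet_cube l m) fun y hy => ?_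
  rw [← mul_assoc]
  gcongr
  exact decayKernel_le_latticeWeight hq hy

/-- Schur's test at fixed time: the kernel has the same mass in either variable. -/
theorem lTwo_cubeConv_le (T : ℝ) (N l : ℕ) (m : Fin d → ℤ) {f : ℝ × Space d → ℝ≥0∞}
    (hf : Measurable f) :
    lTwo (slabMeasure d T) (cubeConv (d + 1) N l m f) ≤
      kernelMass d * lTwo (cubeMeasure T l m) f := by
  refine lTwo_le_of_sq_le ?_
  rw [mul_pow, lTwo_sq, slabMeasure, cubeMeasure,
    lintegral_prod _ ((measurable_cubeConv _ N l m hf).pow_const 2).aemeasurable,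
    lintegral_prod _ (hf.pow_const 2).aemeasurable, ← lintegral_const_mul' _ _
      (by simpa using kernelMass_ne_top d)]
  refine lintegral_mono fun t => ?_
  have hk : ∀ x : Space d, Measurable fun y => decayKernel d (d + 1) N (y - x) := fun x =>
    (measurable_decayKernel _ _ _).comp (measurable_id.sub_const x)
  have hft : Measurable fun y => f (t, y) := hf.comp measurable_prodMk_left
  calc ∫⁻ x, cubeConv (d + 1) N l m f (t, x) ^ 2
      ≤ ∫⁻ x, kernelMass d * ∫⁻ y in cube l m, decayKernel d (d + 1) N (y - x) * f (t, y) ^ 2 := by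
        refine lintegral_mono fun x => ?_
        refine (sq_lintegral_kernel_mul_le (hk x).aemeasurable hft.aemeasurable).trans ?_
        gcongr
        exact (setLIntegral_le_lintegral _ _).trans (lintegral_decayKernel_sub_left N x).le
    _ = kernelMass d * ∫⁻ y in cube l m, ∫⁻ x, decayKernel d (d + 1) N (y - x) * f (t, y) ^ 2 := by
        rw [lintegral_const_mul' _ _ (kernelMass_ne_top d), lintegral_lintegral_swap]
        refine Measurable.aemeasurable ?_
        exact ((measurable_decayKernel d (d + 1) N).comp (by fun_prop)).mul
          ((hft.comp measurable_snd).pow_const 2)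
    _ = kernelMass d ^ 2 * ∫⁻ y in cube l m, f (t, y) ^ 2 := by
        have : ∀ y, ∫⁻ x, decayKernel d (d + 1) N (y - x) * f (t, y) ^ 2 =
            kernelMass d * f (t, y) ^ 2 := fun y => by
          rw [lintegral_mul_const _ (measurable_decayKernel_sub _ _ y),
            lintegral_decayKernel_sub_right]
        simp only [this]
        rw [lintegral_const_mul' _ _ (kernelMass_ne_top d), pow_two, mul_assoc]

/-- The constant of the convolution estimates. -/
def convConst (d : ℕ) : ℝ≥0∞ := 2 ^ (d + 1) * weightMass d * (1 + kernelMass d)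

theorem convConst_ne_top (d : ℕ) : convConst d ≠ ⊤ := by
  have := weightMass_ne_top d
  have := kernelMass_ne_top d
  unfold convConst
  finiteness

/-- The order of decay of the kernels used below. -/
abbrev decayOrder (d : ℕ) : ℕ := (d + 1) + (d + 1)

theorem amalgam_kernelConv_le (T : ℝ) (N l : ℕ) {f : ℝ × Space d → ℝ≥0∞} (hf : Measurable f) :
    amalgam T l (kernelConv (decayOrder d) N f) ≤ convConst d * amalgam T l f := by
  have h1 : ∀ n : Fin d → ℤ, lTwo (cubeMeasure T l n) (kernelConv (decayOrder d) N f) ≤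
      ∑' m, latticeWeight (n - m) * (2 ^ (d + 1) * kernelMass d * lTwo (cubeMeasure T l m) f) := by
    intro n
    calc _ ≤ lTwo (cubeMeasure T l n) (fun q => ∑' m, 2 ^ (d + 1) * latticeWeight (n - m) *
          cubeConv (d + 1) N l m f q) :=
        lTwo_mono_ae ((ae_mem_cube T l n).mono fun q hq => kernelConv_le_tsum _ _ _ _ hq)
      _ ≤ ∑' m, lTwo (cubeMeasure T l n) (fun q => 2 ^ (d + 1) * latticeWeight (n - m) *
          cubeConv (d + 1) N l m f q) :=
        lTwo_tsum_le fun m => ((measurable_cubeConv _ _ _ _ hf).const_mul _).aemeasurable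
      _ ≤ _ := by
        refine ENNReal.tsum_le_tsum fun m => ?_
        rw [lTwo_const_mul _ (measurable_cubeConv _ _ _ _ hf).aemeasurable]
        calc _ ≤ 2 ^ (d + 1) * latticeWeight (n - m) * (kernelMass d * lTwo (cubeMeasure T l m) f) :=
            mul_le_mul_right ((lTwo_mono_measure (cubeMeasure_le T l n)).trans
              (lTwo_cubeConv_le T N l m hf)) _
          _ = _ := by ring
  refine (ENNReal.tsum_le_tsum h1).trans ?_
  rw [tsum_tsum_latticeWeight_mul, ENNReal.tsum_mul_left, convConst, amalgam, ← mul_assoc,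
    ← mul_assoc, mul_comm (weightMass d)]
  gcongr
  exact le_add_self

/-- Bernstein from `L¹` to `L²`: Cauchy-Schwarz with respect to the measure `f dy`, then the square
integral of the kernel is at most its supremum `2^(Nd)` times its mass. -/
theorem lTwo_section_cubeConv_le (N l : ℕ) (m : Fin d → ℤ) {f : ℝ × Space d → ℝ≥0∞}
    (hf : Measurable f) (t : ℝ) :
    lTwo volume (fun x => cubeConv (d + 1) N l m f (t, x)) ≤
      2 ^ ((N : ℝ) * d / 2) * (1 + kernelMass d) * ∫⁻ y in cube l m, f (t, y) := by
  have hft : Measurable fun y => f (t, y) := hf.comp measurable_prodMk_left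
  have h2 : ((2 : ℝ≥0∞) ^ ((N : ℝ) * d / 2)) ^ 2 = 2 ^ (N * d) := by
    rw [← ENNReal.rpow_natCast, ← ENNReal.rpow_mul, ← ENNReal.rpow_natCast]
    congr 1
    push_cast
    ring
  -- This makes a square root of the mass unnecessary in the constant.
  have hkm : kernelMass d ≤ (1 + kernelMass d) ^ 2 := by
    rw [pow_two, mul_add, mul_one]
    exact le_add_right le_add_self
  refine lTwo_le_of_sq_le ?_
  rw [mul_pow, mul_pow, h2]
  have hk : ∀ x : Space d, Measurable fun y => decayKernel d (d + 1) N (y - x) := fun x =>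
    (measurable_decayKernel _ _ _).comp (measurable_id.sub_const x)
  calc ∫⁻ x, cubeConv (d + 1) N l m f (t, x) ^ 2
      ≤ ∫⁻ x, (∫⁻ y in cube l m, f (t, y)) *
          ∫⁻ y in cube l m, f (t, y) * decayKernel d (d + 1) N (y - x) ^ 2 := by
        refine lintegral_mono fun x => ?_
        refine le_trans (le_of_eq ?_) (sq_lintegral_kernel_mul_le hft.aemeasurable
          (hk x).aemeasurable)
        simp only [cubeConv, mul_comm]
    _ ≤ (∫⁻ y in cube l m, f (t, y)) *
          ∫⁻ x, ∫⁻ y in cube l m, f (t, y) * decayKernel d (d + 1) N (y - x) ^ 2 := by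
        rw [lintegral_const_mul]
        have := ((hf.comp (measurable_prodMk_left (x := t))).comp measurable_snd).mul
          (((measurable_decayKernel d (d + 1) N).comp
            (measurable_snd.sub measurable_fst)).pow_const 2)
        exact this.lintegral_prod_right' (ν := volume.restrict (cube l m))
    _ = (∫⁻ y in cube l m, f (t, y)) *
          ∫⁻ y in cube l m, ∫⁻ x, f (t, y) * decayKernel d (d + 1) N (y - x) ^ 2 := by
        rw [lintegral_lintegral_swap]
        exact (((hf.comp (measurable_prodMk_left (x := t))).comp measurable_snd).mul
          (((measurable_decayKernel d (d + 1) N).comp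
            (measurable_snd.sub measurable_fst)).pow_const 2)).aemeasurable
    _ ≤ (∫⁻ y in cube l m, f (t, y)) *
          ∫⁻ y in cube l m, f (t, y) * (2 ^ (N * d) * kernelMass d) := by
        gcongr with y
        rw [lintegral_const_mul _ ((measurable_decayKernel_sub _ _ y).pow_const 2)]
        gcongr
        exact lintegral_decayKernel_sq_right_le N y
    _ = 2 ^ (N * d) * kernelMass d * (∫⁻ y in cube l m, f (t, y)) ^ 2 := by
        rw [lintegral_mul_const _ hft]
        ring
    _ ≤ _ := by gcongr

/-- `∑_{Q ∈ 𝒬_l} ‖f‖_{L¹L²([0,T] × Q)}`. -/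
def amalgamOne (T : ℝ) (l : ℕ) (f : ℝ × Space d → ℝ≥0∞) : ℝ≥0∞ :=
  ∑' n : Fin d → ℤ, ∫⁻ t, lTwo (volume.restrict (cube l n)) (fun x => f (t, x)) ∂timeMeasure T

theorem measurable_lTwo_section {f : ℝ × Space d → ℝ≥0∞} (hf : Measurable f)
    (μ : Measure (Space d)) [SFinite μ] : Measurable fun t => lTwo μ (fun x => f (t, x)) :=
  Measurable.pow_const ((hf.pow_const 2).lintegral_prod_right' (ν := μ)) _

theorem amalgamOne_kernelConv_le (T : ℝ) (N l : ℕ) {f : ℝ × Space d → ℝ≥0∞} (hf : Measurable f) :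
    amalgamOne T l (kernelConv (decayOrder d) N f) ≤
      convConst d * 2 ^ ((N : ℝ) * d / 2) * ∫⁻ p, f p ∂slabMeasure d T := by
  have h1 : ∀ n : Fin d → ℤ, ∫⁻ t, lTwo (volume.restrict (cube l n))
      (fun x => kernelConv (decayOrder d) N f (t, x)) ∂timeMeasure T ≤
      ∑' m, latticeWeight (n - m) * (2 ^ (d + 1) * (2 ^ ((N : ℝ) * d / 2) * (1 + kernelMass d)) *
        ∫⁻ t, (∫⁻ y in cube l m, f (t, y)) ∂timeMeasure T) := by
    intro n
    have hfm : ∀ m : Fin d → ℤ, Measurable fun t => ∫⁻ y in cube l m, f (t, y) := fun m =>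
      hf.lintegral_prod_right' (ν := volume.restrict (cube l m))
    have hrt : ∀ m : Fin d → ℤ, latticeWeight (n - m) *
        (2 ^ (d + 1) * (2 ^ ((N : ℝ) * d / 2) * (1 + kernelMass d)) *
        ∫⁻ t, (∫⁻ y in cube l m, f (t, y)) ∂timeMeasure T) =
        ∫⁻ t, latticeWeight (n - m) * (2 ^ (d + 1) * (2 ^ ((N : ℝ) * d / 2) * (1 + kernelMass d)) *
          ∫⁻ y in cube l m, f (t, y)) ∂timeMeasure T := fun m => by
      rw [lintegral_const_mul _ ((hfm m).const_mul _), lintegral_const_mul _ (hfm m)]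
    simp only [hrt]
    rw [← lintegral_tsum fun m => (((hfm m).const_mul _).const_mul _).aemeasurable]
    refine lintegral_mono fun t => ?_
    have hs : ∀ m, Measurable fun x => cubeConv (d + 1) N l m f (t, x) := fun m =>
      (measurable_cubeConv _ _ _ _ hf).comp measurable_prodMk_left
    calc _ ≤ lTwo (volume.restrict (cube l n)) (fun x => ∑' m, 2 ^ (d + 1) *
          latticeWeight (n - m) * cubeConv (d + 1) N l m f (t, x)) :=
        lTwo_mono_ae ((ae_restrict_mem (measurableSet_cube l n)).mono
          fun x hx => kernelConv_le_tsum _ _ _ _ hx)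
      _ ≤ ∑' m, lTwo (volume.restrict (cube l n)) (fun x => 2 ^ (d + 1) *
          latticeWeight (n - m) * cubeConv (d + 1) N l m f (t, x)) :=
        lTwo_tsum_le fun m => ((hs m).const_mul _).aemeasurable
      _ ≤ _ := by
        refine ENNReal.tsum_le_tsum fun m => ?_
        rw [lTwo_const_mul _ (hs m).aemeasurable]
        calc _ ≤ 2 ^ (d + 1) * latticeWeight (n - m) *
            (2 ^ ((N : ℝ) * d / 2) * (1 + kernelMass d) * ∫⁻ y in cube l m, f (t, y)) :=
            mul_le_mul_right ((lTwo_mono_measure Measure.restrict_le_self).trans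
              (lTwo_section_cubeConv_le N l m hf t)) _
          _ = _ := by ring
  refine (ENNReal.tsum_le_tsum h1).trans (le_of_eq ?_)
  rw [tsum_tsum_latticeWeight_mul, ENNReal.tsum_mul_left, ← lintegral_tsum
    fun m => (hf.lintegral_prod_right' (ν := volume.restrict (cube l m))).aemeasurable,
    slabMeasure, lintegral_prod _ hf.aemeasurable]
  simp only [← lintegral_eq_tsum_cube]
  rw [convConst]
  ring

/-- Bernstein from `L²` to `L^∞`, cube by cube: Cauchy-Schwarz between the kernel and `g` on each
cube. -/
theorem lintegral_decayKernel_mul_le (N l : ℕ) {g : Space d → ℝ≥0∞} (hg : Measurable g)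
    {n : Fin d → ℤ} {x : Space d} (hx : x ∈ cube l n) :
    ∫⁻ y, decayKernel d (decayOrder d) N (y - x) * g y ≤
      ∑' m, latticeWeight (n - m) * (2 ^ (d + 1) * (2 ^ ((N : ℝ) * d / 2) * (1 + kernelMass d)) *
        lTwo (volume.restrict (cube l m)) g) := by
  -- The function `g` is regarded as independent of time; the time `0` is arbitrary.
  have h := kernelConv_le_tsum (d + 1) N l (fun q : ℝ × Space d => g q.2) (q := (0, x)) hx
  refine h.trans (ENNReal.tsum_le_tsum fun m => ?_)
  have hk : Measurable fun y => decayKernel d (d + 1) N (y - x) :=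
    (measurable_decayKernel _ _ _).comp (measurable_id.sub_const x)
  have h2 : ((2 : ℝ≥0∞) ^ ((N : ℝ) * d / 2)) ^ 2 = 2 ^ (N * d) := by
    rw [← ENNReal.rpow_natCast, ← ENNReal.rpow_mul, ← ENNReal.rpow_natCast]
    congr 1
    push_cast
    ring
  have hkm : kernelMass d ≤ (1 + kernelMass d) ^ 2 := by
    rw [pow_two, mul_add, mul_one]
    exact le_add_right le_add_self
  have h3 : lTwo (volume.restrict (cube l m)) (fun y => decayKernel d (d + 1) N (y - x)) ≤
      2 ^ ((N : ℝ) * d / 2) * (1 + kernelMass d) := by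
    refine lTwo_le_of_sq_le ?_
    rw [mul_pow, h2]
    exact (setLIntegral_le_lintegral _ _).trans ((lintegral_decayKernel_sq_left_le N x).trans
      (by gcongr))
  calc _ ≤ 2 ^ (d + 1) * latticeWeight (n - m) * (2 ^ ((N : ℝ) * d / 2) * (1 + kernelMass d) *
        lTwo (volume.restrict (cube l m)) g) := by
        refine mul_le_mul_right ?_ _
        refine (lintegral_mul_le_lTwo hk.aemeasurable hg.aemeasurable).trans ?_
        gcongr
    _ = _ := by ring

/-! ### Consequences of the localized norms -/

/-- The cutoff `χ_Q` with values in `[0, ∞]`. -/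
def CubePartition.weight (χ : CubePartition d) (j : ℕ) (n : Fin d → ℤ) (x : Space d) : ℝ≥0∞ :=
  ENNReal.ofReal (χ.cutoff j n x)

theorem CubePartition.measurable_weight (χ : CubePartition d) (j : ℕ) (n : Fin d → ℤ) :
    Measurable (χ.weight j n) :=
  (χ.continuous_cutoff j n).measurable.ennreal_ofReal

theorem CubePartition.weight_le_one (χ : CubePartition d) (j : ℕ) (n : Fin d → ℤ) (x : Space d) :
    χ.weight j n x ≤ 1 := by
  rw [weight, ← ENNReal.ofReal_one]
  exact ENNReal.ofReal_le_ofReal (χ.cutoff_le_one j n x)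

theorem CubePartition.enorm_localize (χ : CubePartition d) (j : ℕ) (n : Fin d → ℤ)
    (F : ℝ × Space d → ℂ) (p : ℝ × Space d) :
    ‖χ.localize j n F p‖ₑ = χ.weight j n p.2 * ‖F p‖ₑ := by
  rw [localize, enorm_mul, weight]
  congr 1
  rw [← ofReal_norm, Complex.norm_real, Real.norm_of_nonneg (χ.cutoff_nonneg _ _ _)]

theorem CubePartition.tsum_weight_mul (χ : CubePartition d) (j : ℕ) (x : Space d) (a : ℝ≥0∞) :
    ∑' n, χ.weight j n x * a = a := by
  rw [ENNReal.tsum_mul_right]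
  simp only [weight]
  rw [χ.tsum_enorm_cutoff, one_mul]

theorem ENNReal_two_rpow_mul_neg (a : ℝ) : (2 : ℝ≥0∞) ^ a * 2 ^ (-a) = 1 := by
  rw [← ENNReal.rpow_add _ _ two_ne_zero ENNReal.ofNat_ne_top]; simp

theorem lTwo_cubeMeasure_le_normX (T : ℝ) (l : ℕ) (m : Fin d → ℤ) (F : ℝ × Space d → ℂ) :
    lTwo (cubeMeasure T l m) (fun p => ‖F p‖ₑ) ≤ 2 ^ ((l : ℝ) / 2) * normX T F := by
  have h : (2 : ℝ≥0∞) ^ (-(l : ℝ) / 2) * eLpNorm F 2 (cubeMeasure T l m) ≤ normX T F :=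
    le_iSup₂_of_le (f := fun (l : ℕ) (n : Fin d → ℤ) => (2 : ℝ≥0∞) ^ (-(l : ℝ) / 2) *
      eLpNorm F 2 ((timeMeasure T).prod (volume.restrict (cube l n)))) l m le_rfl
  rw [← eLpNorm_two_eq_lTwo]
  calc eLpNorm F 2 (cubeMeasure T l m)
      = 2 ^ ((l : ℝ) / 2) * (2 ^ (-(l : ℝ) / 2) * eLpNorm F 2 (cubeMeasure T l m)) := by
        rw [← mul_assoc, neg_div, ENNReal_two_rpow_mul_neg, one_mul]
    _ ≤ _ := by gcongr

theorem normX_le_normXj (T : ℝ) (j : ℕ) (F : ℝ × Space d → ℂ) :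
    normX T F ≤ 2 ^ (-((j : ℝ) / 2)) * normXj T j F := by
  calc normX T F = 2 ^ (-((j : ℝ) / 2)) * (2 ^ ((j : ℝ) / 2) * normX T F) := by
        rw [← mul_assoc, mul_comm (2 ^ _), ENNReal_two_rpow_mul_neg, one_mul]
    _ ≤ _ := by gcongr; exact le_max_left _ _

theorem measurable_weight_mul (χ : CubePartition d) (j : ℕ) (n : Fin d → ℤ)
    {f : ℝ × Space d → ℝ≥0∞} (hf : Measurable f) :
    Measurable fun p : ℝ × Space d => χ.weight j n p.2 * f p :=
  ((χ.measurable_weight j n).comp measurable_snd).mul hf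

/-- The local energy gain: `2^(l/2)` comes from the definition of `X` on cubes of side `2^l`, and
`2^(-j/2)` from the weight in `X_j`. -/
theorem lTwo_cubeMeasure_le_normL1j (χ : CubePartition d) (T : ℝ) (j l : ℕ) (m : Fin d → ℤ)
    {F : ℝ × Space d → ℂ} (hF : Measurable F) :
    lTwo (cubeMeasure T l m) (fun p => ‖F p‖ₑ) ≤
      2 ^ (((l : ℝ) - j) / 2) * normL1j χ j (normXj T j) F := by
  have e : ∀ p, ‖F p‖ₑ = ∑' n, ‖χ.localize j n F p‖ₑ := fun p => by
    simp only [χ.enorm_localize]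
    rw [χ.tsum_weight_mul]
  simp only [e]
  refine (lTwo_tsum_le fun n => ?_).trans ?_
  · simp only [χ.enorm_localize]
    exact (measurable_weight_mul χ j n hF.enorm).aemeasurable
  · rw [normL1j, ← ENNReal.tsum_mul_left]
    refine ENNReal.tsum_le_tsum fun n => ?_
    refine (lTwo_cubeMeasure_le_normX T l m _).trans ?_
    calc _ ≤ (2 : ℝ≥0∞) ^ ((l : ℝ) / 2) * (2 ^ (-((j : ℝ) / 2)) * normXj T j _) := by
          gcongr; exact normX_le_normXj _ _ _
      _ = _ := by
        rw [← mul_assoc, ← ENNReal.rpow_add _ _ two_ne_zero ENNReal.ofNat_ne_top]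
        congr 2
        ring

theorem ae_lTwo_localize_le (χ : CubePartition d) (T : ℝ) (j : ℕ) (F : ℝ × Space d → ℂ) :
    ∀ᵐ t ∂timeMeasure T, ∀ n, lTwo volume (fun x => χ.weight j n x * ‖F (t, x)‖ₑ) ≤
      normXj T j (χ.localize j n F) := by
  rw [ae_all_iff]
  intro n
  have h := ae_le_essSup (μ := timeMeasure T)
    (f := fun t => eLpNorm (fun x => χ.localize j n F (t, x)) 2 volume)
  filter_upwards [h] with t ht
  rw [eLpNorm_two_eq_lTwo] at ht
  simp only [χ.enorm_localize] at ht
  exact ht.trans (le_max_right _ _)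

theorem ae_lTwo_le_normL1j (χ : CubePartition d) (T : ℝ) (j : ℕ) {F : ℝ × Space d → ℂ}
    (hF : Measurable F) :
    ∀ᵐ t ∂timeMeasure T, lTwo volume (fun x => ‖F (t, x)‖ₑ) ≤ normL1j χ j (normXj T j) F := by
  filter_upwards [ae_lTwo_localize_le χ T j F] with t ht
  have e : ∀ x, ‖F (t, x)‖ₑ = ∑' n, χ.weight j n x * ‖F (t, x)‖ₑ := fun x => by
    rw [χ.tsum_weight_mul]
  rw [funext e]
  refine (lTwo_tsum_le fun n => ?_).trans (ENNReal.tsum_le_tsum ht)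
  exact ((measurable_weight_mul χ j n hF.enorm).comp measurable_prodMk_left).aemeasurable

/-- The competing bound, from the `L^∞L²` part of `X_j` and Hölder in time: a power of `T` in place
of the gain `2^((l-j)/2)`. -/
theorem lTwo_slabMeasure_le_normL1j (χ : CubePartition d) (T : ℝ) (j : ℕ)
    {F : ℝ × Space d → ℂ} (hF : Measurable F) :
    lTwo (slabMeasure d T) (fun p => ‖F p‖ₑ) ≤
      ENNReal.ofReal T ^ (1 / 2 : ℝ) * normL1j χ j (normXj T j) F := by
  refine lTwo_le_of_sq_le ?_
  rw [mul_pow, ENNReal_rpow_half_sq, slabMeasure,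
    lintegral_prod _ (hF.enorm.pow_const 2).aemeasurable]
  calc _ ≤ ∫⁻ _, normL1j χ j (normXj T j) F ^ 2 ∂timeMeasure T := by
        refine lintegral_mono_ae ?_
        filter_upwards [ae_lTwo_le_normL1j χ T j hF] with t ht
        rw [← lTwo_sq volume (fun x => ‖F (t, x)‖ₑ)]
        exact pow_le_pow_left₀ bot_le ht 2
    _ = _ := by rw [lintegral_const, timeMeasure_univ, mul_comm]

theorem weight_mul_le_of_mem_cube {χ : CubePartition d} {C : ℝ≥0∞} {k : ℕ} {n m : Fin d → ℤ}
    {x : Space d} (hC : χ.cutoff k n x ≠ 0 → 1 ≤ C * latticeWeight (n - m)) (a : ℝ≥0∞) :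
    χ.weight k n x * a ≤ C * latticeWeight (n - m) * (χ.weight k n x * a) := by
  by_cases h : χ.cutoff k n x = 0
  · simp [CubePartition.weight, h]
  · exact le_mul_of_one_le_left' (hC h)

/-- The numbers `a n` do not depend on `t`: the sum over cubes is taken outside the supremum in
time, as in `l¹_j X_j`, while the smooth cutoffs are replaced by sharp cubes. -/
theorem exists_cubewise_bound (χ : CubePartition d) :
    ∃ C : ℝ≥0∞, C ≠ ⊤ ∧ ∀ (T : ℝ) (j : ℕ) (F : ℝ × Space d → ℂ), Measurable F →
      ∃ a : (Fin d → ℤ) → ℝ≥0∞, ∑' n, a n ≤ C * normL1j χ j (normXj T j) F ∧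
        ∀ᵐ t ∂timeMeasure T, ∀ n,
          lTwo (volume.restrict (cube j n)) (fun x => ‖F (t, x)‖ₑ) ≤ a n := by
  obtain ⟨C, hC, h⟩ := χ.exists_cutoff_weight
  refine ⟨C * weightMass d, ENNReal.mul_ne_top hC (weightMass_ne_top d), fun T j F hF => ?_⟩
  refine ⟨fun n => ∑' m, latticeWeight (n - m) * (C * normXj T j (χ.localize j m F)), ?_, ?_⟩
  · rw [tsum_tsum_latticeWeight_mul (fun m => C * normXj T j (χ.localize j m F)),
      ENNReal.tsum_mul_left, ← mul_assoc, mul_comm C]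
    rfl
  · filter_upwards [ae_lTwo_localize_le χ T j F] with t ht n
    have hm : ∀ m, Measurable fun x => χ.weight j m x * ‖F (t, x)‖ₑ := fun m =>
      (χ.measurable_weight j m).mul (hF.comp measurable_prodMk_left).enorm
    have e : ∀ x, ‖F (t, x)‖ₑ = ∑' m, χ.weight j m x * ‖F (t, x)‖ₑ := fun x => by
      rw [χ.tsum_weight_mul]
    rw [funext e]
    refine (lTwo_tsum_le fun m => (hm m).aemeasurable).trans (ENNReal.tsum_le_tsum fun m => ?_)
    calc _ ≤ lTwo (volume.restrict (cube j n)) (fun x => C * latticeWeight (m - n) *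
          (χ.weight j m x * ‖F (t, x)‖ₑ)) := by
          refine lTwo_mono_ae ((ae_restrict_mem (measurableSet_cube j n)).mono fun x hx => ?_)
          exact weight_mul_le_of_mem_cube (h j m n x hx) _
      _ = C * latticeWeight (m - n) * lTwo (volume.restrict (cube j n))
          (fun x => χ.weight j m x * ‖F (t, x)‖ₑ) := lTwo_const_mul _ (hm m).aemeasurable
      _ ≤ C * latticeWeight (m - n) * normXj T j (χ.localize j m F) := by
          gcongr
          exact (lTwo_mono_measure Measure.restrict_le_self).trans (ht m)
      _ = _ := by rw [← latticeWeight_neg (m - n), neg_sub]; ring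

/-! ### Upper bounds for the atomic norms -/

theorem lTwo_indicator (T : ℝ) (l : ℕ) (n : Fin d → ℤ) (f : ℝ × Space d → ℝ≥0∞) :
    lTwo (slabMeasure d T) ((Set.univ ×ˢ cube l n).indicator f) = lTwo (cubeMeasure T l n) f := by
  rw [lTwo, lTwo, cubeMeasure_eq_restrict,
    ← lintegral_indicator (MeasurableSet.univ.prod (measurableSet_cube l n))]
  congr 2
  ext p
  by_cases h : p ∈ Set.univ ×ˢ cube l n <;> simp [h]

theorem hasSum_cube_indicator (l : ℕ) (F : ℝ × Space d → ℂ) (p : ℝ × Space d) :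
    HasSum (fun n => (Set.univ ×ˢ cube l n).indicator F p) (F p) := by
  have h : F p = (Set.univ ×ˢ cube l (cubeIndex l p.2)).indicator F p := by
    rw [Set.indicator_of_mem]
    exact ⟨trivial, mem_cube_iff_eq.2 rfl⟩
  rw [h]
  refine hasSum_single _ fun n hn => Set.indicator_of_notMem ?_ _
  rintro ⟨-, h2⟩
  exact hn (mem_cube_iff_eq.1 h2)

/-- Cutting each `A l` along the cubes of side `2^l` produces admissible atoms. -/
theorem normY_le_sum_amalgam (T : ℝ) (L : ℕ) {A : ℕ → ℝ × Space d → ℂ} (hA : ∀ l, Measurable (A l)) :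
    normY T (fun p => ∑ l ∈ Finset.range L, A l p) ≤
      ∑ l ∈ Finset.range L, 2 ^ ((l : ℝ) / 2) * amalgam T l (fun p => ‖A l p‖ₑ) := by
  set a : ℕ × (Fin d → ℤ) → ℝ × Space d → ℂ := fun q =>
    if q.1 < L then (Set.univ ×ˢ cube q.1 q.2).indicator (A q.1) else 0 with ha
  have h1 : ∀ q, AEStronglyMeasurable (a q) (slabMeasure d T) := fun q => by
    simp only [ha]
    split_ifs
    · exact ((hA q.1).indicator
        (MeasurableSet.univ.prod (measurableSet_cube q.1 q.2))).aestronglyMeasurable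
    · exact aestronglyMeasurable_zero
  have h2 : ∀ q p, p.2 ∉ cube q.1 q.2 → a q p = 0 := fun q p hp => by
    simp only [ha]
    split_ifs
    · exact Set.indicator_of_notMem (fun h => hp h.2) _
    · rfl
  have h3 : ∀ p, HasSum (fun q => a q p) (∑ l ∈ Finset.range L, A l p) := fun p => by
    have hl : ∀ l ∈ Finset.range L, HasSum
        (fun q : ℕ × (Fin d → ℤ) => if q.1 = l then (Set.univ ×ˢ cube l q.2).indicator (A l) p else 0)
        (A l p) := by
      intro l _
      have hi : Function.Injective (fun n : Fin d → ℤ => (l, n)) := fun n m h => (Prod.ext_iff.1 h).2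
      refine (hi.hasSum_iff (f := fun q : ℕ × (Fin d → ℤ) =>
        if q.1 = l then (Set.univ ×ˢ cube l q.2).indicator (A l) p else 0) fun q hq => ?_).1 ?_
      · refine if_neg fun hq1 => hq ⟨q.2, ?_⟩
        rw [← hq1]
      · simpa [Function.comp_def] using hasSum_cube_indicator l (A l) p
    have hs := hasSum_sum hl
    refine hs.congr_fun ?_
    intro q
    simp only [ha, Finset.sum_ite_eq, Finset.mem_range]
    split_ifs <;> rfl
  refine (iInf₂_le a h1).trans ((iInf₂_le h2 (Eventually.of_forall h3)).trans ?_)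
  rw [ENNReal.tsum_prod', tsum_eq_sum (s := Finset.range L)]
  · refine Finset.sum_le_sum fun l hl => ?_
    change ∑' n, 2 ^ ((l : ℝ) / 2) * eLpNorm (a (l, n)) 2 (slabMeasure d T) ≤ _
    rw [ENNReal.tsum_mul_left, amalgam]
    refine mul_le_mul_right (ENNReal.tsum_le_tsum fun n => ?_) _
    rw [eLpNorm_two_eq_lTwo, ← lTwo_indicator]
    refine lTwo_mono fun p => ?_
    simp only [ha, Finset.mem_range.1 hl, if_true]
    by_cases h : p ∈ Set.univ ×ˢ cube l n
    · rw [Set.indicator_of_mem h, Set.indicator_of_mem h]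
    · rw [Set.indicator_of_notMem h, Set.indicator_of_notMem h, enorm_zero]
  · intro l hl
    refine ENNReal.tsum_eq_zero.2 fun n => ?_
    simp only [ha, Finset.mem_range.not.1 hl, if_false]
    exact mul_eq_zero_of_right _ eLpNorm_zero


theorem enorm_two_rpow (a : ℝ) : ‖(((2 : ℝ) ^ a : ℝ) : ℂ)‖ₑ = (2 : ℝ≥0∞) ^ a := by
  rw [← ofReal_norm, Complex.norm_real, Real.norm_of_nonneg (by positivity),
    ← ENNReal.ofReal_rpow_of_pos two_pos, ENNReal.ofReal_ofNat]

/-- A function dominated by a finite sum splits into pieces dominated by the summands. -/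
theorem exists_dominated_split {α : Type*} [MeasurableSpace α] {W : α → ℂ} (hW : Measurable W)
    {ι : Type*} (s : Finset ι) {G : ι → α → ℝ≥0∞} (hG : ∀ i, Measurable (G i))
    (h : ∀ p, ‖W p‖ₑ ≤ ∑ i ∈ s, G i p) :
    ∃ A : ι → α → ℂ, (∀ i, Measurable (A i)) ∧ (∀ p, W p = ∑ i ∈ s, A i p) ∧
      ∀ i p, ‖A i p‖ₑ ≤ G i p := by
  -- Truncation at `|W|` makes the dominating functions finite, so that `W` can be distributed with
  -- weights `g i / S` summing to one where `S ≠ 0`.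
  set g : ι → α → ℝ≥0∞ := fun i p => min (G i p) ‖W p‖ₑ with hg
  set S : α → ℝ≥0∞ := fun p => ∑ i ∈ s, g i p with hS
  have hgm : ∀ i, Measurable (g i) := fun i => (hG i).min hW.enorm
  have hSm : Measurable S := Finset.measurable_fun_sum s fun i _ => hgm i
  have hgfin : ∀ i p, g i p ≠ ⊤ := fun i p => ne_top_of_le_ne_top enorm_ne_top (min_le_right _ _)
  have hSfin : ∀ p, S p ≠ ⊤ := fun p => by
    simp only [hS]
    exact ENNReal.sum_ne_top.2 fun i _ => hgfin i p
  -- Truncation keeps the domination: either one summand alone reaches `|W|`, or none has been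
  -- changed.
  have hWS : ∀ p, ‖W p‖ₑ ≤ S p := by
    intro p
    by_cases hc : ∃ i ∈ s, ‖W p‖ₑ ≤ G i p
    · obtain ⟨i, hi, h1⟩ := hc
      calc ‖W p‖ₑ = g i p := (min_eq_right h1).symm
        _ ≤ S p := Finset.single_le_sum (f := fun i => g i p) (fun _ _ => bot_le) hi
    · push Not at hc
      refine (h p).trans (le_of_eq (Finset.sum_congr rfl fun i hi => ?_))
      exact (min_eq_left (hc i hi).le).symm
  refine ⟨fun i p => ((g i p / S p).toReal : ℂ) * W p, fun i => ?_, fun p => ?_, fun i p => ?_⟩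
  · exact (Complex.measurable_ofReal.comp ((hgm i).div hSm).ennreal_toReal).mul hW
  · rw [← Finset.sum_mul]
    by_cases h0 : S p = 0
    · have : W p = 0 := by
        have := hWS p
        rw [h0] at this
        simpa using this
      simp [this]
    · have e : ∑ i ∈ s, (((g i p / S p).toReal : ℝ) : ℂ) = 1 := by
        rw [← Complex.ofReal_sum, ← ENNReal.toReal_sum]
        · simp only [div_eq_mul_inv]
          rw [← Finset.sum_mul, ENNReal.mul_inv_cancel h0 (hSfin p)]
          simp
        · intro i _
          exact ENNReal.div_ne_top (hgfin i p) h0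
      rw [e, one_mul]
  · rw [enorm_mul, ← ofReal_norm (_ : ℂ), Complex.norm_real, Real.norm_of_nonneg ENNReal.toReal_nonneg]
    refine le_trans ?_ (min_le_left (G i p) ‖W p‖ₑ)
    change _ ≤ g i p
    refine (mul_le_mul_left ENNReal.ofReal_toReal_le _).trans ?_
    calc g i p / S p * ‖W p‖ₑ ≤ g i p / S p * S p := by gcongr; exact hWS p
      _ ≤ g i p := by rw [mul_comm]; exact ENNReal.mul_div_le

theorem amalgam_const_mul (T : ℝ) (l : ℕ) (c : ℝ≥0∞) {f : ℝ × Space d → ℝ≥0∞}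
    (hf : Measurable f) : amalgam T l (fun p => c * f p) = c * amalgam T l f := by
  simp only [amalgam]
  rw [← ENNReal.tsum_mul_left]
  exact tsum_congr fun n => lTwo_const_mul c hf.aemeasurable

theorem amalgam_mono {T : ℝ} {l : ℕ} {f g : ℝ × Space d → ℝ≥0∞} (h : ∀ p, f p ≤ g p) :
    amalgam T l f ≤ amalgam T l g :=
  ENNReal.tsum_le_tsum fun _ => lTwo_mono h

/-- A pointwise bound suffices, since `W` splits into pieces below the summands. Indices `l < L`
feed the atomic part, index `L` the `L¹L²` part. Dividing by the factor `2^(k/2)` turns the atomic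
weight `2^(l/2)` into `2^((l-k)/2)`. -/
theorem normYj_le_of_dominated (T : ℝ) (k L : ℕ) {W : ℝ × Space d → ℂ} (hW : Measurable W)
    {G : ℕ → ℝ × Space d → ℝ≥0∞} (hG : ∀ l, Measurable (G l)) {G' : ℝ × Space d → ℝ≥0∞}
    (hG' : Measurable G') (h : ∀ p, ‖W p‖ₑ ≤ ∑ l ∈ Finset.range L, G l p + G' p) :
    normYj T k W ≤ ∑ l ∈ Finset.range L, 2 ^ (((l : ℝ) - k) / 2) * amalgam T l (G l) +
      ∫⁻ t, lTwo volume (fun x => G' (t, x)) ∂timeMeasure T := by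
  obtain ⟨A, hA, hsum, hle⟩ := exists_dominated_split hW (Finset.range (L + 1))
    (G := fun l => if l < L then G l else G')
    (fun l => by split_ifs; exacts [hG l, hG'])
    (fun p => by
      refine (h p).trans (le_of_eq ?_)
      rw [Finset.sum_range_succ, if_neg (lt_irrefl L)]
      congr 1
      exact Finset.sum_congr rfl fun l hl => by rw [if_pos (Finset.mem_range.1 hl)])
  set c : ℂ := (((2 : ℝ) ^ (-((k : ℝ) / 2)) : ℝ) : ℂ) with hc
  have hcc : (((2 : ℝ) ^ ((k : ℝ) / 2) : ℝ) : ℂ) * c = 1 := by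
    rw [hc, ← Complex.ofReal_mul, ← Real.rpow_add two_pos]
    simp
  have hAc : ∀ l, Measurable fun p => c * A l p := fun l => (hA l).const_mul c
  have hm1 : Measurable fun p => ∑ l ∈ Finset.range L, c * A l p :=
    Finset.measurable_fun_sum _ fun l _ => hAc l
  have hdec : ∀ p, W p = (((2 : ℝ) ^ ((k : ℝ) / 2) : ℝ) : ℂ) *
      ∑ l ∈ Finset.range L, c * A l p + A L p := by
    intro p
    rw [← Finset.mul_sum, ← mul_assoc, hcc, one_mul, hsum p, Finset.sum_range_succ]
  refine (iInf₂_le (fun p => ∑ l ∈ Finset.range L, c * A l p) (A L)).trans ?_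
  refine (iInf₂_le hm1.aestronglyMeasurable (hA L).aestronglyMeasurable).trans ?_
  refine (iInf_le _ (Eventually.of_forall hdec)).trans ?_
  refine add_le_add ?_ ?_
  · refine (normY_le_sum_amalgam T L hAc).trans (Finset.sum_le_sum fun l hl => ?_)
    have e : ∀ p, ‖c * A l p‖ₑ = 2 ^ (-((k : ℝ) / 2)) * ‖A l p‖ₑ := fun p => by
      rw [enorm_mul, hc, enorm_two_rpow]
    simp only [e]
    rw [amalgam_const_mul T l _ (hA l).enorm, ← mul_assoc,
      ← ENNReal.rpow_add _ _ two_ne_zero ENNReal.ofNat_ne_top]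
    have e2 : (l : ℝ) / 2 + -((k : ℝ) / 2) = ((l : ℝ) - k) / 2 := by ring
    rw [e2]
    gcongr
    refine amalgam_mono fun p => (hle l p).trans ?_
    rw [if_pos (Finset.mem_range.1 hl)]
  · refine lintegral_mono fun t => ?_
    rw [eLpNorm_two_eq_lTwo]
    refine lTwo_mono fun x => (hle L (t, x)).trans ?_
    rw [if_neg (lt_irrefl L)]

theorem CubePartition.measurable_localize (χ : CubePartition d) (j : ℕ) (n : Fin d → ℤ)
    {F : ℝ × Space d → ℂ} (hF : Measurable F) : Measurable (χ.localize j n F) :=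
  (Complex.measurable_ofReal.comp
    ((χ.continuous_cutoff j n).measurable.comp measurable_snd)).mul hF

theorem lTwo_le_tsum_cube (k : ℕ) {g : Space d → ℝ≥0∞} (hg : Measurable g) :
    lTwo volume g ≤ ∑' m, lTwo (volume.restrict (cube k m)) g := by
  have e : g = fun x => ∑' m, (cube k m).indicator g x := by
    ext x
    rw [tsum_eq_single (cubeIndex k x) fun m hm => Set.indicator_of_notMem
      (fun h => hm (mem_cube_iff_eq.1 h)) _, Set.indicator_of_mem (mem_cube_iff_eq.2 rfl)]
  conv_lhs => rw [e]
  refine (lTwo_tsum_le fun m => (hg.indicator (measurableSet_cube k m)).aemeasurable).trans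
    (ENNReal.tsum_le_tsum fun m => le_of_eq ?_)
  rw [lTwo, lTwo, ← lintegral_indicator (measurableSet_cube k m)]
  congr 2
  ext x
  by_cases h : x ∈ cube k m <;> simp [h]

/-- For `l ≤ k` every cube of side `2^l` lies in one cube of side `2^k`, hence meets boundedly many
of the supports of the cutoffs at scale `k`. Summing the localized pieces thus costs only a
constant. -/
theorem exists_normL1j_normYj_le (χ : CubePartition d) :
    ∃ C : ℝ≥0∞, C ≠ ⊤ ∧ ∀ (T : ℝ) (k : ℕ) (W : ℝ × Space d → ℂ), Measurable W →
      ∀ (G : ℕ → ℝ × Space d → ℝ≥0∞) (G' : ℝ × Space d → ℝ≥0∞), (∀ l, Measurable (G l)) →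
      Measurable G' → (∀ p, ‖W p‖ₑ ≤ ∑ l ∈ Finset.range (k + 1), G l p + G' p) →
      normL1j χ k (normYj T k) W ≤
        C * (∑ l ∈ Finset.range (k + 1), 2 ^ (((l : ℝ) - k) / 2) * amalgam T l (G l) +
          amalgamOne T k G') := by
  obtain ⟨C, hC, h⟩ := χ.exists_cutoff_weight
  refine ⟨C * weightMass d, ENNReal.mul_ne_top hC (weightMass_ne_top d), ?_⟩
  intro T k W hW G G' hG hG' hle
  have h1 : ∀ n, normYj T k (χ.localize k n W) ≤
      ∑ l ∈ Finset.range (k + 1), 2 ^ (((l : ℝ) - k) / 2) *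
        amalgam T l (fun p => χ.weight k n p.2 * G l p) +
      ∫⁻ t, lTwo volume (fun x => χ.weight k n x * G' (t, x)) ∂timeMeasure T := fun n => by
    refine normYj_le_of_dominated T k (k + 1) (χ.measurable_localize k n hW)
      (fun l => measurable_weight_mul χ k n (hG l)) (measurable_weight_mul χ k n hG') fun p => ?_
    rw [χ.enorm_localize, ← Finset.mul_sum, ← mul_add]
    gcongr
    exact hle p
  have h2 : ∀ l ∈ Finset.range (k + 1), ∑' n, amalgam T l (fun p => χ.weight k n p.2 * G l p) ≤
      C * weightMass d * amalgam T l (G l) := by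
    intro l hl
    have hlk : l ≤ k := by have := Finset.mem_range.1 hl; omega
    simp only [amalgam]
    rw [ENNReal.tsum_comm, ← ENNReal.tsum_mul_left]
    refine ENNReal.tsum_le_tsum fun m => ?_
    calc ∑' n, lTwo (cubeMeasure T l m) (fun p => χ.weight k n p.2 * G l p)
        ≤ ∑' n, C * latticeWeight (n - parentIndex l k m) * lTwo (cubeMeasure T l m) (G l) := by
          refine ENNReal.tsum_le_tsum fun n => ?_
          rw [← lTwo_const_mul _ (hG l).aemeasurable]
          refine lTwo_mono_ae ((ae_mem_cube T l m).mono fun p hp => ?_)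
          refine (weight_mul_le_of_mem_cube (h k n _ p.2 (cube_subset_parent hlk m hp)) _).trans ?_
          gcongr
          exact mul_le_of_le_one_left' (χ.weight_le_one _ _ _)
      _ = _ := by
          rw [ENNReal.tsum_mul_right, ENNReal.tsum_mul_left, tsum_latticeWeight_sub_left]
  have h3 : ∑' n, ∫⁻ t, lTwo volume (fun x => χ.weight k n x * G' (t, x)) ∂timeMeasure T ≤
      C * weightMass d * amalgamOne T k G' := by
    have hsm : ∀ m : Fin d → ℤ, Measurable fun t =>
        lTwo (volume.restrict (cube k m)) (fun x => G' (t, x)) := fun m =>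
      measurable_lTwo_section hG' _
    have h4 : ∀ n, ∫⁻ t, lTwo volume (fun x => χ.weight k n x * G' (t, x)) ∂timeMeasure T ≤
        ∑' m, latticeWeight (n - m) *
          (C * ∫⁻ t, lTwo (volume.restrict (cube k m)) (fun x => G' (t, x)) ∂timeMeasure T) := by
      intro n
      have e : ∀ m, latticeWeight (n - m) *
          (C * ∫⁻ t, lTwo (volume.restrict (cube k m)) (fun x => G' (t, x)) ∂timeMeasure T) =
          ∫⁻ t, latticeWeight (n - m) *
            (C * lTwo (volume.restrict (cube k m)) (fun x => G' (t, x))) ∂timeMeasure T := fun m => by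
        rw [lintegral_const_mul _ ((hsm m).const_mul _), lintegral_const_mul _ (hsm m)]
      simp only [e]
      rw [← lintegral_tsum fun m => (((hsm m).const_mul _).const_mul _).aemeasurable]
      refine lintegral_mono fun t => ?_
      have hgt : Measurable fun x => G' (t, x) := hG'.comp measurable_prodMk_left
      refine (lTwo_le_tsum_cube k ((χ.measurable_weight k n).mul hgt)).trans
        (ENNReal.tsum_le_tsum fun m => ?_)
      rw [← mul_assoc, mul_comm _ C, ← lTwo_const_mul _ hgt.aemeasurable]
      refine lTwo_mono_ae ((ae_restrict_mem (measurableSet_cube k m)).mono fun x hx => ?_)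
      refine (weight_mul_le_of_mem_cube (h k n m x hx) _).trans ?_
      gcongr
      exact mul_le_of_le_one_left' (χ.weight_le_one _ _ _)
    refine (ENNReal.tsum_le_tsum h4).trans (le_of_eq ?_)
    rw [tsum_tsum_latticeWeight_mul, ENNReal.tsum_mul_left, amalgamOne, ← mul_assoc,
      mul_comm (weightMass d)]
  refine (ENNReal.tsum_le_tsum h1).trans ?_
  rw [ENNReal.tsum_add, mul_add]
  refine add_le_add ?_ h3
  rw [Summable.tsum_finsetSum fun _ _ => ENNReal.summable, Finset.mul_sum]
  refine Finset.sum_le_sum fun l hl => ?_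
  rw [ENNReal.tsum_mul_left]
  calc _ ≤ (2 : ℝ≥0∞) ^ (((l : ℝ) - k) / 2) * (C * weightMass d * amalgam T l (G l)) := by
        gcongr; exact h2 l hl
    _ = _ := by ring

/-! ### Bilinear estimates for frequency localized functions -/

/-- A space-time function controlled by its own average at frequency `2^i`. -/
def SelfReproducing (C : ℝ≥0∞) (i : ℕ) (F : ℝ × Space d → ℂ) : Prop :=
  ∀ q, ‖F q‖ₑ ≤ C * kernelConv (decayOrder d) i (fun p => ‖F p‖ₑ) q

/-- Bernstein's inequality on the cubes of side `2^i`, in summed form: self-reproduction turns the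
cubewise `L²` bounds into pointwise ones, at the cost `2^(id/2)`. -/
theorem exists_cubewise_sup_bound (χ : CubePartition d) {C₀ : ℝ≥0∞} (hC₀ : C₀ ≠ ⊤) :
    ∃ C : ℝ≥0∞, C ≠ ⊤ ∧ ∀ (T : ℝ) (i : ℕ) (F : ℝ × Space d → ℂ), Measurable F →
      SelfReproducing C₀ i F →
      ∃ a : (Fin d → ℤ) → ℝ≥0∞,
        ∑' n, a n ≤ C * 2 ^ ((i : ℝ) * d / 2) * normL1j χ i (normXj T i) F ∧
        ∀ᵐ t ∂timeMeasure T, ∀ n, ∀ x ∈ cube i n, ‖F (t, x)‖ₑ ≤ a n := by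
  obtain ⟨C, hC, h⟩ := exists_cubewise_bound χ
  refine ⟨C₀ * convConst d * C, by have := convConst_ne_top d; finiteness, ?_⟩
  intro T i F hF hrep
  obtain ⟨a, ha, hae⟩ := h T i F hF
  refine ⟨fun n => ∑' m, latticeWeight (n - m) *
    (C₀ * (2 ^ (d + 1) * (2 ^ ((i : ℝ) * d / 2) * (1 + kernelMass d)) * a m)), ?_, ?_⟩
  · rw [tsum_tsum_latticeWeight_mul (fun m =>
      C₀ * (2 ^ (d + 1) * (2 ^ ((i : ℝ) * d / 2) * (1 + kernelMass d)) * a m)),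
      ENNReal.tsum_mul_left, ENNReal.tsum_mul_left]
    calc _ = C₀ * convConst d * 2 ^ ((i : ℝ) * d / 2) * ∑' n, a n := by rw [convConst]; ring
      _ ≤ C₀ * convConst d * 2 ^ ((i : ℝ) * d / 2) * (C * normL1j χ i (normXj T i) F) := by
          gcongr
      _ = _ := by ring
  · filter_upwards [hae] with t ht n x hx
    have hFt : Measurable fun y => ‖F (t, y)‖ₑ := (hF.comp measurable_prodMk_left).enorm
    refine (hrep (t, x)).trans ?_
    calc _ ≤ C₀ * ∑' m, latticeWeight (n - m) * (2 ^ (d + 1) * (2 ^ ((i : ℝ) * d / 2) *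
          (1 + kernelMass d)) * lTwo (volume.restrict (cube i m)) (fun y => ‖F (t, y)‖ₑ)) :=
          mul_le_mul_right (lintegral_decayKernel_mul_le i i hFt hx) _
      _ = ∑' m, latticeWeight (n - m) * (C₀ * (2 ^ (d + 1) * (2 ^ ((i : ℝ) * d / 2) *
          (1 + kernelMass d)) * lTwo (volume.restrict (cube i m)) (fun y => ‖F (t, y)‖ₑ))) := by
          rw [← ENNReal.tsum_mul_left]
          exact tsum_congr fun m => by ring
      _ ≤ _ := by
          refine ENNReal.tsum_le_tsum fun m => ?_
          gcongr
          exact ht m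

/-- Write `S = S^(1-2δ) S^(2δ)` and use one bound on each factor. This is the source of `T^δ` and of
the restriction `δ ≤ 1/2`. -/
theorem le_interpolation {S a b y : ℝ≥0∞} {δ : ℝ} (h0 : 0 ≤ δ) (h1 : δ ≤ 1 / 2) (ha : S ≤ a * y)
    (hb : S ≤ b ^ (1 / 2 : ℝ) * y) : S ≤ a ^ (1 - 2 * δ) * b ^ δ * y := by
  have e : ∀ z : ℝ≥0∞, z = z ^ (1 - 2 * δ) * z ^ (2 * δ) := fun z => by
    rw [← ENNReal.rpow_add_of_nonneg _ _ (by linarith) (by linarith), sub_add_cancel,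
      ENNReal.rpow_one]
  calc S = S ^ (1 - 2 * δ) * S ^ (2 * δ) := e S
    _ ≤ (a * y) ^ (1 - 2 * δ) * (b ^ (1 / 2 : ℝ) * y) ^ (2 * δ) := by
        gcongr
        · linarith
    _ = a ^ (1 - 2 * δ) * b ^ δ * (y ^ (1 - 2 * δ) * y ^ (2 * δ)) := by
        rw [ENNReal.mul_rpow_of_nonneg _ _ (by linarith : 0 ≤ 1 - 2 * δ),
          ENNReal.mul_rpow_of_nonneg _ _ (by linarith : 0 ≤ 2 * δ), ← ENNReal.rpow_mul,
          show (1 / 2 : ℝ) * (2 * δ) = δ by ring]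
        ring
    _ = _ := by rw [← e]

/-- The core bilinear estimate, on cubes adapted to the factor `F` of frequency `2^i`: its suprema
are summable over the cubes, and `H` is needed only in `L²([0,T] × Q)` uniformly in `Q`,
interpolated between the local energy gain and `T^(1/2)`. -/
theorem exists_amalgam_mul_le (χ : CubePartition d) {C₀ : ℝ≥0∞} (hC₀ : C₀ ≠ ⊤) :
    ∃ C : ℝ≥0∞, C ≠ ⊤ ∧ ∀ (T δ : ℝ), 0 ≤ δ → δ ≤ 1 / 2 →
      ∀ (i j : ℕ) (F H : ℝ × Space d → ℂ), Measurable F → Measurable H → SelfReproducing C₀ i F →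
      amalgam T i (fun p => ‖F p‖ₑ * ‖H p‖ₑ) ≤
        C * 2 ^ ((i : ℝ) * d / 2) * normL1j χ i (normXj T i) F *
          ((2 ^ (((i : ℝ) - j) / 2)) ^ (1 - 2 * δ) * ENNReal.ofReal T ^ δ *
            normL1j χ j (normXj T j) H) := by
  obtain ⟨C, hC, h⟩ := exists_cubewise_sup_bound χ hC₀
  refine ⟨C, hC, fun T δ hδ hδ' i j F H hF hH hrep => ?_⟩
  obtain ⟨a, ha, hae⟩ := h T i F hF hrep
  have hH' : ∀ n, lTwo (cubeMeasure T i n) (fun p => ‖H p‖ₑ) ≤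
      (2 ^ (((i : ℝ) - j) / 2)) ^ (1 - 2 * δ) * ENNReal.ofReal T ^ δ *
        normL1j χ j (normXj T j) H := fun n =>
    le_interpolation hδ hδ' (lTwo_cubeMeasure_le_normL1j χ T j i n hH)
      ((lTwo_mono_measure (cubeMeasure_le T i n)).trans (lTwo_slabMeasure_le_normL1j χ T j hH))
  have h1 : ∀ n, lTwo (cubeMeasure T i n) (fun p => ‖F p‖ₑ * ‖H p‖ₑ) ≤
      a n * ((2 ^ (((i : ℝ) - j) / 2)) ^ (1 - 2 * δ) * ENNReal.ofReal T ^ δ *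
        normL1j χ j (normXj T j) H) := fun n => by
    have hp : ∀ᵐ p ∂cubeMeasure T i n, ‖F p‖ₑ ≤ a n := by
      have h2 : ∀ᵐ p ∂cubeMeasure T i n, ∀ n, ∀ x ∈ cube i n, ‖F (p.1, x)‖ₑ ≤ a n :=
        Measure.quasiMeasurePreserving_fst.ae hae
      filter_upwards [h2, ae_mem_cube T i n] with p h3 h4
      exact h3 n p.2 h4
    calc _ ≤ lTwo (cubeMeasure T i n) (fun p => a n * ‖H p‖ₑ) :=
          lTwo_mono_ae (hp.mono fun p hp => by gcongr)
      _ = a n * lTwo (cubeMeasure T i n) (fun p => ‖H p‖ₑ) :=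
          lTwo_const_mul _ hH.enorm.aemeasurable
      _ ≤ _ := by gcongr; exact hH' n
  refine (ENNReal.tsum_le_tsum h1).trans ?_
  rw [ENNReal.tsum_mul_right]
  gcongr

theorem lintegral_mul_le_normL1j (χ : CubePartition d) (T : ℝ) (i j : ℕ) {F H : ℝ × Space d → ℂ}
    (hF : Measurable F) (hH : Measurable H) :
    ∫⁻ p, ‖F p‖ₑ * ‖H p‖ₑ ∂slabMeasure d T ≤
      ENNReal.ofReal T * (normL1j χ i (normXj T i) F * normL1j χ j (normXj T j) H) := by
  have hm : Measurable fun p => ‖F p‖ₑ * ‖H p‖ₑ := hF.enorm.mul hH.enorm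
  rw [slabMeasure, lintegral_prod _ hm.aemeasurable]
  calc _ ≤ ∫⁻ _, normL1j χ i (normXj T i) F * normL1j χ j (normXj T j) H ∂timeMeasure T := by
        refine lintegral_mono_ae ?_
        filter_upwards [ae_lTwo_le_normL1j χ T i hF, ae_lTwo_le_normL1j χ T j hH] with t h1 h2
        refine (lintegral_mul_le_lTwo (f := fun x => ‖F (t, x)‖ₑ) (g := fun x => ‖H (t, x)‖ₑ)
          (hF.comp measurable_prodMk_left).enorm.aemeasurable
          (hH.comp measurable_prodMk_left).enorm.aemeasurable).trans ?_
        gcongr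
    _ = _ := by rw [lintegral_const, timeMeasure_univ, mul_comm]

/-! ### Decomposition of the product by frequency interaction. -/

open Classical in
/-- The indicator of the interacting frequencies. -/
def interactionWeight (i j k : ℕ) : ℝ≥0∞ := if Interacting i j k then 1 else 0

/-- The indicator of the low-high interactions. -/
def lowHighWeight (l j k : ℕ) : ℝ≥0∞ := if l + 3 ≤ j ∧ j ≤ k + 2 ∧ k ≤ j + 2 then 1 else 0

/-- The indicator of the high-high interactions. -/
def highHighWeight (i j k : ℕ) : ℝ≥0∞ := if i ≤ j + 2 ∧ j ≤ i + 2 ∧ k ≤ i + 4 then 1 else 0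

theorem interactionWeight_le (i j k : ℕ) :
    interactionWeight i j k ≤ lowHighWeight i j k + lowHighWeight j i k + highHighWeight i j k := by
  unfold interactionWeight lowHighWeight highHighWeight
  by_cases h : Interacting i j k
  · rw [if_pos h]
    rcases h with h | h | h
    · rw [if_pos h, add_assoc]; exact le_self_add
    · rw [if_pos h, add_right_comm]; exact le_add_self
    · rw [if_pos h]; exact le_add_self
  · rw [if_neg h]; exact bot_le

theorem lowHighWeight_eq_zero {l k : ℕ} (h : k < l) (j : ℕ) : lowHighWeight l j k = 0 :=
  if_neg (by omega)

/-- In both low-high cases the lower frequency is named `l`. Then `l + 3 ≤ j ≤ k + 2` forces `l <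
k`, so the outer sum is finite and its cubes do not exceed those of scale `k`. -/
theorem tsum_interaction_le (U V : ℕ → ℝ≥0∞) (k : ℕ) :
    ∑' i, ∑' j, interactionWeight i j k * (U i * V j) ≤
      ∑ l ∈ Finset.range (k + 1), ∑' j, lowHighWeight l j k * (U l * V j + V l * U j) +
        ∑' i, ∑' j, highHighWeight i j k * (U i * V j) := by
  calc _ ≤ ∑' i, ∑' j, (lowHighWeight i j k * (U i * V j) + lowHighWeight j i k * (U i * V j) +
        highHighWeight i j k * (U i * V j)) := by
        refine ENNReal.tsum_le_tsum fun i => ENNReal.tsum_le_tsum fun j => ?_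
        rw [← add_mul, ← add_mul]
        gcongr
        exact interactionWeight_le i j k
    _ = ∑' i, ∑' j, lowHighWeight i j k * (U i * V j) +
        ∑' i, ∑' j, lowHighWeight j i k * (U i * V j) +
        ∑' i, ∑' j, highHighWeight i j k * (U i * V j) := by
        simp only [ENNReal.tsum_add]
    _ = _ := by
        congr 1
        rw [ENNReal.tsum_comm (f := fun i j => lowHighWeight j i k * (U i * V j)),
          ← ENNReal.tsum_add, tsum_eq_sum (s := Finset.range (k + 1))]
        · refine Finset.sum_congr rfl fun l _ => ?_
          rw [← ENNReal.tsum_add]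
          exact tsum_congr fun j => by ring
        · intro l hl
          have : k < l := by
            by_contra h
            exact hl (Finset.mem_range.2 (by omega))
          simp [lowHighWeight_eq_zero this]

theorem kernelConv_add (p N : ℕ) {f g : ℝ × Space d → ℝ≥0∞} (hf : Measurable f)
    (q : ℝ × Space d) :
    kernelConv p N (fun r => f r + g r) q = kernelConv p N f q + kernelConv p N g q := by
  simp only [kernelConv, mul_add]
  rw [lintegral_add_left]
  exact ((measurable_decayKernel d p N).comp (measurable_id.sub_const _)).mul
    (hf.comp measurable_prodMk_left)

theorem kernelConv_sum (p N : ℕ) {ι : Type*} (s : Finset ι) {f : ι → ℝ × Space d → ℝ≥0∞}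
    (hf : ∀ i, Measurable (f i)) (q : ℝ × Space d) :
    kernelConv p N (fun r => ∑ i ∈ s, f i r) q = ∑ i ∈ s, kernelConv p N (f i) q := by
  simp only [kernelConv, Finset.mul_sum]
  rw [lintegral_finsetSum]
  intro i _
  exact ((measurable_decayKernel d p N).comp (measurable_id.sub_const _)).mul
    ((hf i).comp measurable_prodMk_left)

theorem amalgam_tsum_le (T : ℝ) (l : ℕ) {f : ℕ → ℝ × Space d → ℝ≥0∞}
    (hf : ∀ j, Measurable (f j)) :
    amalgam T l (fun p => ∑' j, f j p) ≤ ∑' j, amalgam T l (f j) := by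
  simp only [amalgam]
  rw [ENNReal.tsum_comm]
  exact ENNReal.tsum_le_tsum fun n => lTwo_tsum_le fun j => (hf j).aemeasurable

theorem amalgam_add_le (T : ℝ) (l : ℕ) {f g : ℝ × Space d → ℝ≥0∞}
    (hf : Measurable f) (hg : Measurable g) :
    amalgam T l (fun p => f p + g p) ≤ amalgam T l f + amalgam T l g := by
  simp only [amalgam]
  rw [← ENNReal.tsum_add]
  refine ENNReal.tsum_le_tsum fun n => ?_
  have h := lTwo_sum_le (μ := cubeMeasure T l n) Finset.univ (f := fun b : Bool => cond b f g)
    (by rintro (_ | _); exacts [hg.aemeasurable, hf.aemeasurable])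
  simpa using h

/-- The bound for `‖S_k (u v)‖_{l¹_k Y_k}` in terms of the norms of the pieces. -/
def pieceBound (d : ℕ) (T δ : ℝ) (X Y : ℕ → ℝ≥0∞) (k : ℕ) : ℝ≥0∞ :=
  ∑ l ∈ Finset.range (k + 1), 2 ^ (((l : ℝ) - k) / 2) * ∑' j, lowHighWeight l j k *
    (2 ^ ((l : ℝ) * d / 2) * ((2 ^ (((l : ℝ) - j) / 2)) ^ (1 - 2 * δ) * ENNReal.ofReal T ^ δ) *
      (X l * Y j + Y l * X j)) +
  2 ^ ((k : ℝ) * d / 2) * ∑' i, ∑' j, highHighWeight i j k * (ENNReal.ofReal T * (X i * Y j))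

/-- Low-high products are measured on cubes adapted to the low frequency and become atoms; high-high
products are bounded in `L¹` and enter `L¹L²` by Bernstein at frequency `2^k`. The kernel of `S_k`
acts boundedly on the amalgams of every scale. -/
theorem exists_normL1j_normYj_le_pieceBound (χ : CubePartition d) {C₀ : ℝ≥0∞} (hC₀ : C₀ ≠ ⊤) :
    ∃ C : ℝ≥0∞, C ≠ ⊤ ∧ ∀ (T δ : ℝ), 0 ≤ δ → δ ≤ 1 / 2 →
      ∀ (F H : ℕ → ℝ × Space d → ℂ), (∀ i, Measurable (F i)) → (∀ i, Measurable (H i)) →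
      (∀ i, SelfReproducing C₀ i (F i)) → (∀ i, SelfReproducing C₀ i (H i)) →
      ∀ (k : ℕ) (W : ℝ × Space d → ℂ), Measurable W →
      (∀ q, ‖W q‖ₑ ≤ C₀ * kernelConv (decayOrder d) k
        (fun p => ∑' i, ∑' j, interactionWeight i j k * (‖F i p‖ₑ * ‖H j p‖ₑ)) q) →
      normL1j χ k (normYj T k) W ≤ C * pieceBound d T δ
        (fun i => normL1j χ i (normXj T i) (F i)) (fun i => normL1j χ i (normXj T i) (H i)) k := by
  obtain ⟨C₁, hC₁, hY⟩ := exists_normL1j_normYj_le χ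
  obtain ⟨C₂, hC₂, hA⟩ := exists_amalgam_mul_le χ hC₀
  have hcc := convConst_ne_top d
  refine ⟨C₁ * (C₀ * convConst d * (C₂ + 1)), by finiteness, ?_⟩
  intro T δ hδ hδ' F H hF hH hrF hrH k W hW hWb
  set X := fun i => normL1j χ i (normXj T i) (F i) with hX
  set Y := fun i => normL1j χ i (normXj T i) (H i) with hY'
  set g : ℕ → ℕ → ℝ × Space d → ℝ≥0∞ := fun l j p => lowHighWeight l j k *
    (‖F l p‖ₑ * ‖H j p‖ₑ + ‖H l p‖ₑ * ‖F j p‖ₑ) with hg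
  set g' : ℕ → ℕ → ℝ × Space d → ℝ≥0∞ := fun i j p => highHighWeight i j k *
    (‖F i p‖ₑ * ‖H j p‖ₑ) with hg'
  have hgm : ∀ l j, Measurable (g l j) := fun l j =>
    (((hF l).enorm.mul (hH j).enorm).add ((hH l).enorm.mul (hF j).enorm)).const_mul _
  have hgm' : ∀ l j, Measurable (g' l j) := fun l j => ((hF l).enorm.mul (hH j).enorm).const_mul _
  have hgs : ∀ l, Measurable fun p => ∑' j, g l j p := fun l => Measurable.tsum (hgm l)
  have hgs' : ∀ i, Measurable fun p => ∑' j, g' i j p := fun l => Measurable.tsum (hgm' l)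
  have hgss' : Measurable fun p => ∑' i, ∑' j, g' i j p := Measurable.tsum hgs'
  have hdom : ∀ q, ‖W q‖ₑ ≤ ∑ l ∈ Finset.range (k + 1),
      C₀ * kernelConv (decayOrder d) k (fun p => ∑' j, g l j p) q +
      C₀ * kernelConv (decayOrder d) k (fun p => ∑' i, ∑' j, g' i j p) q := by
    intro q
    rw [← Finset.mul_sum, ← mul_add, ← kernelConv_sum _ _ _ hgs, ← kernelConv_add _ _
      (Finset.measurable_fun_sum _ fun l _ => hgs l)]
    refine (hWb q).trans ?_
    gcongr
    refine kernelConv_mono (fun p => ?_) q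
    exact tsum_interaction_le (fun i => ‖F i p‖ₑ) (fun j => ‖H j p‖ₑ) k
  refine (hY T k W hW _ _ (fun l => (measurable_kernelConv _ _ (hgs l)).const_mul _)
    ((measurable_kernelConv _ _ hgss').const_mul _) hdom).trans ?_
  rw [mul_assoc C₁]
  gcongr
  have hlow : ∀ l, amalgam T l (fun q => C₀ * kernelConv (decayOrder d) k
      (fun p => ∑' j, g l j p) q) ≤ C₀ * convConst d * (C₂ + 1) * ∑' j, lowHighWeight l j k *
      (2 ^ ((l : ℝ) * d / 2) * ((2 ^ (((l : ℝ) - j) / 2)) ^ (1 - 2 * δ) * ENNReal.ofReal T ^ δ) *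
      (X l * Y j + Y l * X j)) := by
    intro l
    rw [amalgam_const_mul _ _ _ (measurable_kernelConv _ _ (hgs l)), mul_assoc C₀, mul_assoc C₀]
    gcongr
    refine (amalgam_kernelConv_le T k l (hgs l)).trans ?_
    rw [mul_assoc]
    gcongr
    refine (amalgam_tsum_le T l (hgm l)).trans ?_
    rw [← ENNReal.tsum_mul_left]
    refine ENNReal.tsum_le_tsum fun j => ?_
    have hm : Measurable fun p => ‖F l p‖ₑ * ‖H j p‖ₑ + ‖H l p‖ₑ * ‖F j p‖ₑ :=
      ((hF l).enorm.mul (hH j).enorm).add ((hH l).enorm.mul (hF j).enorm)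
    have e : amalgam T l (g l j) = lowHighWeight l j k *
      amalgam T l (fun p => ‖F l p‖ₑ * ‖H j p‖ₑ + ‖H l p‖ₑ * ‖F j p‖ₑ) :=
      amalgam_const_mul _ _ _ hm
    rw [e, mul_left_comm]
    gcongr
    refine (amalgam_add_le T l ((hF l).enorm.mul (hH j).enorm)
      ((hH l).enorm.mul (hF j).enorm)).trans ?_
    refine (add_le_add (hA T δ hδ hδ' l j _ _ (hF l) (hH j) (hrF l))
      (hA T δ hδ hδ' l j _ _ (hH l) (hF j) (hrH l))).trans ?_
    calc _ = C₂ * (2 ^ ((l : ℝ) * d / 2) * ((2 ^ (((l : ℝ) - j) / 2)) ^ (1 - 2 * δ) *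
          ENNReal.ofReal T ^ δ) * (X l * Y j + Y l * X j)) := by
          simp only [hX, hY']; ring
      _ ≤ _ := by gcongr; exact le_self_add
  have hhigh : amalgamOne T k (fun q => C₀ * kernelConv (decayOrder d) k
      (fun p => ∑' i, ∑' j, g' i j p) q) ≤ C₀ * convConst d * (C₂ + 1) *
      (2 ^ ((k : ℝ) * d / 2) *
        ∑' i, ∑' j, highHighWeight i j k * (ENNReal.ofReal T * (X i * Y j))) := by
    have hm := measurable_kernelConv (decayOrder d) k hgss'
    have e : amalgamOne T k (fun q => C₀ * kernelConv (decayOrder d) k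
        (fun p => ∑' i, ∑' j, g' i j p) q) = C₀ * amalgamOne T k (kernelConv (decayOrder d) k
        (fun p => ∑' i, ∑' j, g' i j p)) := by
      simp only [amalgamOne]
      rw [← ENNReal.tsum_mul_left]
      refine tsum_congr fun n => ?_
      rw [← lintegral_const_mul _ (measurable_lTwo_section hm _)]
      refine lintegral_congr fun t => ?_
      exact lTwo_const_mul _ (hm.comp measurable_prodMk_left).aemeasurable
    rw [e, mul_assoc C₀, mul_assoc C₀]
    gcongr
    refine (amalgamOne_kernelConv_le T k k hgss').trans ?_
    have hint : ∫⁻ p, ∑' i, ∑' j, g' i j p ∂slabMeasure d T ≤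
        ∑' i, ∑' j, highHighWeight i j k * (ENNReal.ofReal T * (X i * Y j)) := by
      rw [lintegral_tsum fun i => (hgs' i).aemeasurable]
      refine ENNReal.tsum_le_tsum fun i => ?_
      rw [lintegral_tsum fun j => (hgm' i j).aemeasurable]
      refine ENNReal.tsum_le_tsum fun j => ?_
      have hm : Measurable fun p => ‖F i p‖ₑ * ‖H j p‖ₑ := (hF i).enorm.mul (hH j).enorm
      rw [lintegral_const_mul _ hm]
      gcongr
      exact lintegral_mul_le_normL1j χ T i j (hF i) (hH j)
    calc _ ≤ convConst d * 2 ^ ((k : ℝ) * d / 2) *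
          ∑' i, ∑' j, highHighWeight i j k * (ENNReal.ofReal T * (X i * Y j)) := by gcongr
      _ = convConst d * (1 * (2 ^ ((k : ℝ) * d / 2) *
          ∑' i, ∑' j, highHighWeight i j k * (ENNReal.ofReal T * (X i * Y j)))) := by
          rw [one_mul, mul_assoc]
      _ ≤ _ := by
          rw [mul_assoc]
          gcongr
          exact le_add_self
  rw [pieceBound, mul_add]
  refine add_le_add ?_ hhigh
  rw [Finset.mul_sum]
  refine Finset.sum_le_sum fun l _ => ?_
  rw [mul_left_comm]
  gcongr
  exact hlow l

/-! ### Summation over the frequencies -/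

theorem ENNReal_two_rpow_add (a b : ℝ) : (2 : ℝ≥0∞) ^ a * 2 ^ b = 2 ^ (a + b) :=
  (ENNReal.rpow_add _ _ two_ne_zero ENNReal.ofNat_ne_top).symm

/-- The `ℓ²` norm of a sequence with dyadic weights. -/
def dyadicNorm (α : ℝ) (X : ℕ → ℝ≥0∞) : ℝ≥0∞ :=
  lTwo Measure.count fun i : ℕ => 2 ^ ((i : ℝ) * α) * X i

theorem dyadicNorm_eq (α : ℝ) (X : ℕ → ℝ≥0∞) :
    dyadicNorm α X = (∑' j : ℕ, (2 : ℝ≥0∞) ^ (2 * (j : ℝ) * α) * X j ^ 2) ^ (1 / 2 : ℝ) := by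
  rw [dyadicNorm, lTwo, lintegral_count]
  congr 1
  refine tsum_congr fun j => ?_
  rw [mul_pow, ← ENNReal.rpow_natCast, ← ENNReal.rpow_mul]
  congr 2
  push_cast
  ring

theorem le_dyadicNorm (α : ℝ) (X : ℕ → ℝ≥0∞) (i : ℕ) :
    X i ≤ 2 ^ (-((i : ℝ) * α)) * dyadicNorm α X := by
  have h : 2 ^ ((i : ℝ) * α) * X i ≤ dyadicNorm α X := by
    have h1 : (2 ^ ((i : ℝ) * α) * X i) ^ 2 ≤ dyadicNorm α X ^ 2 := by
      rw [dyadicNorm, lTwo_sq, lintegral_count]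
      exact ENNReal.le_tsum (f := fun i : ℕ => (2 ^ ((i : ℝ) * α) * X i) ^ 2) i
    simpa only [ENNReal_sq_rpow_half] using ENNReal.rpow_le_rpow h1 (by norm_num : (0 : ℝ) ≤ 1 / 2)
  calc X i = 2 ^ (-((i : ℝ) * α)) * (2 ^ ((i : ℝ) * α) * X i) := by
        rw [← mul_assoc, ENNReal_two_rpow_add, neg_add_cancel, ENNReal.rpow_zero, one_mul]
    _ ≤ _ := by gcongr

/-- The indicator of the neighbouring frequencies. -/
def nearWeight (j k : ℕ) : ℝ≥0∞ := if j ≤ k + 2 ∧ k ≤ j + 2 then 1 else 0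

theorem nearWeight_comm (j k : ℕ) : nearWeight j k = nearWeight k j := by
  simp only [nearWeight, and_comm]

theorem tsum_nearWeight_le (k : ℕ) : ∑' j, nearWeight j k ≤ 5 := by
  rw [tsum_eq_sum (s := Finset.Icc (k - 2) (k + 2))]
  · calc _ ≤ ∑ _j ∈ Finset.Icc (k - 2) (k + 2), (1 : ℝ≥0∞) :=
          Finset.sum_le_sum fun j _ => by unfold nearWeight; split_ifs <;> simp
      _ = ((Finset.Icc (k - 2) (k + 2)).card : ℝ≥0∞) := by simp
      _ ≤ ((5 : ℕ) : ℝ≥0∞) := by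
          rw [Nat.card_Icc]
          exact_mod_cast (by omega : k + 2 + 1 - (k - 2) ≤ 5)
      _ = 5 := by norm_num
  · intro j hj
    refine if_neg fun h => hj ?_
    rw [Finset.mem_Icc]
    omega

/-- Schur's test: each row and each column of the matrix `nearWeight` has at most five nonzero
entries. -/
theorem lTwo_tsum_nearWeight_le (y : ℕ → ℝ≥0∞) :
    lTwo Measure.count (fun k : ℕ => ∑' j, nearWeight j k * y j) ≤ 5 * lTwo Measure.count y := by
  refine lTwo_le_of_sq_le ?_
  rw [mul_pow, lTwo_sq, lintegral_count, lintegral_count]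
  have hsq : ∀ j k, nearWeight j k ^ 2 = nearWeight j k := fun j k => by
    unfold nearWeight; split_ifs <;> simp
  calc ∑' k, (∑' j, nearWeight j k * y j) ^ 2
      ≤ ∑' k, 5 * ∑' j, nearWeight j k * y j ^ 2 := by
        refine ENNReal.tsum_le_tsum fun k => ?_
        have h := sq_lintegral_mul_le (μ := Measure.count) (f := fun j => nearWeight j k)
          (g := fun j => nearWeight j k * y j) (measurable_of_countable _).aemeasurable
          (measurable_of_countable _).aemeasurable
        simp only [lintegral_count, ← mul_assoc, ← pow_two, hsq, mul_pow] at h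
        exact h.trans (mul_le_mul_left (tsum_nearWeight_le k) _)
    _ = 5 * ∑' j, (∑' k, nearWeight k j) * y j ^ 2 := by
        rw [ENNReal.tsum_mul_left, ENNReal.tsum_comm]
        congr 1
        refine tsum_congr fun j => ?_
        rw [ENNReal.tsum_mul_right]
        simp only [nearWeight_comm j]
    _ ≤ 5 * ∑' j, 5 * y j ^ 2 := by
        gcongr
        exact tsum_nearWeight_le _
    _ = _ := by rw [ENNReal.tsum_mul_left]; ring

/-- For `k = j` the left side equals `jβ - lε - (j - l)(β - σ + 1) - lδ`. The hypothesis `β ≥ σ - 1`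
and the loss of `δ` in the index make the last two terms harmless. Moving `k` to `j` costs `(k -
j)(σ - δ - 1/2) ≤ 2s + 2`. -/
theorem lowHigh_exponent_le {s σ δ α β ε d l j k : ℝ} (hε : ε = s - 2 - d / 2)
    (hsum : α + β = σ + s - 2) (hβ : σ - 1 ≤ β) (hσ : 0 ≤ σ) (hσs : σ ≤ s) (hδ : 0 ≤ δ)
    (hδ' : δ ≤ 1 / 2) (hl : 0 ≤ l) (hlj : l ≤ j) (hjk : j ≤ k + 2) (hkj : k ≤ j + 2) :
    k * (σ - δ) + (l - k) / 2 + l * d / 2 + (l - j) / 2 * (1 - 2 * δ) - l * α ≤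
      2 * s + 2 - l * ε + j * β := by
  have h1 : (k - j) * (σ - δ - 1 / 2) ≤ 2 * s + 2 := by
    rcases le_total 0 (σ - δ - 1 / 2) with h | h <;> nlinarith
  have h2 : 0 ≤ (j - l) * (β - (σ - 1)) := mul_nonneg (by linarith) (by linarith)
  have h3 : 0 ≤ l * δ := mul_nonneg hl hδ
  obtain rfl : α = σ + s - 2 - β := by linarith
  subst hε
  nlinarith

/-- The low factor is bounded by its norm and contributes a geometric decay in `l`; the high factor
is retained for the `ℓ²` sum in `k`. -/
theorem lowHigh_term_le {d : ℕ} {s σ δ α β ε : ℝ} (hε : ε = s - 2 - d / 2)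
    (hsum : α + β = σ + s - 2) (hβ : σ - 1 ≤ β) (hσ : 0 ≤ σ) (hσs : σ ≤ s) (hδ : 0 ≤ δ)
    (hδ' : δ ≤ 1 / 2) (X Y : ℕ → ℝ≥0∞) (τ : ℝ≥0∞) (l j k : ℕ) :
    2 ^ ((k : ℝ) * (σ - δ)) * (2 ^ (((l : ℝ) - k) / 2) * (lowHighWeight l j k *
      (2 ^ ((l : ℝ) * d / 2) * ((2 ^ (((l : ℝ) - j) / 2)) ^ (1 - 2 * δ) * τ) * (X l * Y j)))) ≤
      2 ^ (2 * s + 2) * τ * dyadicNorm α X * (2 ^ (-ε)) ^ l *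
        (nearWeight j k * (2 ^ ((j : ℝ) * β) * Y j)) := by
  by_cases h : l + 3 ≤ j ∧ j ≤ k + 2 ∧ k ≤ j + 2
  · rw [lowHighWeight, if_pos h, nearWeight, if_pos h.2, one_mul, one_mul, ← ENNReal.rpow_mul,
      ← ENNReal.rpow_natCast, ← ENNReal.rpow_mul]
    obtain ⟨h1, h2, h3⟩ := h
    have h1' : (l : ℝ) ≤ j := by exact_mod_cast (by omega : l ≤ j)
    have h2' : (j : ℝ) ≤ k + 2 := by exact_mod_cast h2
    have h3' : (k : ℝ) ≤ j + 2 := by exact_mod_cast h3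
    have key := lowHigh_exponent_le hε hsum hβ hσ hσs hδ hδ' (Nat.cast_nonneg l) h1' h2' h3'
    calc _ ≤ 2 ^ ((k : ℝ) * (σ - δ)) * (2 ^ (((l : ℝ) - k) / 2) *
          (2 ^ ((l : ℝ) * d / 2) * (2 ^ (((l : ℝ) - j) / 2 * (1 - 2 * δ)) * τ) *
            ((2 ^ (-((l : ℝ) * α)) * dyadicNorm α X) * Y j))) := by
          gcongr
          exact le_dyadicNorm α X l
      _ = (2 ^ ((k : ℝ) * (σ - δ)) * 2 ^ (((l : ℝ) - k) / 2) * 2 ^ ((l : ℝ) * d / 2) *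
          2 ^ (((l : ℝ) - j) / 2 * (1 - 2 * δ)) * 2 ^ (-((l : ℝ) * α))) *
            (τ * dyadicNorm α X * Y j) := by ring
      _ ≤ (2 ^ (2 * s + 2) * 2 ^ (-ε * (l : ℝ)) * 2 ^ ((j : ℝ) * β)) *
            (τ * dyadicNorm α X * Y j) := by
          simp only [ENNReal_two_rpow_add]
          refine mul_le_mul_left (ENNReal.rpow_le_rpow_of_exponent_le one_le_two ?_) _
          linarith
      _ = _ := by ring
  · rw [lowHighWeight, if_neg h]
    simp

/-- For `i = j` the exponent is `k(σ - δ + d/2) - i(σ + d/2 + ε)`. As `k ≤ i + 4`, the surplus `ε`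
can be shared: half for summing in `i`, half for the `ℓ²` norm in `k`. -/
theorem highHigh_exponent_le {s σ δ α β ε d i j k : ℝ} (hε : ε = s - 2 - d / 2) (hε0 : 0 ≤ ε)
    (hd : 0 ≤ d) (hsum : α + β = σ + s - 2) (hβ : |β| ≤ s + 1) (hσ : 0 ≤ σ) (hσs : σ ≤ s)
    (hδ : 0 ≤ δ) (hk : 0 ≤ k) (hij : i ≤ j + 2) (hji : j ≤ i + 2) (hki : k ≤ i + 4) :
    k * (σ - δ) + k * d / 2 - i * α - j * β ≤ 10 * s + 2 - i * (ε / 2) - k * (ε / 2) := by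
  obtain ⟨hβ1, hβ2⟩ := abs_le.1 hβ
  have h1 : (i - j) * β ≤ 2 * s + 2 := by
    rcases le_total 0 β with h | h <;> nlinarith
  have h2 : 0 ≤ k * δ := mul_nonneg hk hδ
  have h3 : 0 ≤ (i + 4 - k) * (σ + d / 2 + ε / 2) := mul_nonneg (by linarith) (by positivity)
  obtain rfl : α = σ + s - 2 - β := by linarith
  obtain rfl : s = ε + 2 + d / 2 := by linarith
  nlinarith

theorem highHigh_term_le {d : ℕ} {s σ δ α β ε : ℝ} (hε : ε = s - 2 - d / 2) (hε0 : 0 ≤ ε)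
    (hsum : α + β = σ + s - 2) (hβ : |β| ≤ s + 1) (hσ : 0 ≤ σ) (hσs : σ ≤ s) (hδ : 0 ≤ δ)
    (X Y : ℕ → ℝ≥0∞) (τ : ℝ≥0∞) (i j k : ℕ) :
    2 ^ ((k : ℝ) * (σ - δ)) * (2 ^ ((k : ℝ) * d / 2) * (highHighWeight i j k *
      (τ * (X i * Y j)))) ≤
      2 ^ (10 * s + 2) * τ * (dyadicNorm α X * dyadicNorm β Y) * (2 ^ (-(ε / 2))) ^ k *
        ((2 ^ (-(ε / 2))) ^ i * nearWeight j i) := by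
  by_cases h : i ≤ j + 2 ∧ j ≤ i + 2 ∧ k ≤ i + 4
  · rw [highHighWeight, if_pos h, nearWeight, if_pos ⟨h.2.1, h.1⟩, one_mul, mul_one]
    simp only [← ENNReal.rpow_natCast, ← ENNReal.rpow_mul]
    obtain ⟨h1, h2, h3⟩ := h
    have h1' : (i : ℝ) ≤ j + 2 := by exact_mod_cast h1
    have h2' : (j : ℝ) ≤ i + 2 := by exact_mod_cast h2
    have h3' : (k : ℝ) ≤ i + 4 := by exact_mod_cast h3
    have key := highHigh_exponent_le hε hε0 (Nat.cast_nonneg d) hsum hβ hσ hσs hδ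
      (Nat.cast_nonneg k) h1' h2' h3'
    calc _ ≤ 2 ^ ((k : ℝ) * (σ - δ)) * (2 ^ ((k : ℝ) * d / 2) *
          (τ * ((2 ^ (-((i : ℝ) * α)) * dyadicNorm α X) *
            (2 ^ (-((j : ℝ) * β)) * dyadicNorm β Y)))) := by
          gcongr
          · exact le_dyadicNorm α X i
          · exact le_dyadicNorm β Y j
      _ = (2 ^ ((k : ℝ) * (σ - δ)) * 2 ^ ((k : ℝ) * d / 2) * 2 ^ (-((i : ℝ) * α)) *
          2 ^ (-((j : ℝ) * β))) * (τ * (dyadicNorm α X * dyadicNorm β Y)) := by ring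
      _ ≤ (2 ^ (10 * s + 2) * 2 ^ (-(ε / 2) * (k : ℝ)) * 2 ^ (-(ε / 2) * (i : ℝ))) *
            (τ * (dyadicNorm α X * dyadicNorm β Y)) := by
          simp only [ENNReal_two_rpow_add]
          refine mul_le_mul_left (ENNReal.rpow_le_rpow_of_exponent_le one_le_two ?_) _
          linarith
      _ = _ := by ring
  · rw [highHighWeight, if_neg h]
    simp

/-- The sum of the geometric series of ratio `2^{-a}`. -/
def geomMass (a : ℝ) : ℝ≥0∞ := ∑' n : ℕ, ((2 : ℝ≥0∞) ^ (-a)) ^ n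

theorem geomMass_ne_top {a : ℝ} (ha : 0 < a) : geomMass a ≠ ⊤ := by
  rw [geomMass, ENNReal.tsum_geometric, ENNReal.inv_ne_top]
  have : (2 : ℝ≥0∞) ^ (-a) < 1 := ENNReal.rpow_lt_one_of_one_lt_of_neg (by norm_num) (by linarith)
  exact (tsub_pos_of_lt this).ne'

theorem lTwo_geom_le {a : ℝ} (ha : 0 < a) :
    lTwo Measure.count (fun n : ℕ => ((2 : ℝ≥0∞) ^ (-a)) ^ n) ≤ geomMass a := by
  have h1 : 1 ≤ geomMass a := by
    rw [← pow_zero ((2 : ℝ≥0∞) ^ (-a))]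
    exact ENNReal.le_tsum (f := fun n : ℕ => ((2 : ℝ≥0∞) ^ (-a)) ^ n) 0
  have h2 : (2 : ℝ≥0∞) ^ (-a) ≤ 1 :=
    (ENNReal.rpow_lt_one_of_one_lt_of_neg (by norm_num) (by linarith)).le
  refine lTwo_le_of_sq_le ?_
  rw [lintegral_count]
  calc _ ≤ geomMass a := ENNReal.tsum_le_tsum fun n => by
        rw [pow_two]
        exact mul_le_of_le_one_left' (pow_le_one' h2 n)
    _ ≤ _ := by
        rw [pow_two]
        exact le_mul_of_one_le_left' h1

theorem pieceBound_le {d : ℕ} {s σ δ α β ε T : ℝ} (hε : ε = s - 2 - d / 2) (hε0 : 0 < ε)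
    (hsum : α + β = σ + s - 2) (hα : σ - 1 ≤ α) (hβ : σ - 1 ≤ β) (hβ' : |β| ≤ s + 1)
    (hσ : 0 ≤ σ) (hσs : σ ≤ s) (hδ : 0 ≤ δ) (hδ' : δ ≤ 1 / 2) (hT : T ≤ 1)
    (X Y : ℕ → ℝ≥0∞) (k : ℕ) :
    2 ^ ((k : ℝ) * (σ - δ)) * pieceBound d T δ X Y k ≤
      2 ^ (2 * s + 2) * ENNReal.ofReal T ^ δ * geomMass ε * dyadicNorm α X *
        (∑' j, nearWeight j k * (2 ^ ((j : ℝ) * β) * Y j)) +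
      2 ^ (2 * s + 2) * ENNReal.ofReal T ^ δ * geomMass ε * dyadicNorm β Y *
        (∑' j, nearWeight j k * (2 ^ ((j : ℝ) * α) * X j)) +
      2 ^ (10 * s + 2) * ENNReal.ofReal T ^ δ * 5 * geomMass (ε / 2) *
        (dyadicNorm α X * dyadicNorm β Y) * (2 ^ (-(ε / 2))) ^ k := by
  set τ := ENNReal.ofReal T ^ δ with hτ
  -- The full power of `T` in the high-high terms is more than needed, as `T ≤ 1` and `δ ≤ 1`.
  have hTτ : ENNReal.ofReal T ≤ τ := by
    calc ENNReal.ofReal T = ENNReal.ofReal T ^ (1 : ℝ) := (ENNReal.rpow_one _).symm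
      _ ≤ _ := ENNReal.rpow_le_rpow_of_exponent_ge (by simpa using hT) (by linarith)
  -- Stated for general sequences in order to be applied twice, with either distribution as the low
  -- factor.
  have hlow : ∀ (γ : ℝ) (Z W : ℕ → ℝ≥0∞) (γ' : ℝ), γ' + γ = σ + s - 2 → σ - 1 ≤ γ →
      ∑ l ∈ Finset.range (k + 1), ∑' j, 2 ^ ((k : ℝ) * (σ - δ)) * (2 ^ (((l : ℝ) - k) / 2) *
        (lowHighWeight l j k * (2 ^ ((l : ℝ) * d / 2) *
          ((2 ^ (((l : ℝ) - j) / 2)) ^ (1 - 2 * δ) * τ) * (Z l * W j)))) ≤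
      2 ^ (2 * s + 2) * τ * geomMass ε * dyadicNorm γ' Z *
        (∑' j, nearWeight j k * (2 ^ ((j : ℝ) * γ) * W j)) := by
    intro γ Z W γ' h1 h2
    calc _ ≤ ∑ l ∈ Finset.range (k + 1), ∑' j, 2 ^ (2 * s + 2) * τ * dyadicNorm γ' Z *
          (2 ^ (-ε)) ^ l * (nearWeight j k * (2 ^ ((j : ℝ) * γ) * W j)) :=
          Finset.sum_le_sum fun l _ => ENNReal.tsum_le_tsum fun j =>
            lowHigh_term_le hε h1 h2 hσ hσs hδ hδ' Z W τ l j k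
      _ = 2 ^ (2 * s + 2) * τ * (∑ l ∈ Finset.range (k + 1), (2 ^ (-ε)) ^ l) * dyadicNorm γ' Z *
          (∑' j, nearWeight j k * (2 ^ ((j : ℝ) * γ) * W j)) := by
          simp only [ENNReal.tsum_mul_left]
          rw [← Finset.sum_mul, ← Finset.mul_sum]
          ring
      _ ≤ _ := by
          gcongr
          exact ENNReal.sum_le_tsum _
  have hhigh : 2 ^ ((k : ℝ) * (σ - δ)) * (2 ^ ((k : ℝ) * d / 2) *
      ∑' i, ∑' j, highHighWeight i j k * (ENNReal.ofReal T * (X i * Y j))) ≤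
      2 ^ (10 * s + 2) * τ * 5 * geomMass (ε / 2) *
        (dyadicNorm α X * dyadicNorm β Y) * (2 ^ (-(ε / 2))) ^ k := by
    simp only [← ENNReal.tsum_mul_left]
    calc _ ≤ ∑' i, ∑' j, 2 ^ (10 * s + 2) * τ * (dyadicNorm α X * dyadicNorm β Y) *
          (2 ^ (-(ε / 2))) ^ k * ((2 ^ (-(ε / 2))) ^ i * nearWeight j i) := by
          refine ENNReal.tsum_le_tsum fun i => ENNReal.tsum_le_tsum fun j => ?_
          refine le_trans ?_ (highHigh_term_le hε hε0.le hsum hβ' hσ hσs hδ X Y τ i j k)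
          gcongr
      _ = 2 ^ (10 * s + 2) * τ * (dyadicNorm α X * dyadicNorm β Y) *
          (2 ^ (-(ε / 2))) ^ k * ∑' i, (2 ^ (-(ε / 2))) ^ i * ∑' j, nearWeight j i := by
          simp only [ENNReal.tsum_mul_left]
      _ ≤ 2 ^ (10 * s + 2) * τ * (dyadicNorm α X * dyadicNorm β Y) *
          (2 ^ (-(ε / 2))) ^ k * ∑' i, (2 ^ (-(ε / 2))) ^ i * 5 := by
          gcongr
          exact tsum_nearWeight_le _
      _ = _ := by rw [ENNReal.tsum_mul_right, ← geomMass]; ring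
  rw [pieceBound, mul_add]
  refine add_le_add ?_ hhigh
  refine le_trans (le_of_eq ?_) (add_le_add (hlow β X Y α hsum hβ)
    (hlow α Y X β (by linarith) hα))
  rw [Finset.mul_sum, ← Finset.sum_add_distrib]
  refine Finset.sum_congr rfl fun l _ => ?_
  simp only [ENNReal.tsum_mul_left]
  rw [← mul_add, ← mul_add, ← ENNReal.tsum_add]
  congr 2
  refine tsum_congr fun j => ?_
  ring

theorem exists_dyadicNorm_pieceBound_le (d : ℕ) {s : ℝ} (hs : (d : ℝ) / 2 + 2 < s) :
    ∃ C : ℝ≥0∞, C ≠ ⊤ ∧ ∀ σ δ α β T : ℝ, α + β = σ + s - 2 → σ - 1 ≤ α → σ - 1 ≤ β →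
      |β| ≤ s + 1 → 0 ≤ σ → σ ≤ s → 0 ≤ δ → δ ≤ 1 / 2 → T ≤ 1 → ∀ X Y : ℕ → ℝ≥0∞,
      dyadicNorm (σ - δ) (pieceBound d T δ X Y) ≤
        C * ENNReal.ofReal T ^ δ * dyadicNorm α X * dyadicNorm β Y := by
  set ε := s - 2 - d / 2 with hε
  have hε0 : 0 < ε := by simp only [hε]; linarith
  have hg := geomMass_ne_top hε0
  have hg' := geomMass_ne_top (half_pos hε0)
  have h2 : ∀ a : ℝ, (2 : ℝ≥0∞) ^ a ≠ ⊤ := fun a =>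
    ENNReal.rpow_ne_top_of_ne_zero two_ne_zero ENNReal.ofNat_ne_top
  -- The `10` collects the five neighbouring frequencies for each of the two low-high sums. In the
  -- high-high sum one `geomMass (ε / 2)` sums over `i`, the other bounds the `ℓ²` norm in `k`.
  refine ⟨2 ^ (2 * s + 2) * geomMass ε * 10 +
    2 ^ (10 * s + 2) * 5 * geomMass (ε / 2) * geomMass (ε / 2), ?_, ?_⟩
  · have := h2 (2 * s + 2)
    have := h2 (10 * s + 2)
    finiteness
  intro σ δ α β T hsum hα hβ hβ' hσ hσs hδ hδ' hT X Y
  set τ := ENNReal.ofReal T ^ δ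
  have hm : ∀ f : ℕ → ℝ≥0∞, AEMeasurable f Measure.count := fun f =>
    (measurable_of_countable f).aemeasurable
  set f : Fin 3 → ℕ → ℝ≥0∞ := ![
    fun k => 2 ^ (2 * s + 2) * τ * geomMass ε * dyadicNorm α X *
        (∑' j, nearWeight j k * (2 ^ ((j : ℝ) * β) * Y j)),
    fun k => 2 ^ (2 * s + 2) * τ * geomMass ε * dyadicNorm β Y *
        (∑' j, nearWeight j k * (2 ^ ((j : ℝ) * α) * X j)),
    fun k => 2 ^ (10 * s + 2) * τ * 5 * geomMass (ε / 2) *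
        (dyadicNorm α X * dyadicNorm β Y) * (2 ^ (-(ε / 2))) ^ k] with hf
  calc dyadicNorm (σ - δ) (pieceBound d T δ X Y)
      ≤ lTwo Measure.count (fun k => ∑ b, f b k) := by
        refine lTwo_mono fun k => ?_
        rw [Fin.sum_univ_three]
        exact pieceBound_le hε hε0 hsum hα hβ hβ' hσ hσs hδ hδ' hT X Y k
    _ ≤ ∑ b, lTwo Measure.count (f b) := lTwo_sum_le _ fun b => hm _
    _ ≤ 2 ^ (2 * s + 2) * τ * geomMass ε * dyadicNorm α X * (5 * dyadicNorm β Y) +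
        2 ^ (2 * s + 2) * τ * geomMass ε * dyadicNorm β Y * (5 * dyadicNorm α X) +
        2 ^ (10 * s + 2) * τ * 5 * geomMass (ε / 2) *
        (dyadicNorm α X * dyadicNorm β Y) * geomMass (ε / 2) := by
        rw [Fin.sum_univ_three]
        simp only [hf, Matrix.cons_val]
        rw [lTwo_const_mul _ (hm _), lTwo_const_mul _ (hm _), lTwo_const_mul _ (hm _)]
        gcongr
        · exact lTwo_tsum_nearWeight_le _
        · exact lTwo_tsum_nearWeight_le _
        · exact lTwo_geom_le (half_pos hε0)
    _ = _ := by ring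

/-! ### The product of two tempered distributions -/

theorem continuous_lpPiece (φ : LPCutoff d) (k : ℕ) (u : 𝓢'(Space d, ℂ)) :
    Continuous (lpPiece φ k u) := by
  rw [lpPiece_eq_multiplier]
  exact continuous_multiplier _ u

theorem integrable_lpPiece_mul_lpPiece_mul (φ : LPCutoff d) (i j : ℕ) (u v : 𝓢'(Space d, ℂ))
    (θ : 𝓢(Space d, ℂ)) : Integrable fun x => lpPiece φ i u x * lpPiece φ j v x * θ x := by
  have hc := ((continuous_lpPiece φ i u).mul (continuous_lpPiece φ j v)).mul θ.continuous
  rw [lpPiece_eq_multiplier, lpPiece_eq_multiplier] at hc ⊢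
  obtain ⟨C₁, k₁, h₁, hu⟩ := exists_norm_multiplier_le (pieceSymbol φ i) u
  obtain ⟨C₂, k₂, h₂, hv⟩ := exists_norm_multiplier_le (pieceSymbol φ j) v
  refine ((integrable_one_add_norm_pow_smul θ (k₁ + k₂)).norm.const_mul (C₁ * C₂)).mono'
    hc.aestronglyMeasurable (Eventually.of_forall fun x => ?_)
  rw [norm_mul, norm_mul, norm_smul, Real.norm_of_nonneg (by positivity), pow_add]
  calc _ ≤ (C₁ * (1 + ‖x‖) ^ k₁) * (C₂ * (1 + ‖x‖) ^ k₂) * ‖θ x‖ := by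
        gcongr
        · exact hu x
        · exact hv x
    _ = _ := by ring

/-- The pairing of `S_i u S_j v` with a test function. -/
def piecePairing (φ : LPCutoff d) (u v : 𝓢'(Space d, ℂ)) (p : ℕ × ℕ) (θ : 𝓢(Space d, ℂ)) : ℂ :=
  ∫ x, lpPiece φ p.1 u x * lpPiece φ p.2 v x * θ x

theorem norm_integral_lpPiece_mul_le (φ : LPCutoff d) {u v : 𝓢'(Space d, ℂ)} {i j : ℕ}
    {θ : 𝓢(Space d, ℂ)} {a b c : ℝ} (ha : 0 ≤ a) (hb : 0 ≤ b)
    (hu : lTwo volume (fun x => ‖lpPiece φ i u x‖ₑ) ≤ ENNReal.ofReal a)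
    (hv : lTwo volume (fun x => ‖lpPiece φ j v x‖ₑ) ≤ ENNReal.ofReal b)
    (hθ : ∀ x, ‖θ x‖ ≤ c) :
    ‖∫ x, lpPiece φ i u x * lpPiece φ j v x * θ x‖ ≤ a * b * c := by
  have hc : 0 ≤ c := (norm_nonneg _).trans (hθ 0)
  have hum : Measurable fun x => ‖lpPiece φ i u x‖ₑ := (continuous_lpPiece φ i u).measurable.enorm
  have hvm : Measurable fun x => ‖lpPiece φ j v x‖ₑ := (continuous_lpPiece φ j v).measurable.enorm
  rw [← ENNReal.ofReal_le_ofReal_iff (by positivity), ofReal_norm,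
    ENNReal.ofReal_mul (by positivity), ENNReal.ofReal_mul ha]
  calc _ ≤ ∫⁻ x, ‖lpPiece φ i u x * lpPiece φ j v x * θ x‖ₑ := enorm_integral_le_lintegral_enorm _
    _ ≤ ∫⁻ x, ‖lpPiece φ i u x‖ₑ * ‖lpPiece φ j v x‖ₑ * ENNReal.ofReal c := by
        refine lintegral_mono fun x => ?_
        rw [enorm_mul, enorm_mul, ← ofReal_norm (θ x)]
        gcongr
        exact hθ x
    _ = (∫⁻ x, ‖lpPiece φ i u x‖ₑ * ‖lpPiece φ j v x‖ₑ) * ENNReal.ofReal c := by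
        have hm : Measurable fun x => ‖lpPiece φ i u x‖ₑ * ‖lpPiece φ j v x‖ₑ := hum.mul hvm
        rw [lintegral_mul_const _ hm]
    _ ≤ _ := by
        gcongr
        exact (lintegral_mul_le_lTwo hum.aemeasurable hvm.aemeasurable).trans (by gcongr)

/-- The spectrum of the product lies at `|ξ| ~ 2^(max i j)`, so `θ` may be replaced by its part at
high frequencies, which is small to any order `M`. -/
theorem exists_norm_piecePairing_le_separated (φ : LPCutoff d) {u v : 𝓢'(Space d, ℂ)} {i j : ℕ}
    (hij : i + 3 ≤ j ∨ j + 3 ≤ i) {a b : ℝ} (ha : 0 ≤ a) (hb : 0 ≤ b)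
    (hu : lTwo volume (fun x => ‖lpPiece φ i u x‖ₑ) ≤ ENNReal.ofReal a)
    (hv : lTwo volume (fun x => ‖lpPiece φ j v x‖ₑ) ≤ ENNReal.ofReal b)
    (M : ℕ) (θ : 𝓢(Space d, ℂ)) :
    ‖piecePairing φ u v (i, j) θ‖ ≤
      a * b * ((φ.radius * 2 ^ (max i j - 3))⁻¹ ^ M * spectralMoment M θ) := by
  have key : ∀ θ' : 𝓢(Space d, ℂ), ∫ x, lpPiece φ i u x * lpPiece φ j v x * (θ - θ') x = 0 →
      piecePairing φ u v (i, j) θ = ∫ x, lpPiece φ i u x * lpPiece φ j v x * θ' x := by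
    intro θ' h
    rw [← sub_eq_zero, ← h, piecePairing, ← integral_sub
      (integrable_lpPiece_mul_lpPiece_mul φ i j u v θ)
      (integrable_lpPiece_mul_lpPiece_mul φ i j u v θ')]
    refine integral_congr_ae (Eventually.of_forall fun x => ?_)
    simp only [sub_apply]
    ring
  rcases hij with h | h
  · obtain ⟨θ', h1, h2, -⟩ := exists_integral_lpPiece_mul_eq φ h M θ
    rw [key θ' (h2 u v), max_eq_right (by omega)]
    exact norm_integral_lpPiece_mul_le φ ha hb hu hv h1
  · obtain ⟨θ', h1, -, h2⟩ := exists_integral_lpPiece_mul_eq φ h M θ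
    rw [key θ' (h2 u v), max_eq_left (by omega)]
    exact norm_integral_lpPiece_mul_le φ ha hb hu hv h1

/-- The series of the pairings of the pieces of `u` and `v` converges absolutely. -/
def PiecewiseSummable (φ : LPCutoff d) (u v : 𝓢'(Space d, ℂ)) : Prop :=
  ∃ (M : ℕ) (b : ℕ × ℕ → ℝ), Summable b ∧
    ∀ p θ, ‖piecePairing φ u v p θ‖ ≤ b p * (spectralMoment 0 θ + spectralMoment M θ)

theorem near_exponent_le {α β η i j : ℝ} (hαβ : 0 < α + β) (hη : η ≤ (α + β) / 2) (hi : 0 ≤ i) (hj : 0 ≤ j)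
    (hij : i ≤ j + 2) (hji : j ≤ i + 2) :
    -(i * α) - j * β ≤ 2 * |β| + (α + β) + -η * i + -η * j := by
  have h1 : (i - j) * β ≤ 2 * |β| := by
    refine (le_abs_self _).trans ?_
    rw [abs_mul]
    gcongr
    exact abs_le.2 ⟨by linarith, by linarith⟩
  have h2 : 0 ≤ ((α + β) / 2 - η) * (i + j) := mul_nonneg (by linarith) (by linarith)
  have h3 : 0 ≤ (α + β) * (i + 2 - j) := mul_nonneg hαβ.le (by linarith)
  nlinarith

theorem separated_exponent_le {α β η i j m M : ℝ} (hη : η ≤ 1) (hi : 0 ≤ i) (hj : 0 ≤ j)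
    (him : i ≤ m) (hjm : j ≤ m) (hM : |α| + |β| + 2 ≤ M) :
    -(i * α) - j * β + -(m - 3) * M ≤ 3 * M + -η * i + -η * j := by
  have h1 : -(i * α) ≤ m * |α| := by
    have := neg_abs_le α
    nlinarith [abs_nonneg α]
  have h2 : -(j * β) ≤ m * |β| := by
    have := neg_abs_le β
    nlinarith [abs_nonneg β]
  nlinarith

/-- Either of `α`, `β` may be negative. Separated pairs are summable for any exponents, thanks to
the smoothness of `θ`; only the near-diagonal pairs use `α + β > 0`. -/
theorem piecewiseSummable_of_decay (φ : LPCutoff d) {u v : 𝓢'(Space d, ℂ)} {α β A B : ℝ}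
    (hαβ : 0 < α + β) (hA : 0 ≤ A) (hB : 0 ≤ B)
    (hu : ∀ i : ℕ, lTwo volume (fun x => ‖lpPiece φ i u x‖ₑ) ≤
      ENNReal.ofReal (2 ^ (-((i : ℝ) * α)) * A))
    (hv : ∀ j : ℕ, lTwo volume (fun x => ‖lpPiece φ j v x‖ₑ) ≤
      ENNReal.ofReal (2 ^ (-((j : ℝ) * β)) * B)) : PiecewiseSummable φ u v := by
  have hr := φ.radius_pos
  -- The part `|α| + |β|` compensates the possible growth of the pieces; the remaining `2` gives
  -- decay in `i + j ≤ 2 max i j`.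
  set M := ⌈|α| + |β| + 2⌉₊ with hMdef
  have hM : |α| + |β| + 2 ≤ M := Nat.le_ceil _
  -- A common rate: `1` is admissible for separated pairs and `(α + β)/2` for near-diagonal ones.
  set η := min 1 ((α + β) / 2) with hηdef
  have hη : 0 < η := lt_min one_pos (by linarith)
  have hη1 : η ≤ 1 := min_le_left _ _
  have hη2 : η ≤ (α + β) / 2 := min_le_right _ _
  set q : ℝ := 2 ^ (-η) with hq
  have hq0 : 0 ≤ q := by positivity
  have hq1 : q < 1 := Real.rpow_lt_one_of_one_lt_of_neg one_lt_two (by linarith)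
  have hqp : ∀ n : ℕ, q ^ n = 2 ^ (-η * n) := fun n => by
    rw [hq, ← Real.rpow_natCast, ← Real.rpow_mul zero_le_two]
  set K₁ : ℝ := 2 ^ (2 * |β| + (α + β)) with hK₁
  set K₂ : ℝ := φ.radius⁻¹ ^ M * 2 ^ (3 * (M : ℝ)) with hK₂
  have hK₁0 : 0 ≤ K₁ := by positivity
  have hK₂0 : 0 ≤ K₂ := by positivity
  refine ⟨M, fun p => A * B * (K₁ + K₂) * (q ^ p.1 * q ^ p.2), ?_, ?_⟩
  · have hs := summable_geometric_of_lt_one hq0 hq1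
    exact (hs.mul_of_nonneg hs (fun n => pow_nonneg hq0 n) fun n => pow_nonneg hq0 n).mul_left _
  rintro ⟨i, j⟩ θ
  have h0 := spectralMoment_nonneg 0 θ
  have hM0 := spectralMoment_nonneg M θ
  dsimp only
  by_cases hij : i + 3 ≤ j ∨ j + 3 ≤ i
  · refine (exists_norm_piecePairing_le_separated φ hij (by positivity) (by positivity) (hu i)
      (hv j) M θ).trans ?_
    have h3 : 3 ≤ max i j := by omega
    have e : (φ.radius * 2 ^ (max i j - 3))⁻¹ ^ M =
        φ.radius⁻¹ ^ M * 2 ^ (-((max i j : ℕ) - 3 : ℝ) * M) := by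
      rw [mul_inv, mul_pow, Real.rpow_mul zero_le_two, Real.rpow_natCast,
        Real.rpow_neg zero_le_two, ← Real.rpow_natCast 2 (max i j - 3), Nat.cast_sub h3]
      norm_num
    have hi : (i : ℝ) ≤ (max i j : ℕ) := by exact_mod_cast le_max_left i j
    have hj : (j : ℝ) ≤ (max i j : ℕ) := by exact_mod_cast le_max_right i j
    have key := separated_exponent_le hη1 (Nat.cast_nonneg i) (Nat.cast_nonneg j) hi hj hM
    calc _ = A * B * φ.radius⁻¹ ^ M * (2 ^ (-((i : ℝ) * α)) * 2 ^ (-((j : ℝ) * β)) *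
          2 ^ (-((max i j : ℕ) - 3 : ℝ) * M)) * spectralMoment M θ := by rw [e]; ring
      _ ≤ A * B * φ.radius⁻¹ ^ M * (2 ^ (3 * (M : ℝ)) * 2 ^ (-η * i) * 2 ^ (-η * j)) *
          spectralMoment M θ := by
          simp only [← Real.rpow_add (zero_lt_two' ℝ)]
          refine mul_le_mul_of_nonneg_right (mul_le_mul_of_nonneg_left
            (Real.rpow_le_rpow_of_exponent_le one_le_two ?_) (by positivity)) hM0
          linarith
      _ = A * B * K₂ * (q ^ i * q ^ j) * spectralMoment M θ := by rw [hqp, hqp]; ring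
      _ ≤ _ := by gcongr <;> linarith
  · have hi : (i : ℝ) ≤ j + 2 := by exact_mod_cast (by omega : i ≤ j + 2)
    have hj : (j : ℝ) ≤ i + 2 := by exact_mod_cast (by omega : j ≤ i + 2)
    have key := near_exponent_le hαβ hη2 (Nat.cast_nonneg i) (Nat.cast_nonneg j) hi hj
    refine (norm_integral_lpPiece_mul_le φ (by positivity) (by positivity) (hu i) (hv j)
      (norm_le_spectralMoment_zero θ)).trans ?_
    calc _ = A * B * (2 ^ (-((i : ℝ) * α)) * 2 ^ (-((j : ℝ) * β))) * spectralMoment 0 θ := by ring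
      _ ≤ A * B * (K₁ * 2 ^ (-η * i) * 2 ^ (-η * j)) * spectralMoment 0 θ := by
          simp only [hK₁, ← Real.rpow_add (zero_lt_two' ℝ)]
          refine mul_le_mul_of_nonneg_right (mul_le_mul_of_nonneg_left
            (Real.rpow_le_rpow_of_exponent_le one_le_two ?_) (by positivity)) h0
          linarith
      _ = A * B * K₁ * (q ^ i * q ^ j) * spectralMoment 0 θ := by rw [hqp, hqp]; ring
      _ ≤ _ := by gcongr <;> linarith

theorem PiecewiseSummable.summable {φ : LPCutoff d} {u v : 𝓢'(Space d, ℂ)}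
    (h : PiecewiseSummable φ u v) (θ : 𝓢(Space d, ℂ)) :
    Summable fun p => piecePairing φ u v p θ := by
  obtain ⟨M, b, hb, hle⟩ := h
  exact (hb.mul_right _).of_norm_bounded fun p => hle p θ

theorem PiecewiseSummable.exists_seminorm_bound {φ : LPCutoff d} {u v : 𝓢'(Space d, ℂ)}
    (h : PiecewiseSummable φ u v) : ∃ (s : Finset (ℕ × ℕ)) (C : ℝ), 0 ≤ C ∧
      ∀ θ : 𝓢(Space d, ℂ), ‖∑' p, piecePairing φ u v p θ‖ ≤
        C * s.sup (schwartzSeminormFamily ℂ (Space d) ℂ) θ := by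
  classical
  obtain ⟨M, b, hb, hle⟩ := h
  obtain ⟨s₀, C₀, hC₀, h₀⟩ := exists_spectralMoment_le (d := d) 0
  obtain ⟨s₁, C₁, hC₁, h₁⟩ := exists_spectralMoment_le (d := d) M
  have hB : 0 ≤ ∑' p, |b p| := tsum_nonneg fun p => abs_nonneg _
  refine ⟨s₀ ∪ s₁, (∑' p, |b p|) * (C₀ + C₁), by positivity, fun θ => ?_⟩
  have hmono : ∀ t ⊆ s₀ ∪ s₁, t.sup (schwartzSeminormFamily ℂ (Space d) ℂ) θ ≤
      (s₀ ∪ s₁).sup (schwartzSeminormFamily ℂ (Space d) ℂ) θ := fun t ht =>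
    (Finset.sup_mono ht : t.sup (schwartzSeminormFamily ℂ (Space d) ℂ) ≤ _) θ
  have h0 := spectralMoment_nonneg 0 θ
  have hM0 := spectralMoment_nonneg M θ
  calc _ ≤ ∑' p, |b p| * (spectralMoment 0 θ + spectralMoment M θ) :=
        tsum_of_norm_bounded (hb.abs.mul_right _).hasSum fun p => (hle p θ).trans (by
          gcongr
          exact le_abs_self _)
    _ = (∑' p, |b p|) * (spectralMoment 0 θ + spectralMoment M θ) := tsum_mul_right
    _ ≤ (∑' p, |b p|) * (C₀ * (s₀ ∪ s₁).sup (schwartzSeminormFamily ℂ (Space d) ℂ) θ +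
          C₁ * (s₀ ∪ s₁).sup (schwartzSeminormFamily ℂ (Space d) ℂ) θ) := by
        gcongr
        · refine (h₀ θ).trans ?_
          gcongr
          exact hmono _ Finset.subset_union_left
        · refine (h₁ θ).trans ?_
          gcongr
          exact hmono _ Finset.subset_union_right
    _ = _ := by ring

theorem piecePairing_add (φ : LPCutoff d) (u v : 𝓢'(Space d, ℂ)) (p : ℕ × ℕ)
    (θ θ' : 𝓢(Space d, ℂ)) :
    piecePairing φ u v p (θ + θ') = piecePairing φ u v p θ + piecePairing φ u v p θ' := by
  rw [piecePairing, piecePairing, piecePairing, ← integral_add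
    (integrable_lpPiece_mul_lpPiece_mul φ _ _ u v θ)
    (integrable_lpPiece_mul_lpPiece_mul φ _ _ u v θ')]
  simp only [add_apply, mul_add]

theorem piecePairing_smul (φ : LPCutoff d) (u v : 𝓢'(Space d, ℂ)) (p : ℕ × ℕ) (c : ℂ)
    (θ : 𝓢(Space d, ℂ)) : piecePairing φ u v p (c • θ) = c * piecePairing φ u v p θ := by
  rw [piecePairing, piecePairing, ← integral_const_mul]
  congr 1
  ext x
  simp only [smul_apply, smul_eq_mul]
  ring

open Classical in
/-- The functional `θ ↦ ∑_{i,j} ∫ S_i u S_j v θ`. -/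
def pieceProductCLM (φ : LPCutoff d) (u v : 𝓢'(Space d, ℂ)) : 𝓢(Space d, ℂ) →L[ℂ] ℂ :=
  if h : PiecewiseSummable φ u v then
    SchwartzMap.mkCLMtoNormedSpace (σ := RingHom.id ℂ) (fun θ => ∑' p, piecePairing φ u v p θ)
      (fun θ θ' => by
        simp only [piecePairing_add]
        exact (h.summable θ).tsum_add (h.summable θ'))
      (fun c θ => by
        simp only [piecePairing_smul, tsum_mul_left]
        rfl)
      h.exists_seminorm_bound
  else 0

/-- The product of `u` and `v`, as the sum of the products of their pieces. -/
def pieceProduct (φ : LPCutoff d) (u v : 𝓢'(Space d, ℂ)) : 𝓢'(Space d, ℂ) :=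
  pieceProductCLM φ u v

theorem pieceProduct_apply {φ : LPCutoff d} {u v : 𝓢'(Space d, ℂ)} (h : PiecewiseSummable φ u v)
    (θ : 𝓢(Space d, ℂ)) : pieceProduct φ u v θ = ∑' p, piecePairing φ u v p θ := by
  have e : pieceProductCLM φ u v θ = ∑' p, piecePairing φ u v p θ := by
    rw [pieceProductCLM, dif_pos h]
    rfl
  exact e

theorem tendsto_range_product :
    Tendsto (fun N : ℕ => Finset.range N ×ˢ Finset.range N) atTop atTop := by
  refine tendsto_atTop_finset_of_monotone (fun m n h => Finset.product_subset_product
    (Finset.range_mono h) (Finset.range_mono h)) fun p => ⟨max p.1 p.2 + 1, ?_⟩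
  simp only [Finset.mem_product, Finset.mem_range]
  omega

/-- The product `S_{≤N} u S_{≤N} v` is the partial sum over a square of indices, and the squares
exhaust `ℕ × ℕ`; the series of pairings converges absolutely. -/
theorem isProduct_pieceProduct {φ : LPCutoff d} {u v : 𝓢'(Space d, ℂ)}
    (h : PiecewiseSummable φ u v) : IsProduct φ u v (pieceProduct φ u v) := by
  intro θ
  rw [pieceProduct_apply h]
  -- The shift accounts for the `N + 1` pieces in `S_{≤N}`.
  have h1 := ((h.summable θ).hasSum.comp tendsto_range_product).comp (tendsto_add_atTop_nat 1)
  refine h1.congr fun N => ?_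
  simp only [Function.comp_apply, piecePairing]
  rw [← integral_finsetSum _ fun p _ => integrable_lpPiece_mul_lpPiece_mul φ p.1 p.2 u v θ]
  congr 1
  ext x
  rw [lpLow_eq_sum, lpLow_eq_sum, Finset.sum_mul_sum, ← Finset.sum_product', Finset.sum_mul]

/-- Test the series against the kernel of `S_k` centred at `x`: non-interacting pairs vanish by
orthogonality, the others are estimated by the decay of the kernel. -/
theorem exists_enorm_lpPiece_pieceProduct_le (φ : LPCutoff d) :
    ∃ C : ℝ≥0∞, C ≠ ⊤ ∧ ∀ (u v : 𝓢'(Space d, ℂ)), PiecewiseSummable φ u v →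
      ∀ (k : ℕ) (x : Space d), ‖lpPiece φ k (pieceProduct φ u v) x‖ₑ ≤
        C * ∫⁻ y, decayKernel d (decayOrder d) k (y - x) *
          ∑' i, ∑' j, interactionWeight i j k * (‖lpPiece φ i u y‖ₑ * ‖lpPiece φ j v y‖ₑ) := by
  obtain ⟨C, hC, hK⟩ := exists_enorm_fourier_pieceSymbol_le φ (decayOrder d)
  refine ⟨C, hC, fun u v h k x => ?_⟩
  have hm : ∀ i j, Measurable fun y => decayKernel d (decayOrder d) k (y - x) *
      (interactionWeight i j k * (‖lpPiece φ i u y‖ₑ * ‖lpPiece φ j v y‖ₑ)) := fun i j =>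
    ((measurable_decayKernel d _ k).comp (measurable_id.sub_const x)).mul
      (((continuous_lpPiece φ i u).measurable.enorm.mul
        (continuous_lpPiece φ j v).measurable.enorm).const_mul _)
  have hterm : ∀ i j, ‖piecePairing φ u v (i, j)
      ((𝓕 (pieceSymbol φ k) : 𝓢(Space d, ℂ)).compSubConstCLM ℂ x)‖ₑ ≤
      C * ∫⁻ y, decayKernel d (decayOrder d) k (y - x) *
        (interactionWeight i j k * (‖lpPiece φ i u y‖ₑ * ‖lpPiece φ j v y‖ₑ)) := by
    intro i j
    by_cases hint : Interacting i j k
    · rw [← lintegral_const_mul _ (hm i j)]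
      refine (enorm_integral_le_lintegral_enorm _).trans (lintegral_mono fun y => ?_)
      rw [enorm_mul, enorm_mul, interactionWeight, if_pos hint, one_mul, ← mul_assoc, mul_comm]
      gcongr
      exact hK k (y - x)
    · rw [piecePairing, integral_lpPiece_mul_lpPiece_mul_eq_zero φ hint u v x]
      simp
  rw [lpPiece_eq_multiplier, multiplier, pieceProduct_apply h]
  refine enorm_tsum_le_tsum_enorm.trans ?_
  rw [ENNReal.tsum_prod (f := fun i j => ‖piecePairing φ u v (i, j)
    ((𝓕 (pieceSymbol φ k) : 𝓢(Space d, ℂ)).compSubConstCLM ℂ x)‖ₑ)]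
  refine (ENNReal.tsum_le_tsum fun i => ENNReal.tsum_le_tsum fun j => hterm i j).trans ?_
  simp only [ENNReal.tsum_mul_left]
  gcongr
  simp only [← ENNReal.tsum_mul_left]
  rw [lintegral_tsum fun i => (Measurable.tsum (hm i)).aemeasurable]
  refine ENNReal.tsum_le_tsum fun i => ?_
  rw [lintegral_tsum fun j => (hm i j).aemeasurable]

/-! ### Measurability in time and the product estimate -/

theorem lpPiece_zero_right (φ : LPCutoff d) (k : ℕ) (x : Space d) : lpPiece φ k 0 x = 0 := by
  rw [lpPiece_eq_multiplier]
  rfl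

/-- Weak measurability gives measurability in `t` for each `x` up to null sets. A countable dense
set of points needs only one null set, off which continuity in `x` yields joint measurability; on
the null set the distribution is set to zero. -/
theorem exists_measurable_modification (φ : LPCutoff d) {T : ℝ} {u : ℝ → 𝓢'(Space d, ℂ)}
    (hu : WeaklyMeasurable T u) :
    ∃ G ∈ ae (timeMeasure T), MeasurableSet G ∧
      ∀ j, Measurable (spaceTimePiece φ j (G.indicator u)) := by
  have hA : ∀ j (x : Space d), AEMeasurable (fun t => lpPiece φ j (u t) x) (timeMeasure T) := by
    intro j x
    simp only [lpPiece_eq_multiplier, multiplier]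
    exact hu _
  have hae : ∀ᵐ t ∂timeMeasure T, ∀ j n, lpPiece φ j (u t) (TopologicalSpace.denseSeq (Space d) n) =
      (hA j (TopologicalSpace.denseSeq (Space d) n)).mk _ t :=
    ae_all_iff.2 fun j => ae_all_iff.2 fun n => (hA j _).ae_eq_mk
  obtain ⟨G, hG, hGm, h⟩ := hae.exists_measurable_mem
  refine ⟨G, hG, hGm, fun j => ?_⟩
  have h1 : ∀ n, Measurable fun t => lpPiece φ j (G.indicator u t) (TopologicalSpace.denseSeq (Space d) n) := by
    intro n
    have hm := (hA j (TopologicalSpace.denseSeq (Space d) n)).measurable_mk.indicator hGm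
    convert hm using 1
    ext t
    by_cases ht : t ∈ G
    · rw [Set.indicator_of_mem ht, Set.indicator_of_mem ht, h t ht]
    · rw [Set.indicator_of_notMem ht, Set.indicator_of_notMem ht, lpPiece_zero_right]
  have h2 : ∀ x, Measurable fun t => lpPiece φ j (G.indicator u t) x := by
    intro x
    obtain ⟨y, hy, hlim⟩ := mem_closure_iff_seq_limit.1 (TopologicalSpace.denseRange_denseSeq (Space d) x)
    choose n hn using hy
    refine measurable_of_tendsto_metrizable (f := fun k t => lpPiece φ j (G.indicator u t) (y k))
      (fun k => ?_) (tendsto_pi_nhds.2 fun t =>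
        ((continuous_lpPiece φ j _).tendsto x).comp hlim)
    rw [← hn k]
    exact h1 (n k)
  exact (measurable_uncurry_of_continuous_of_measurable (u := fun x t =>
    lpPiece φ j (G.indicator u t) x) (fun t => continuous_lpPiece φ j _) h2).comp measurable_swap

theorem measurable_piecePairing {Ω : Type*} [MeasurableSpace Ω] (φ : LPCutoff d)
    {u v : ℝ → 𝓢'(Space d, ℂ)} (hu : ∀ j, Measurable (spaceTimePiece φ j u))
    (hv : ∀ j, Measurable (spaceTimePiece φ j v)) {τ : Ω → ℝ} (hτ : Measurable τ)
    {θ : Ω → 𝓢(Space d, ℂ)} (hθ : Measurable fun q : Ω × Space d => θ q.1 q.2) (p : ℕ × ℕ) :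
    Measurable fun z => piecePairing φ (u (τ z)) (v (τ z)) p (θ z) := by
  have hp : Measurable fun q : Ω × Space d => (τ q.1, q.2) :=
    (hτ.comp measurable_fst).prodMk measurable_snd
  have h := (((hu p.1).comp hp).mul ((hv p.2).comp hp)).mul hθ
  exact (StronglyMeasurable.integral_prod_right (ν := (volume : Measure (Space d)))
    (f := fun z x => lpPiece φ p.1 (u (τ z)) x * lpPiece φ p.2 (v (τ z)) x * θ z x)
    h.stronglyMeasurable).measurable

/-- The parameter space serves two purposes: a fixed `θ` gives weak measurability of the product in
time, and translated kernels give joint measurability of its Littlewood-Paley pieces. -/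
theorem measurable_pieceProduct_apply {Ω : Type*} [MeasurableSpace Ω] (φ : LPCutoff d)
    {u v : ℝ → 𝓢'(Space d, ℂ)} (hu : ∀ j, Measurable (spaceTimePiece φ j u))
    (hv : ∀ j, Measurable (spaceTimePiece φ j v)) {G : Set ℝ} (hG : MeasurableSet G)
    (hs : ∀ t ∈ G, PiecewiseSummable φ (u t) (v t)) {τ : Ω → ℝ} (hτ : Measurable τ)
    {θ : Ω → 𝓢(Space d, ℂ)} (hθ : Measurable fun q : Ω × Space d => θ q.1 q.2) :
    Measurable fun z => G.indicator (fun t => pieceProduct φ (u t) (v t)) (τ z) (θ z) := by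
  refine measurable_of_tendsto_metrizable (f := fun N : ℕ => (τ ⁻¹' G).indicator fun z =>
    ∑ p ∈ Finset.range N ×ˢ Finset.range N, piecePairing φ (u (τ z)) (v (τ z)) p (θ z))
    (fun N => (Finset.measurable_fun_sum _ fun p _ =>
      measurable_piecePairing φ hu hv hτ hθ p).indicator (hτ hG)) (tendsto_pi_nhds.2 fun z => ?_)
  by_cases hz : τ z ∈ G
  · simp only [Set.indicator_of_mem hz, Set.indicator_of_mem (Set.mem_preimage.2 hz)]
    rw [pieceProduct_apply (hs _ hz)]
    exact ((hs _ hz).summable _).hasSum.comp tendsto_range_product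
  · simp only [Set.indicator_of_notMem hz, Set.indicator_of_notMem (mt Set.mem_preimage.1 hz)]
    exact tendsto_const_nhds

theorem measurable_spaceTimePiece_pieceProduct (φ : LPCutoff d)
    {u v : ℝ → 𝓢'(Space d, ℂ)} (hu : ∀ j, Measurable (spaceTimePiece φ j u))
    (hv : ∀ j, Measurable (spaceTimePiece φ j v)) {G : Set ℝ} (hG : MeasurableSet G)
    (hs : ∀ t ∈ G, PiecewiseSummable φ (u t) (v t)) (k : ℕ) :
    Measurable (spaceTimePiece φ k (G.indicator fun t => pieceProduct φ (u t) (v t))) := by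
  have h := measurable_pieceProduct_apply φ hu hv hG hs (τ := fun p : ℝ × Space d => p.1)
    measurable_fst
    (θ := fun p => (𝓕 (pieceSymbol φ k) : 𝓢(Space d, ℂ)).compSubConstCLM ℂ p.2) (by
      have hc : Continuous fun q : (ℝ × Space d) × Space d =>
          𝓕 (pieceSymbol φ k) (q.2 - q.1.2) :=
        (𝓕 (pieceSymbol φ k) : 𝓢(Space d, ℂ)).continuous.comp (by fun_prop)
      exact hc.measurable)
  have e : ∀ f : 𝓢'(Space d, ℂ), lpPiece φ k f = multiplier (pieceSymbol φ k) f :=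
    lpPiece_eq_multiplier φ k
  convert h using 1
  ext p
  rw [spaceTimePiece, e]
  rfl

theorem normXj_congr {T : ℝ} (j : ℕ) {F H : ℝ × Space d → ℂ}
    (h : ∀ᵐ t ∂timeMeasure T, ∀ x, F (t, x) = H (t, x)) : normXj T j F = normXj T j H := by
  have h1 : normX T F = normX T H := by
    refine iSup_congr fun l => iSup_congr fun n => ?_
    rw [eLpNorm_congr_ae]
    have h2 := Measure.quasiMeasurePreserving_fst
      (μ := timeMeasure T) (ν := volume.restrict (cube (d := d) l n)) |>.ae h
    exact h2.mono fun p hp => hp p.2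
  have h2 : normLinftyL2 T F = normLinftyL2 T H :=
    essSup_congr_ae (h.mono fun t ht => by simp only [ht])
  rw [normXj, normXj, h1, h2]

theorem normL1j_normXj_congr (χ : CubePartition d) {T : ℝ} (j : ℕ) {F H : ℝ × Space d → ℂ}
    (h : ∀ᵐ t ∂timeMeasure T, ∀ x, F (t, x) = H (t, x)) :
    normL1j χ j (normXj T j) F = normL1j χ j (normXj T j) H :=
  tsum_congr fun n => normXj_congr j (h.mono fun t ht x => by
    simp only [CubePartition.localize, ht])

theorem normL1X_eq_dyadicNorm (φ : LPCutoff d) (χ : CubePartition d) (T s : ℝ)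
    {G : Set ℝ} (hG : G ∈ ae (timeMeasure T)) (u : ℝ → 𝓢'(Space d, ℂ)) :
    normL1X φ χ T s u = dyadicNorm s fun i =>
      normL1j χ i (normXj T i) (spaceTimePiece φ i (G.indicator u)) := by
  rw [dyadicNorm_eq, normL1X]
  congr 1
  refine tsum_congr fun j => ?_
  rw [normL1j_normXj_congr χ j]
  filter_upwards [hG] with t ht x
  rw [spaceTimePiece, spaceTimePiece, Set.indicator_of_mem ht]

/-- The reproducing kernel lives at frequency `2^(i+1)`; comparison with frequency `2^i` costs the
factor `2^d`. -/
theorem exists_selfReproducing (φ : LPCutoff d) : ∃ C : ℝ≥0∞, C ≠ ⊤ ∧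
    ∀ (u : ℝ → 𝓢'(Space d, ℂ)) (i : ℕ), SelfReproducing C i (spaceTimePiece φ i u) := by
  obtain ⟨C, hC, h⟩ := exists_enorm_fourier_dilate_le φ (decayOrder d)
  refine ⟨C * 2 ^ d, by finiteness, fun u i q => ?_⟩
  have hm : Measurable fun y => decayKernel d (decayOrder d) i (y - q.2) *
      ‖lpPiece φ i (u q.1) y‖ₑ :=
    ((measurable_decayKernel d _ i).comp (measurable_id.sub_const _)).mul
      (continuous_lpPiece φ i _).measurable.enorm
  rw [spaceTimePiece, ← lpPiece_reproducing]
  refine (enorm_integral_le_lintegral_enorm _).trans ?_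
  simp only [kernelConv, spaceTimePiece]
  rw [← lintegral_const_mul _ hm]
  refine lintegral_mono fun y => ?_
  rw [enorm_mul, ← mul_assoc]
  gcongr
  calc _ ≤ C * decayKernel d (decayOrder d) (i + 1) (y - q.2) := h _ _
    _ ≤ C * (2 ^ d * decayKernel d (decayOrder d) i (y - q.2)) := by
        gcongr
        exact decayKernel_succ_le _ _ _
    _ = _ := (mul_assoc _ _ _).symm

theorem SelfReproducing.mono {C C' : ℝ≥0∞} (hC : C ≤ C') {i : ℕ} {F : ℝ × Space d → ℂ}
    (h : SelfReproducing C i F) : SelfReproducing C' i F := fun q =>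
  (h q).trans (by gcongr)

theorem ae_lTwo_lpPiece_le (φ : LPCutoff d) (χ : CubePartition d) {T α : ℝ}
    {u : ℝ → 𝓢'(Space d, ℂ)} (hu : ∀ j, Measurable (spaceTimePiece φ j u))
    {A : ℝ≥0∞} (hA : A ≠ ⊤)
    (h : dyadicNorm α (fun i => normL1j χ i (normXj T i) (spaceTimePiece φ i u)) ≤ A) :
    ∀ᵐ t ∂timeMeasure T, ∀ i : ℕ, lTwo volume (fun x => ‖lpPiece φ i (u t) x‖ₑ) ≤
      ENNReal.ofReal (2 ^ (-((i : ℝ) * α)) * A.toReal) := by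
  refine ae_all_iff.2 fun i => ?_
  filter_upwards [ae_lTwo_le_normL1j χ T i (hu i)] with t ht
  refine ht.trans ((le_dyadicNorm α
    (fun i => normL1j χ i (normXj T i) (spaceTimePiece φ i u)) i).trans ?_)
  rw [ENNReal.ofReal_mul (by positivity), ENNReal.ofReal_toReal hA,
    ← ENNReal.ofReal_rpow_of_pos zero_lt_two, ENNReal.ofReal_ofNat]
  gcongr

/-- The common form of both parts. Only `α + β` and the lower bounds `α, β ≥ σ - 1` matter, the
latter because either distribution may carry the high frequency; `|β| ≤ s + 1` keeps the constant
uniform. -/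
theorem exists_product_estimate (φ : LPCutoff d) (χ : CubePartition d) {s : ℝ}
    (hs : (d : ℝ) / 2 + 2 < s) :
    ∃ C : ℝ≥0∞, C ≠ ⊤ ∧ ∀ σ δ α β T : ℝ, α + β = σ + s - 2 → σ - 1 ≤ α → σ - 1 ≤ β →
      |β| ≤ s + 1 → 0 ≤ σ → σ ≤ s → 0 ≤ δ → δ ≤ 1 / 2 → T ≤ 1 → ∀ u v : ℝ → 𝓢'(Space d, ℂ),
      MemL1X φ χ T α u → MemL1X φ χ T β v →
      ∃ w : ℝ → 𝓢'(Space d, ℂ), IsProductOn φ T u v w ∧ WeaklyMeasurable T w ∧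
        normL1Y φ χ T (σ - δ) w ≤
          C * ENNReal.ofReal T ^ δ * normL1X φ χ T α u * normL1X φ χ T β v := by
  obtain ⟨C₁, hC₁, hrep⟩ := exists_selfReproducing φ
  obtain ⟨C₂, hC₂, hprod⟩ := exists_enorm_lpPiece_pieceProduct_le φ
  obtain ⟨C₃, hC₃, hpiece⟩ := exists_normL1j_normYj_le_pieceBound χ
    (C₀ := C₁ + C₂) (by finiteness)
  obtain ⟨C₄, hC₄, hsumm⟩ := exists_dyadicNorm_pieceBound_le d hs
  refine ⟨C₃ * C₄, by finiteness, ?_⟩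
  intro σ δ α β T hsum hα hβ hβ' hσ hσs hδ hδ' hT u v hu hv
  -- Here `α + β ≥ s - 2 > d/2`.
  have hαβ : 0 < α + β := by
    have : (0 : ℝ) ≤ d := Nat.cast_nonneg d
    linarith
  obtain ⟨Gu, hGu, -, hum⟩ := exists_measurable_modification φ hu.1
  obtain ⟨Gv, hGv, -, hvm⟩ := exists_measurable_modification φ hv.1
  have hXu := normL1X_eq_dyadicNorm φ χ T α hGu u
  have hXv := normL1X_eq_dyadicNorm φ χ T β hGv v
  set u' := Gu.indicator u with hu'
  set v' := Gv.indicator v with hv'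
  have hgood : ∀ᵐ t ∂timeMeasure T, t ∈ Gu ∧ t ∈ Gv ∧ PiecewiseSummable φ (u' t) (v' t) := by
    filter_upwards [hGu, hGv, ae_lTwo_lpPiece_le φ χ hum hu.2.ne hXu.ge,
      ae_lTwo_lpPiece_le φ χ hvm hv.2.ne hXv.ge] with t h1 h2 h3 h4
    exact ⟨h1, h2, piecewiseSummable_of_decay φ hαβ ENNReal.toReal_nonneg ENNReal.toReal_nonneg
      h3 h4⟩
  obtain ⟨G, hG, hGm, hGs⟩ := hgood.exists_measurable_mem
  have hs' : ∀ t ∈ G, PiecewiseSummable φ (u' t) (v' t) := fun t ht => (hGs t ht).2.2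
  -- Off the set of good times, which is null, the product is set to zero; there the pointwise bound
  -- below is trivial.
  set w := G.indicator fun t => pieceProduct φ (u' t) (v' t) with hw
  refine ⟨w, ?_, ?_, ?_⟩
  · filter_upwards [hG] with t ht
    have h := isProduct_pieceProduct (hs' t ht)
    rw [hw, Set.indicator_of_mem ht]
    rwa [hu', hv', Set.indicator_of_mem (hGs t ht).1, Set.indicator_of_mem (hGs t ht).2.1] at h ⊢
  · intro θ
    exact (measurable_pieceProduct_apply φ hum hvm hGm hs' measurable_id (θ := fun _ => θ)
      (θ.continuous.measurable.comp measurable_snd)).aemeasurable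
  · have hbound : ∀ k q, ‖spaceTimePiece φ k w q‖ₑ ≤ (C₁ + C₂) * kernelConv (decayOrder d) k
        (fun p => ∑' i, ∑' j, interactionWeight i j k *
          (‖spaceTimePiece φ i u' p‖ₑ * ‖spaceTimePiece φ j v' p‖ₑ)) q := by
      intro k q
      by_cases hq : q.1 ∈ G
      · rw [spaceTimePiece, hw, Set.indicator_of_mem hq]
        refine (hprod _ _ (hs' _ hq) k q.2).trans ?_
        simp only [kernelConv, spaceTimePiece]
        gcongr
        exact le_add_self
      · rw [spaceTimePiece, hw, Set.indicator_of_notMem hq, lpPiece_zero_right, enorm_zero]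
        exact bot_le
    have hk : ∀ k, normL1j χ k (normYj T k) (spaceTimePiece φ k w) ≤ C₃ * pieceBound d T δ
        (fun i => normL1j χ i (normXj T i) (spaceTimePiece φ i u'))
        (fun i => normL1j χ i (normXj T i) (spaceTimePiece φ i v')) k := fun k =>
      hpiece T δ hδ hδ' _ _ hum hvm (fun i => (hrep u' i).mono le_self_add)
        (fun i => (hrep v' i).mono le_self_add) k _
        (measurable_spaceTimePiece_pieceProduct φ hum hvm hGm hs' k) (hbound k)
    have e : normL1Y φ χ T (σ - δ) w = dyadicNorm (σ - δ) fun k =>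
        normL1j χ k (normYj T k) (spaceTimePiece φ k w) := (dyadicNorm_eq _ _).symm
    rw [e, hXu, hXv]
    calc _ ≤ C₃ * dyadicNorm (σ - δ) (pieceBound d T δ
          (fun i => normL1j χ i (normXj T i) (spaceTimePiece φ i u'))
          (fun i => normL1j χ i (normXj T i) (spaceTimePiece φ i v'))) := by
          rw [dyadicNorm, dyadicNorm, ← lTwo_const_mul _ (measurable_of_countable _).aemeasurable]
          refine lTwo_mono fun k => ?_
          rw [mul_left_comm]
          gcongr
          exact hk k
      _ ≤ C₃ * (C₄ * ENNReal.ofReal T ^ δ * _ * _) := by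
          gcongr
          exact hsumm σ δ α β T hsum hα hβ hβ' hσ hσs hδ hδ' hT _ _
      _ = _ := by ring

end LocalEnergy

end

theorem mainTheorem9 {d : ℕ} (hd : 1 ≤ d) (φ : LPCutoff d) (χ : CubePartition d)
    (s : ℝ) (hs : (d : ℝ) / 2 + 2 < s) :
    ∃ δ₀ : ℝ, 0 < δ₀ ∧ ∃ C : ℝ, 0 < C ∧
      ∀ δ : ℝ, 0 ≤ δ → δ ≤ δ₀ → ∀ T : ℝ, 0 < T → T ≤ 1 →
        (∀ σ : ℝ, 0 ≤ σ → σ ≤ s → ∀ u v : ℝ → 𝓢'(Space d, ℂ),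
          MemL1X φ χ T (σ - 1) u → MemL1X φ χ T (s - 1) v →
          ∃ w : ℝ → 𝓢'(Space d, ℂ), IsProductOn φ T u v w ∧
            MemL1Y φ χ T (σ - δ) w ∧
            normL1Y φ χ T (σ - δ) w ≤
              ENNReal.ofReal (C * T ^ δ) * normL1X φ χ T (σ - 1) u * normL1X φ χ T (s - 1) v) ∧
        (∀ σ : ℝ, 0 ≤ σ → σ ≤ s - 1 → ∀ u v : ℝ → 𝓢'(Space d, ℂ),
          MemL1X φ χ T σ u → MemL1X φ χ T (s - 2) v →
          ∃ w : ℝ → 𝓢'(Space d, ℂ), IsProductOn φ T u v w ∧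
            MemL1Y φ χ T (σ - δ) w ∧
            normL1Y φ χ T (σ - δ) w ≤
              ENNReal.ofReal (C * T ^ δ) * normL1X φ χ T σ u * normL1X φ χ T (s - 2) v) := by
  obtain ⟨C, hC, h⟩ := exists_product_estimate φ χ hs
  have hd0 : (0 : ℝ) ≤ d := Nat.cast_nonneg d
  have key : ∀ σ δ α β T : ℝ, α + β = σ + s - 2 → σ - 1 ≤ α → σ - 1 ≤ β → |β| ≤ s + 1 →
      0 ≤ σ → σ ≤ s → 0 ≤ δ → δ ≤ 1 / 2 → 0 < T → T ≤ 1 → ∀ u v : ℝ → 𝓢'(Space d, ℂ),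
      MemL1X φ χ T α u → MemL1X φ χ T β v →
      ∃ w : ℝ → 𝓢'(Space d, ℂ), IsProductOn φ T u v w ∧ MemL1Y φ χ T (σ - δ) w ∧
        normL1Y φ χ T (σ - δ) w ≤
          ENNReal.ofReal ((C.toReal + 1) * T ^ δ) * normL1X φ χ T α u * normL1X φ χ T β v := by
    intro σ δ α β T hsum hα hβ hβ' hσ hσs hδ hδ' hT0 hT u v hu hv
    obtain ⟨w, h1, h2, h3⟩ := h σ δ α β T hsum hα hβ hβ' hσ hσs hδ hδ' hT u v hu hv
    have hle : normL1Y φ χ T (σ - δ) w ≤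
        ENNReal.ofReal ((C.toReal + 1) * T ^ δ) * normL1X φ χ T α u * normL1X φ χ T β v := by
      refine h3.trans ?_
      rw [ENNReal.ofReal_mul (by positivity), ← ENNReal.ofReal_rpow_of_pos hT0,
        ENNReal.ofReal_add ENNReal.toReal_nonneg zero_le_one, ENNReal.ofReal_toReal hC]
      gcongr
      exact le_self_add
    refine ⟨w, h1, ⟨h2, hle.trans_lt ?_⟩, hle⟩
    exact ENNReal.mul_lt_top (ENNReal.mul_lt_top ENNReal.ofReal_lt_top hu.2) hv.2
  -- The threshold `1/2` is that of the interpolation; the added `1` makes the constant positive.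
  refine ⟨1 / 2, by norm_num, C.toReal + 1, by positivity, fun δ hδ hδ' T hT0 hT => ⟨?_, ?_⟩⟩
  · intro σ hσ hσs u v hu hv
    exact key σ δ (σ - 1) (s - 1) T (by ring) le_rfl (by linarith)
      (abs_le.2 ⟨by linarith, by linarith⟩) hσ hσs hδ hδ' hT0 hT u v hu hv
  -- With `β = s - 2`, the requirement `β ≥ σ - 1` is exactly `σ ≤ s - 1`.
  · intro σ hσ hσs u v hu hv
    exact key σ δ σ (s - 2) T (by ring) (by linarith) (by linarith)
      (abs_le.2 ⟨by linarith, by linarith⟩) hσ (by linarith) hδ hδ' hT0 hT u v hu hv
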